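/- Let $k$ be a field and let $B=\bigoplus_{d\ge 0}B_d$ be a noetherian graded commutative $k$-algebra with $B_0=k$, with maximal ideal $\mathfrak m=B_+=\bigoplus_{d>0}B_d$ and $n=\dim B$. All modules are $\mathbb Z$-graded and need not be finitely generated, and maps of modules preserve degree. The *end* of a graded module $M$, $\operatorname{end}M\in\mathbb Z\cup\{\pm\infty\}$, is the supremum of the degrees $d$ with $M_d\neq 0$ (so $\operatorname{end}0=-\infty$), and we use the convention $\infty+(-\infty)=-\infty$. Put $t^B_p(M)=\operatorname{end}\operatorname{Tor}^B_p(M,k)$. The local cohomology $H^p_{\mathfrak m}(M)$ is graded as the cohomology of the Čech complex on homogeneous elements that generate $\mathfrak m$ up to radical, and $\operatorname{depth}M=\inf\{p: H^p_{\mathfrak m}(M)\ne 0\}$ (so $\operatorname{depth}0=\infty$). For a homogeneous ideal $I$ of $B$ put $$T_j(I)=\max\{t^B_{i_1}(I)+\cdots+t^B_{i_r}(I)\ :\ r\ge 1,\ i_1,\dots,i_r>0,\ i_1+\cdots+i_r=j\}\quad (j>0).$$ **Theorem.** Let $(L_j,d_j)_{j\in\mathbb Z}$, $d_j:L_j\to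 L_{j-1}$, be a complex of graded $B$-modules with homology $H_j=H_j(L)$, and let $i$ be an integer such that for all $j\le i$ the module $L_j$ is bounded below (zero in all sufficiently negative degrees) and has depth at least $n$ (that is, $H^p_{\mathfrak m}(L_j)=0$ for $p<n$). Let $I\subset B$ be a homogeneous ideal with $\dim B/I=0$ such that $IH_j=0$ for all $j\le i$, and suppose that $H_j=0$ for $j\ll 0$. Then $$\operatorname{end}H_i\ \le\ \max\Bigl\{\operatorname{end}H^n_{\mathfrak m}(L_i),\ \sup_{j<i}\bigl\{\operatorname{end}H^n_{\mathfrak m}(L_j)+T_{i-j}(I)\bigr\}\Bigr\}+t^B_n(B/I).$$ -/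

import Mathlib

universe u v w

namespace GradedHomology

open scoped TensorProduct

/-- The end of a `ℤ`-graded module with homogeneous components `gr d`: the supremum of the degrees
`d` with `gr d ≠ 0`. It is `⊥` for the zero module and `⊤` if these degrees are not bounded above.
In `EReal` one has `⊤ + ⊥ = ⊥`. -/
noncomputable def gradedEnd {M : Type v} [AddCommGroup M] (gr : ℤ → AddSubgroup M) : EReal :=
  ⨆ (d : ℤ) (_ : gr d ≠ ⊥), ((d : ℝ) : EReal)

section Subquotient

variable {B : Type u} [CommRing B] {X : Type v} [AddCommGroup X] [Module B X]

/-- The module `Z / (Z ∩ D)`; for `D ≤ Z`, the module of cycles `Z` modulo boundaries `D`. -/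
abbrev Subquot (Z D : Submodule B X) : Type v := ↥Z ⧸ D.submoduleOf Z

/-- The grading which a subquotient inherits from the ambient module: the degree `e` component
consists of the classes of the elements of `Z` that are homogeneous of degree `e`. -/
def subquotGrading (gr : ℤ → AddSubgroup X) (Z D : Submodule B X) (e : ℤ) :
    AddSubgroup (Subquot Z D) :=
  ((gr e).comap Z.subtype.toAddMonoidHom).map (D.submoduleOf Z).mkQ.toAddMonoidHom

end Subquotient

section GradedRing

variable {k : Type w} [Field k] {B : Type u} [CommRing B] [Algebra k B]

/-- The ideal `B₊` (also called `𝔪`) generated by the homogeneous elements of positive degree. -/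
def irrelevantIdeal (𝒜 : ℤ → Submodule k B) : Ideal B :=
  Ideal.span {b | ∃ d : ℤ, 0 < d ∧ b ∈ 𝒜 d}

/-- The grading of an ideal `I` by `I ∩ B_d`. -/
def idealGrading (𝒜 : ℤ → Submodule k B) (I : Ideal B) (d : ℤ) : AddSubgroup I :=
  (𝒜 d).toAddSubgroup.comap I.subtype.toAddMonoidHom

/-- The grading of `B / I` by the images of the `B_d`. -/
def quotientGrading (𝒜 : ℤ → Submodule k B) (I : Ideal B) (d : ℤ) : AddSubgroup (B ⧸ I) :=
  (𝒜 d).toAddSubgroup.map (Ideal.Quotient.mk I).toAddMonoidHom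

/-! ### Graded Tor -/

/-- The grading of the free module on a basis `ι` whose element `s` has degree `deg s`. -/
def freeGrading (𝒜 : ℤ → Submodule k B) {ι : Type u} (deg : ι → ℤ) (e : ℤ) :
    AddSubgroup (ι →₀ B) where
  carrier := {y | ∀ s, y s ∈ 𝒜 (e - deg s)}
  zero_mem' := fun _ => Submodule.zero_mem _
  add_mem' := fun hx hy s => Submodule.add_mem _ (hx s) (hy s)
  neg_mem' := fun hx s => Submodule.neg_mem _ (hx s)

/-- A stage of a graded free resolution: a free module with a basis `ι`, the degrees of the basis
elements, and the submodule `rel` which the next stage has to cover. -/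
structure Stage (B : Type u) [CommRing B] where
  ι : Type u
  deg : ι → ℤ
  rel : Submodule B (ι →₀ B)

/-- The free module on all homogeneous elements of `M`, with the kernel of its map to `M`. -/
noncomputable def Stage.first {M : Type u} [AddCommGroup M] [Module B M]
    (ℳ : ℤ → AddSubgroup M) : Stage B where
  ι := Σ d : ℤ, ℳ d
  deg := Sigma.fst
  rel := LinearMap.ker (Finsupp.linearCombination B (fun s : Σ d : ℤ, ℳ d => (s.2 : M)))

/-- The index set of the next stage: the homogeneous elements of `s.rel`. -/
abbrev Stage.NextIndex (𝒜 : ℤ → Submodule k B) (s : Stage B) : Type u :=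
  Σ e : ℤ, ↥(freeGrading 𝒜 s.deg e ⊓ s.rel.toAddSubgroup)

/-- The map from the free module on the homogeneous elements of `s.rel` onto `s.rel`. -/
noncomputable def Stage.diff (𝒜 : ℤ → Submodule k B) (s : Stage B) :
    (s.NextIndex 𝒜 →₀ B) →ₗ[B] (s.ι →₀ B) :=
  Finsupp.linearCombination B (fun t => (t.2 : s.ι →₀ B))

/-- The free module on all homogeneous elements of `s.rel`, with the kernel of its map to
`s.rel`. -/
noncomputable def Stage.next (𝒜 : ℤ → Submodule k B) (s : Stage B) : Stage B where
  ι := s.NextIndex 𝒜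
  deg := Sigma.fst
  rel := LinearMap.ker (s.diff 𝒜)

/-- The functorial graded free resolution of a graded module `M`: in every step one takes the free
module on all homogeneous elements of the previous kernel. -/
noncomputable def resStage (𝒜 : ℤ → Submodule k B) {M : Type u} [AddCommGroup M] [Module B M]
    (ℳ : ℤ → AddSubgroup M) : ℕ → Stage B
  | 0 => Stage.first ℳ
  | p + 1 => (resStage 𝒜 ℳ p).next 𝒜

section Tor

variable (𝒜 : ℤ → Submodule k B) {M : Type u} [AddCommGroup M] [Module B M]
  (ℳ : ℤ → AddSubgroup M)

/-- The `p`-th term of the resolution. -/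
abbrev Res (p : ℕ) : Type u := (resStage 𝒜 ℳ p).ι →₀ B

/-- The differential of the resolution. -/
noncomputable def resDiff (p : ℕ) : Res 𝒜 ℳ (p + 1) →ₗ[B] Res 𝒜 ℳ p :=
  (resStage 𝒜 ℳ p).diff 𝒜

/-- The `p`-th term of the resolution tensored with `k = B / B₊`. -/
abbrev ResTensor (p : ℕ) : Type u := Res 𝒜 ℳ p ⊗[B] (B ⧸ irrelevantIdeal 𝒜)

/-- The differential of the resolution tensored with `k`. -/
noncomputable def resTensorDiff (p : ℕ) : ResTensor 𝒜 ℳ (p + 1) →ₗ[B] ResTensor 𝒜 ℳ p :=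
  (resDiff 𝒜 ℳ p).rTensor (B ⧸ irrelevantIdeal 𝒜)

/-- The grading of `F_p ⊗ k`, where `k` sits in degree `0`. -/
noncomputable def resTensorGrading (p : ℕ) (e : ℤ) : AddSubgroup (ResTensor 𝒜 ℳ p) :=
  (freeGrading 𝒜 (resStage 𝒜 ℳ p).deg e).map
    ((TensorProduct.mk B (Res 𝒜 ℳ p) (B ⧸ irrelevantIdeal 𝒜)).flip 1).toAddMonoidHom

/-- The cycles of `F ⊗ k`. -/
noncomputable def torCycles : (p : ℕ) → Submodule B (ResTensor 𝒜 ℳ p)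
  | 0 => ⊤
  | p + 1 => LinearMap.ker (resTensorDiff 𝒜 ℳ p)

/-- The boundaries of `F ⊗ k`. -/
noncomputable def torBoundaries (p : ℕ) : Submodule B (ResTensor 𝒜 ℳ p) :=
  LinearMap.range (resTensorDiff 𝒜 ℳ p)

/-- `Tor_p^B(M, k)`. -/
abbrev Tor (p : ℕ) : Type u :=
  Subquot (B := B) (X := ResTensor 𝒜 ℳ p) (torCycles 𝒜 ℳ p) (torBoundaries 𝒜 ℳ p)

/-- The internal grading of `Tor_p^B(M, k)`. -/
noncomputable def torGrading (p : ℕ) : ℤ → AddSubgroup (Tor 𝒜 ℳ p) :=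
  subquotGrading (resTensorGrading 𝒜 ℳ p) (torCycles 𝒜 ℳ p) (torBoundaries 𝒜 ℳ p)

/-- `t_p^B(M)`, the end of `Tor_p^B(M, k)`. -/
noncomputable def torEnd (p : ℕ) : EReal := gradedEnd (torGrading 𝒜 ℳ p)

end Tor

/-- `T_j(I)`: for `j > 0`, the maximum of `t_{i₁}(I) + ⋯ + t_{i_r}(I)` over all compositions
`j = i₁ + ⋯ + i_r` into positive parts; `-∞` for `j ≤ 0`. -/
noncomputable def maxTorSum (𝒜 : ℤ → Submodule k B) (I : Ideal B) (j : ℤ) : EReal :=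
  if 0 < j then
    ⨆ c : Composition j.toNat, (c.blocks.map (torEnd 𝒜 (idealGrading 𝒜 I))).sum
  else ⊥

/-! ### Graded local cohomology through the Čech complex -/

section Cech

/-- Homogeneous elements `x₁, …, x_r` which generate `B₊` up to radical. -/
structure IsCechFamily (𝒜 : ℤ → Submodule k B) {r : ℕ} (x : Fin r → B) : Prop where
  homogeneous : ∀ a, ∃ d : ℤ, x a ∈ 𝒜 d
  radical_eq : (Ideal.span (Set.range x)).radical = irrelevantIdeal 𝒜

variable {r : ℕ} (x : Fin r → B) (M : Type v) [AddCommGroup M] [Module B M]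

/-- The multiplicative set generated by the `x_a`, `a ∈ S`. -/
def cechMonoid (S : Finset (Fin r)) : Submonoid B := Submonoid.closure (x '' S)

theorem cechMonoid_mono {S T : Finset (Fin r)} (h : S ⊆ T) : cechMonoid x S ≤ cechMonoid x T :=
  Submonoid.closure_mono (Set.image_mono (Finset.coe_subset.2 h))

/-- The localization of `M` in which the `x_a`, `a ∈ S`, are inverted. -/
abbrev CechLoc (S : Finset (Fin r)) : Type (max u v) := LocalizedModule (cechMonoid x S) M

/-- The localization map `M_S → M_T` for `S ⊆ T`. -/
noncomputable def cechRes {S T : Finset (Fin r)} (h : S ⊆ T) :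
    CechLoc x M S →ₗ[B] CechLoc x M T :=
  IsLocalizedModule.liftOfLE (cechMonoid x S) (cechMonoid x T) (cechMonoid_mono x h)
    (LocalizedModule.mkLinearMap (cechMonoid x S) M)
    (LocalizedModule.mkLinearMap (cechMonoid x T) M)

/-- The `p`-th term of the Čech complex. -/
abbrev Cech (p : ℕ) : Type (max u v) :=
  (S : {S : Finset (Fin r) // S.card = p}) → CechLoc x M S.1

/-- The differential of the Čech complex,
`(d α)_T = ∑_{a ∈ T} (-1)^{#{b ∈ T | b < a}} α_{T \ a}`. -/
noncomputable def cechDiff (p : ℕ) : Cech x M p →ₗ[B] Cech x M (p + 1) :=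
  LinearMap.pi fun T => ∑ a : {a // a ∈ T.1},
    ((-1 : ℤ) ^ (T.1.filter (fun b => b < a.1)).card) •
      (cechRes x M (T.1.erase_subset a.1) ∘ₗ
        LinearMap.proj (R := B)
          (φ := fun S : {S : Finset (Fin r) // S.card = p} => CechLoc x M S.1)
          ⟨T.1.erase a.1, by rw [Finset.card_erase_of_mem a.2, T.2, Nat.add_sub_cancel]⟩)

/-- The coboundaries of the Čech complex. -/
noncomputable def cechBoundaries : (p : ℕ) → Submodule B (Cech x M p)
  | 0 => ⊥
  | p + 1 => LinearMap.range (cechDiff x M p)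

/-- The local cohomology module `H^p_𝔪(M)`, computed on the family `x`. -/
abbrev LocCoh (p : ℕ) : Type (max u v) :=
  Subquot (LinearMap.ker (cechDiff x M p)) (cechBoundaries x M p)

/-- The depth of a module which need not be finitely generated, that is
`inf {p | H^p_𝔪(M) ≠ 0}`; it is `⊤` if there is no such `p`, in particular for `M = 0`. -/
noncomputable def lcDepth : ℕ∞ := ⨅ (p : ℕ) (_ : Nontrivial (LocCoh x M p)), (p : ℕ∞)

variable {M}
variable (𝒜 : ℤ → Submodule k B) [GradedAlgebra 𝒜]
  (ℳ : ℤ → AddSubgroup M) [SetLike.GradedSMul 𝒜 ℳ]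

/-- The grading of a localization: the component of degree `d` consists of the fractions `m / s`
with `s` homogeneous of some degree `a` and `m` homogeneous of degree `a + d`. -/
def locGrading (S : Finset (Fin r)) (d : ℤ) : AddSubgroup (CechLoc x M S) where
  carrier := {y | ∃ (a : ℤ) (m : M) (s : cechMonoid x S),
    (s : B) ∈ 𝒜 a ∧ m ∈ ℳ (a + d) ∧ y = LocalizedModule.mk m s}
  zero_mem' := ⟨0, 0, 1, SetLike.GradedOne.one_mem, AddSubgroup.zero_mem _, by simp⟩
  add_mem' := by
    rintro _ _ ⟨a, m, s, hs, hm, rfl⟩ ⟨b, m', s', hs', hm', rfl⟩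
    refine ⟨a + b, s' • m + s • m', s * s', SetLike.GradedMul.mul_mem hs hs',
      AddSubgroup.add_mem _ ?_ ?_, LocalizedModule.mk_add_mk⟩
    · have h : (s' : B) • m ∈ ℳ (b +ᵥ (a + d)) := SetLike.GradedSMul.smul_mem hs' hm
      have e : b +ᵥ (a + d) = a + b + d := by rw [vadd_eq_add]; ring
      rwa [e] at h
    · have h : (s : B) • m' ∈ ℳ (a +ᵥ (b + d)) := SetLike.GradedSMul.smul_mem hs hm'
      have e : a +ᵥ (b + d) = a + b + d := by rw [vadd_eq_add]; ring
      rwa [e] at h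
  neg_mem' := by
    rintro _ ⟨a, m, s, hs, hm, rfl⟩
    exact ⟨a, -m, s, hs, AddSubgroup.neg_mem _ hm, LocalizedModule.mk_neg.symm⟩

/-- The grading of the terms of the Čech complex. -/
def cechGrading (p : ℕ) (d : ℤ) : AddSubgroup (Cech x M p) :=
  AddSubgroup.pi Set.univ fun S => locGrading x 𝒜 ℳ S.1 d

/-- `end H^p_𝔪(M)`. -/
noncomputable def locCohEnd (p : ℕ) : EReal :=
  gradedEnd (subquotGrading (cechGrading x 𝒜 ℳ p)
    (LinearMap.ker (cechDiff x M p)) (cechBoundaries x M p))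

end Cech

/-! ### Homology of a complex of graded modules -/

section Complex

variable (L : ChainComplex (ModuleCat.{v} B) ℤ)

/-- The cycles `Z_j` of `L`. -/
def cycles (j : ℤ) : Submodule B (L.X j) := LinearMap.ker (L.d j (j - 1)).hom

/-- The boundaries of `L` in homological degree `j`. -/
def boundaries (j : ℤ) : Submodule B (L.X j) := LinearMap.range (L.d (j + 1) j).hom

/-- The homology `H_j` of `L`. -/
abbrev Homology (j : ℤ) : Type v := Subquot (cycles L j) (boundaries L j)

/-- `end H_j`, for the grading of `H_j` induced by the grading of `L_j`. -/
noncomputable def homologyEnd (ℒ : (j : ℤ) → ℤ → AddSubgroup (L.X j)) (j : ℤ) : EReal :=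
  gradedEnd (subquotGrading (ℒ j) (cycles L j) (boundaries L j))

end Complex

end GradedRing

end GradedHomology

set_option linter.unusedSectionVars false

namespace GradedHomology

open scoped TensorProduct

section Cech

variable {B : Type u} [CommRing B] {r : ℕ} (x : Fin r → B)
  {M : Type v} [AddCommGroup M] [Module B M]

/-! ### The Čech complex -/

/-! Let `Z` be the cycles of `L_i`. As `I` kills `H_i`, the homology `H_i` is a quotient of `Z / I Z
= Tor_0(B / I, Z)`. Tensor a free resolution `F` of `B / I` with the Čech complex of `Z`. Since `dim
B / I = 0`, powers of the Čech elements lie in `I`, so `F ⊗ Č^q` is exact for `q > 0`, and the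
degree `e` part of `Z / I Z` vanishes as soon as that of `Tor_p(B / I, H^p(Z))` does for every `p`
(`exists_coefMap_eq_of_staircase`). Each `H^p(Z)` is `𝔪`-torsion, so a degree of this `Tor_p` is a
degree of `H^p(Z)` plus a degree of `Tor_p(B / I, k)` (`FreeRes.exists_coefMap_eq_of_torsion`).

The local cohomology of `Z` comes from `0 → Z_j → L_j → D_{j-1} → 0` and `0 → D_{j-1} → Z_{j-1} →
H_{j-1} → 0`, with `D` the boundaries. Each `H_j` with `j ≤ i` is torsion, so it has no local
cohomology beyond `H^0(H_j) = H_j`. With the depth hypothesis, a degree of `H^p(Z_i)` with `p ≤ n`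
is either a degree of `H^n(L_i)`, with `p = n`, or a degree of `H_{i-p+1}`, with `p ≥ 2`
(`cechVanishAt_cycles`). For `p > n` there is nothing, by Grothendieck vanishing.

As `Tor_p(B / I, k) = Tor_{p-1}(I, k)` for `p ≥ 2`, a degree of `H_i` is either a degree of
`H^n(L_i)` plus one of `Tor_n(B / I, k)`, or a degree of some `H_j`, `j < i`, plus one of
`Tor_{i-j}(I, k)` (`exists_degree_of_homology_ne_bot`). Iterating ends because `H_j = 0` for `j ≪
0`. The lengths of the descents form a composition, which gives `T_{i-j}(I)`, and the last step
gives `t_n(B / I)` once.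

Everything is phrased as vanishing in one degree, so that infinite ends enter only in the final
comparison. The canonical resolutions are far from minimal; instead of minimality one uses a
homotopy that contracts `F` modulo `𝔪 F` in the degrees where `Tor(B / I, k)` vanishes. -/

theorem cechRes_mk {S T : Finset (Fin r)} (h : S ⊆ T) (m : M) (s : cechMonoid x S) :
    cechRes x M h (LocalizedModule.mk m s) =
      LocalizedModule.mk m ⟨s.1, cechMonoid_mono x h s.2⟩ := by
  rw [IsLocalizedModule.mk_eq_mk', IsLocalizedModule.mk_eq_mk', cechRes,
    IsLocalizedModule.liftOfLE_mk']

theorem cechRes_cechRes {S T U : Finset (Fin r)} (h : S ⊆ T) (h' : T ⊆ U) (y : CechLoc x M S) :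
    cechRes x M h' (cechRes x M h y) = cechRes x M (h.trans h') y := by
  induction y using LocalizedModule.induction_on with
  | h m s => rw [cechRes_mk, cechRes_mk, cechRes_mk]

/-- The sign with which the component `T \ a` enters the component `T` of a Čech coboundary. -/
def cechSign (B : Type u) [CommRing B] (a : Fin r) (T : Finset (Fin r)) : B := (-1) ^ (T.filter (fun b => b < a)).card

theorem cechSign_mul_self (a : Fin r) (T : Finset (Fin r)) :
    cechSign B a T * cechSign B a T = 1 := by
  rw [cechSign, ← mul_pow]; simp

theorem cechSign_erase_self (a : Fin r) (T : Finset (Fin r)) :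
    cechSign B a (T.erase a) = cechSign B a T := by
  unfold cechSign
  congr 2
  ext c
  simp only [Finset.mem_filter, Finset.mem_erase]
  constructor
  · rintro ⟨⟨-, h⟩, h'⟩; exact ⟨h, h'⟩
  · rintro ⟨h, h'⟩; exact ⟨⟨h'.ne, h⟩, h'⟩

theorem cechSign_erase_of_lt {a b : Fin r} {T : Finset (Fin r)} (hb : b ∈ T) (h : b < a) :
    cechSign B a (T.erase b) = -cechSign B a T := by
  unfold cechSign
  rw [Finset.filter_erase]
  have hm : b ∈ T.filter (fun c => c < a) := Finset.mem_filter.2 ⟨hb, h⟩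
  conv_rhs => rw [← Finset.card_erase_add_one hm, pow_succ]
  ring

theorem cechSign_erase_of_gt {a b : Fin r} {T : Finset (Fin r)} (h : a < b) :
    cechSign B a (T.erase b) = cechSign B a T := by
  unfold cechSign
  congr 2
  rw [Finset.filter_erase, Finset.erase_eq_of_notMem]
  simp [h.le]

/-- Removing the smaller index flips the sign attached to the larger one, while removing the larger
index changes nothing. This is the source of `d² = 0`. -/
theorem cechSign_mul_cechSign_erase {a b : Fin r} {T : Finset (Fin r)} (ha : a ∈ T) (hb : b ∈ T)
    (hab : a ≠ b) :
    cechSign B a T * cechSign B b (T.erase a) = -(cechSign B b T * cechSign B a (T.erase b)) := by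
  rcases lt_or_gt_of_ne hab with h | h
  · rw [cechSign_erase_of_lt ha h, cechSign_erase_of_gt h]; ring
  · rw [cechSign_erase_of_gt h, cechSign_erase_of_lt hb h]; ring

/-- The extension by zero of a Čech cochain to all subsets. -/
noncomputable def cechExt {p : ℕ} (α : Cech x M p) (S : Finset (Fin r)) : CechLoc x M S :=
  if h : S.card = p then α ⟨S, h⟩ else 0

/-- The Čech differential on families indexed by all subsets. -/
noncomputable def cechTotal (α : (S : Finset (Fin r)) → CechLoc x M S) (T : Finset (Fin r)) :
    CechLoc x M T :=
  ∑ a ∈ T, cechSign B a T • cechRes x M (T.erase_subset a) (α (T.erase a))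

theorem cechExt_of_card {p : ℕ} (α : Cech x M p) {S : Finset (Fin r)} (h : S.card = p) :
    cechExt x α S = α ⟨S, h⟩ := dif_pos h

theorem cechExt_apply {p : ℕ} (α : Cech x M p) (S : {S : Finset (Fin r) // S.card = p}) :
    cechExt x α S.1 = α S := dif_pos S.2

theorem cechDiff_apply {p : ℕ} (α : Cech x M p) (T : {S : Finset (Fin r) // S.card = p + 1}) :
    cechDiff x M p α T = cechTotal x (cechExt x α) T.1 := by
  unfold cechDiff cechTotal
  rw [LinearMap.pi_apply, LinearMap.sum_apply]
  rw [← Finset.sum_coe_sort T.1 fun a =>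
    cechSign B a T.1 • cechRes x M (T.1.erase_subset a) (cechExt x α (T.1.erase a))]
  refine Finset.sum_congr rfl fun a _ => ?_
  rw [cechExt_of_card x α (by rw [Finset.card_erase_of_mem a.2, T.2, Nat.add_sub_cancel]),
    show cechSign B a.1 T.1 = (((-1 : ℤ) ^ (T.1.filter (fun b => b < a.1)).card : ℤ) : B) by
      simp [cechSign], Int.cast_smul_eq_zsmul B]
  rfl

/-- Families on all subsets carry no proof of cardinality, so iterated differentials can be computed
there without transport between index types. -/
theorem cechExt_cechDiff {p : ℕ} (α : Cech x M p) :
    cechExt x (cechDiff x M p α) = cechTotal x (cechExt x α) := by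
  funext S
  by_cases h : S.card = p + 1
  · rw [cechExt_of_card x _ h, cechDiff_apply]
  · rw [cechExt, dif_neg h, cechTotal, eq_comm]
    refine Finset.sum_eq_zero fun a ha => ?_
    rw [cechExt, dif_neg, map_zero, smul_zero]
    rw [Finset.card_erase_of_mem ha]
    have := Finset.card_pos.2 ⟨a, ha⟩
    omega

theorem cechTotal_cechTotal (α : (S : Finset (Fin r)) → CechLoc x M S) (T : Finset (Fin r)) :
    cechTotal x (cechTotal x α) T = 0 := by
  classical
  -- A non-dependent way to write the restriction to `T`, so that the two orders of removal give
  -- literally the same term.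
  let g : Finset (Fin r) → CechLoc x M T := fun S => if h : S ⊆ T then cechRes x M h (α S) else 0
  have key : cechTotal x (cechTotal x α) T = ∑ a ∈ T, ∑ b ∈ T.erase a,
      (cechSign B a T * cechSign B b (T.erase a)) • g ((T.erase a).erase b) := by
    unfold cechTotal
    refine Finset.sum_congr rfl fun a _ => ?_
    rw [map_sum, Finset.smul_sum]
    refine Finset.sum_congr rfl fun b _ => ?_
    rw [map_smul, smul_smul, cechRes_cechRes]
    congr 1
    change _ = dite _ _ _
    rw [dif_pos (((T.erase a).erase_subset b).trans (T.erase_subset a))]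
  rw [key, Finset.sum_sigma']
  refine Finset.sum_involution (fun q _ => ⟨q.2, q.1⟩) ?_ ?_ ?_ ?_
  · rintro ⟨a, b⟩ h
    simp only [Finset.mem_sigma, Finset.mem_erase] at h
    dsimp only
    rw [cechSign_mul_cechSign_erase h.1 h.2.2 (Ne.symm h.2.1), Finset.erase_right_comm, neg_smul,
      neg_add_cancel]
  · rintro ⟨a, b⟩ h _ h'
    simp only [Finset.mem_sigma, Finset.mem_erase] at h
    simp only [Sigma.mk.injEq, heq_eq_eq] at h'
    exact h.2.1 h'.1
  · rintro ⟨a, b⟩ h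
    simp only [Finset.mem_sigma, Finset.mem_erase] at h ⊢
    exact ⟨h.2.2, Ne.symm h.2.1, h.1⟩
  · rintro ⟨a, b⟩ h
    rfl

theorem cechDiff_cechDiff {p : ℕ} (α : Cech x M p) :
    cechDiff x M (p + 1) (cechDiff x M p α) = 0 := by
  funext T
  rw [cechDiff_apply, cechExt_cechDiff, cechTotal_cechTotal]
  rfl

theorem cechBoundaries_le_ker (p : ℕ) :
    cechBoundaries x M p ≤ LinearMap.ker (cechDiff x M p) := by
  cases p with
  | zero => exact bot_le
  | succ p =>
    rintro _ ⟨α, rfl⟩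
    exact cechDiff_cechDiff x α

/-! ### Powers of the elements of the family kill the Čech cohomology -/

theorem mem_cechMonoid_insert {a : Fin r} {T : Finset (Fin r)} {t : B}
    (ht : t ∈ cechMonoid x (insert a T)) : ∃ s ∈ cechMonoid x T, ∃ K : ℕ, t = x a ^ K * s := by
  unfold cechMonoid at ht
  rw [Finset.coe_insert, Set.image_insert_eq, Set.insert_eq, Submonoid.closure_union,
    Submonoid.mem_sup] at ht
  obtain ⟨y, hy, z, hz, rfl⟩ := ht
  obtain ⟨K, rfl⟩ := Submonoid.mem_closure_singleton.1 hy
  exact ⟨z, hz, K, rfl⟩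

theorem mem_cechMonoid {a : Fin r} {T : Finset (Fin r)} (ha : a ∈ T) : x a ∈ cechMonoid x T :=
  Submonoid.subset_closure ⟨a, ha, rfl⟩

/-- Up to elements already inverted in `M_S`, the only denominators in `M_T` are powers of `x a`. -/
theorem exists_pow_smul_eq_cechRes {S T : Finset (Fin r)} (h : S ⊆ T) {a : Fin r}
    (hT : T ⊆ insert a S) (y : CechLoc x M T) :
    ∃ K : ℕ, ∃ z : CechLoc x M S, cechRes x M h z = x a ^ K • y := by
  induction y using LocalizedModule.induction_on with
  | h m t =>
    obtain ⟨s, hs, K, hK⟩ := mem_cechMonoid_insert x (cechMonoid_mono x hT t.2)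
    refine ⟨K, LocalizedModule.mk m ⟨s, hs⟩, ?_⟩
    rw [cechRes_mk, LocalizedModule.smul'_mk, LocalizedModule.mk_eq]
    refine ⟨1, ?_⟩
    simp only [one_smul, Submonoid.smul_def, hK, smul_smul]
    rw [mul_comm]

theorem exists_pow_smul_eq_zero_of_cechRes {S T : Finset (Fin r)} (h : S ⊆ T) {a : Fin r}
    (hT : T ⊆ insert a S) {y : CechLoc x M S} (hy : cechRes x M h y = 0) :
    ∃ K : ℕ, x a ^ K • y = 0 := by
  induction y using LocalizedModule.induction_on with
  | h m t =>
    rw [cechRes_mk, ← LocalizedModule.zero_mk 1, LocalizedModule.mk_eq] at hy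
    obtain ⟨v, hv⟩ := hy
    obtain ⟨s, hs, K, hK⟩ := mem_cechMonoid_insert x (cechMonoid_mono x hT v.2)
    refine ⟨K, ?_⟩
    rw [LocalizedModule.smul'_mk, ← LocalizedModule.zero_mk 1, LocalizedModule.mk_eq]
    refine ⟨⟨s, hs⟩, ?_⟩
    simp only [one_smul, smul_zero, Submonoid.smul_def, hK, smul_smul] at hv ⊢
    rw [mul_comm]
    exact hv

theorem pow_smul_eq_zero_of_le {X : Type*} [AddCommGroup X] [Module B X] {b : B} {K K' : ℕ}
    (h : K ≤ K') {y : X} (hy : b ^ K • y = 0) : b ^ K' • y = 0 := by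
  rw [← Nat.sub_add_cancel h, pow_add, mul_smul, hy, smul_zero]

/-- After inverting `x a`, the Čech complex is contracted by `β_S = ± α_{S ∪ a}` for `a ∉ S`. There
are finitely many subsets, so all denominators can be cleared by one power of `x a`, and the
contraction then shows that a power of `x a` kills the class. -/
theorem exists_pow_smul_mem_cechBoundaries (a : Fin r) (p : ℕ) (α : Cech x M p)
    (hα : cechDiff x M p α = 0) : ∃ K : ℕ, x a ^ K • α ∈ cechBoundaries x M p := by
  classical
  have hD : ∀ T, cechTotal x (cechExt x α) T = 0 := fun T => by
    rw [← cechExt_cechDiff, hα]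
    unfold cechExt
    split_ifs <;> rfl
  choose K z hz using fun T : Finset (Fin r) =>
    exists_pow_smul_eq_cechRes x (T.erase_subset a) (a := a) (by
      intro b hb; by_cases h : b = a <;> simp [h, hb]) (cechExt x α T)
  obtain ⟨K0, hK0⟩ : ∃ K0, ∀ T, K T ≤ K0 := ⟨Finset.univ.sup K, fun T => Finset.le_sup (Finset.mem_univ T)⟩
  -- The factor with exponent `K0 - K` brings all components to the common power `x a ^ K0`.
  let β : (S : Finset (Fin r)) → CechLoc x M S := fun S =>
    if h : a ∈ S then 0 else
      cechSign B a S • x a ^ (K0 - K (insert a S)) •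
        cechRes x M (by rw [Finset.erase_insert h]) (z (insert a S))
  have hβ : ∀ T, a ∈ T → cechRes x M (T.erase_subset a) (β (T.erase a)) =
      cechSign B a T • x a ^ K0 • cechExt x α T := by
    intro T ha
    have h1 : β (T.erase a) = cechSign B a (T.erase a) • x a ^ (K0 - K (insert a (T.erase a))) •
        cechRes x M (by rw [Finset.erase_insert (Finset.notMem_erase a T)])
          (z (insert a (T.erase a))) := dif_neg (Finset.notMem_erase a T)
    have h2 : ∀ (U : Finset (Fin r)) (hU : U = T) (h : U.erase a ⊆ T.erase a),
        cechRes x M (T.erase_subset a) (x a ^ (K0 - K U) • cechRes x M h (z U)) =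
          x a ^ K0 • cechExt x α T := by
      rintro U rfl h
      rw [map_smul, cechRes_cechRes, hz, smul_smul, ← pow_add, Nat.sub_add_cancel (hK0 U)]
    rw [h1, map_smul, h2 _ (Finset.insert_erase ha), cechSign_erase_self]
  have hβ0 : ∀ S, a ∈ S → β S = 0 := fun S h => dif_pos h
  have hin : ∀ T, a ∈ T → cechTotal x β T = x a ^ K0 • cechExt x α T := by
    intro T ha
    rw [cechTotal, Finset.sum_eq_single a, hβ T ha, smul_smul, cechSign_mul_self, one_smul]
    · intro b hb hba
      rw [hβ0 _ (Finset.mem_erase.2 ⟨hba.symm, ha⟩), map_zero, smul_zero]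
    · exact fun h => absurd ha h
  have hout : ∀ T, ∃ K1 : ℕ, x a ^ K1 • (cechTotal x β T - x a ^ K0 • cechExt x α T) = 0 := by
    intro T
    by_cases ha : a ∈ T
    · exact ⟨0, by rw [hin T ha, sub_self, smul_zero]⟩
    -- For `a ∉ T` it suffices to compare in `M_{T ∪ a}`. There `D D β = 0` and `D α = 0` at `T ∪ a`
    -- agree, up to the factor `x a ^ K0`, in all terms except the one that removes `a`, by the case
    -- `a ∈ T`.
    · refine exists_pow_smul_eq_zero_of_cechRes x (Finset.subset_insert a T) subset_rfl ?_
      have hDD := cechTotal_cechTotal x β (insert a T)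
      have hDα := hD (insert a T)
      rw [cechTotal, Finset.sum_insert ha] at hDD hDα
      have e : ∀ (γ : (S : Finset (Fin r)) → CechLoc x M S),
          cechRes x M ((insert a T).erase_subset a) (γ ((insert a T).erase a)) =
          cechRes x M (Finset.subset_insert a T) (γ T) := by
        intro γ
        have : ∀ (U : Finset (Fin r)) (hU : U = T) (h : U ⊆ insert a T),
          cechRes x M h (γ U) = cechRes x M (Finset.subset_insert a T) (γ T) := by
          rintro U rfl h; rfl
        exact this _ (Finset.erase_insert ha) _
      rw [e] at hDD hDα
      rw [map_sub, map_smul]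
      have hs : ∑ b ∈ T, cechSign B b (insert a T) • cechRes x M ((insert a T).erase_subset b)
            (cechTotal x β ((insert a T).erase b)) =
          x a ^ K0 • ∑ b ∈ T, cechSign B b (insert a T) • cechRes x M ((insert a T).erase_subset b)
            (cechExt x α ((insert a T).erase b)) := by
        rw [Finset.smul_sum]
        refine Finset.sum_congr rfl fun b hb => ?_
        have hba : b ≠ a := fun h => ha (h ▸ hb)
        rw [hin _ (Finset.mem_erase.2 ⟨hba.symm, Finset.mem_insert_self a T⟩), map_smul,
          smul_comm]
      rw [hs] at hDD
      have h3 := congrArg (fun y => x a ^ K0 • y) hDα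
      simp only [smul_add, smul_zero] at h3
      have h4 : cechSign B a (insert a T) • (cechRes x M (Finset.subset_insert a T) (cechTotal x β T) -
          x a ^ K0 • cechRes x M (Finset.subset_insert a T) (cechExt x α T)) = 0 := by
        rw [smul_sub, smul_comm (cechSign B a (insert a T)) (x a ^ K0)]
        rw [eq_neg_of_add_eq_zero_left hDD, eq_neg_of_add_eq_zero_left h3, sub_self]
      have h5 := congrArg (fun y => cechSign B a (insert a T) • y) h4
      simpa only [smul_smul, cechSign_mul_self, one_smul, smul_zero] using h5
  choose K1 hK1 using hout
  obtain ⟨K2, hK2⟩ : ∃ K2, ∀ T, K1 T ≤ K2 := ⟨Finset.univ.sup K1, fun T => Finset.le_sup (Finset.mem_univ T)⟩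
  have hfin : ∀ T, x a ^ (K2 + K0) • cechExt x α T = x a ^ K2 • cechTotal x β T := by
    intro T
    have := pow_smul_eq_zero_of_le (hK2 T) (hK1 T)
    rw [smul_sub, sub_eq_zero, smul_smul, ← pow_add] at this
    exact this.symm
  refine ⟨K2 + K0, ?_⟩
  cases p with
  | zero =>
    refine (Submodule.mem_bot _).2 (funext fun S => ?_)
    rw [Pi.smul_apply, ← cechExt_apply x α S, hfin, cechTotal, Finset.sum_eq_zero, smul_zero]
    · rfl
    · intro b hb
      rw [Finset.card_eq_zero.1 S.2] at hb
      simp at hb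
  | succ p =>
    refine ⟨fun S => x a ^ K2 • β S.1, funext fun T => ?_⟩
    rw [cechDiff_apply, Pi.smul_apply, ← cechExt_apply x α T, hfin, cechTotal, cechTotal,
      Finset.smul_sum]
    refine Finset.sum_congr rfl fun b hb => ?_
    rw [cechExt_of_card x _ (by rw [Finset.card_erase_of_mem hb, T.2, Nat.add_sub_cancel]),
      map_smul, smul_comm]

end Cech

section CechFunctor

variable {B : Type u} [CommRing B] {r : ℕ} (x : Fin r → B)
  {M : Type*} [AddCommGroup M] [Module B M] {N : Type*} [AddCommGroup N] [Module B N]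
  {Q : Type*} [AddCommGroup Q] [Module B Q]

/-! ### Functoriality of the Čech complex -/

/-- The map induced on localizations. -/
noncomputable def locMap (f : M →ₗ[B] N) (S : Finset (Fin r)) :
    CechLoc x M S →ₗ[B] CechLoc x N S :=
  IsLocalizedModule.map (cechMonoid x S) (LocalizedModule.mkLinearMap _ M)
    (LocalizedModule.mkLinearMap _ N) f

theorem locMap_mk (f : M →ₗ[B] N) (S : Finset (Fin r)) (m : M) (s : cechMonoid x S) :
    locMap x f S (LocalizedModule.mk m s) = LocalizedModule.mk (f m) s :=
  IsLocalizedModule.map_LocalizedModules _ f m s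

theorem cechRes_locMap (f : M →ₗ[B] N) {S T : Finset (Fin r)} (h : S ⊆ T) (y : CechLoc x M S) :
    cechRes x N h (locMap x f S y) = locMap x f T (cechRes x M h y) := by
  induction y using LocalizedModule.induction_on with
  | h m s => rw [locMap_mk, cechRes_mk, cechRes_mk, locMap_mk]

theorem locMap_injective {f : M →ₗ[B] N} (hf : Function.Injective f) (S : Finset (Fin r)) :
    Function.Injective (locMap x f S) :=
  IsLocalizedModule.map_injective _ _ _ f hf

theorem locMap_surjective {f : M →ₗ[B] N} (hf : Function.Surjective f) (S : Finset (Fin r)) :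
    Function.Surjective (locMap x f S) :=
  IsLocalizedModule.map_surjective _ _ _ f hf

theorem locMap_exact {f : M →ₗ[B] N} {g : N →ₗ[B] Q} (h : Function.Exact f g)
    (S : Finset (Fin r)) : Function.Exact (locMap x f S) (locMap x g S) :=
  IsLocalizedModule.map_exact _ _ _ _ f g h

/-- The map induced on Čech cochains. -/
noncomputable def cechMap (f : M →ₗ[B] N) (p : ℕ) : Cech x M p →ₗ[B] Cech x N p :=
  LinearMap.pi fun S => locMap x f S.1 ∘ₗ LinearMap.proj S

theorem cechMap_apply (f : M →ₗ[B] N) (p : ℕ) (α : Cech x M p)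
    (S : {S : Finset (Fin r) // S.card = p}) : cechMap x f p α S = locMap x f S.1 (α S) := rfl

theorem cechDiff_cechMap (f : M →ₗ[B] N) (p : ℕ) (α : Cech x M p) :
    cechDiff x N p (cechMap x f p α) = cechMap x f (p + 1) (cechDiff x M p α) := by
  funext T
  rw [cechMap_apply, cechDiff_apply, cechDiff_apply, cechTotal, cechTotal, map_sum]
  refine Finset.sum_congr rfl fun a _ => ?_
  rw [map_smul, ← cechRes_locMap]
  congr 2
  unfold cechExt
  split_ifs
  · rfl
  · rw [map_zero]

theorem cechMap_injective {f : M →ₗ[B] N} (hf : Function.Injective f) (p : ℕ) :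
    Function.Injective (cechMap x f p) := fun _ _ h =>
  funext fun S => locMap_injective x hf S.1 (congrFun h S)

theorem cechMap_surjective {f : M →ₗ[B] N} (hf : Function.Surjective f) (p : ℕ) :
    Function.Surjective (cechMap x f p) := fun β => by
  choose α hα using fun S : {S : Finset (Fin r) // S.card = p} => locMap_surjective x hf S.1 (β S)
  exact ⟨α, funext hα⟩

theorem cechMap_exact {f : M →ₗ[B] N} {g : N →ₗ[B] Q} (h : Function.Exact f g) {p : ℕ}
    {β : Cech x N p} (hβ : cechMap x g p β = 0) : ∃ α, cechMap x f p α = β := by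
  choose α hα using fun S : {S : Finset (Fin r) // S.card = p} =>
    (locMap_exact x h S.1 (β S)).1 (congrFun hβ S)
  exact ⟨α, funext hα⟩

theorem cechMap_comp_eq_zero {f : M →ₗ[B] N} {g : N →ₗ[B] Q} (h : Function.Exact f g) {p : ℕ}
    (α : Cech x M p) : cechMap x g p (cechMap x f p α) = 0 :=
  funext fun S => (locMap_exact x h S.1 _).2 ⟨α S, rfl⟩

theorem cechMap_mem_cechBoundaries (f : M →ₗ[B] N) {p : ℕ} {α : Cech x M p}
    (hα : α ∈ cechBoundaries x M p) : cechMap x f p α ∈ cechBoundaries x N p := by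
  cases p with
  | zero => rw [(Submodule.mem_bot _).1 hα, map_zero]; exact zero_mem _
  | succ p =>
    obtain ⟨β, rfl⟩ := hα
    exact ⟨cechMap x f p β, cechDiff_cechMap x f p β⟩

/-- The exactness of the long cohomology sequence at `H^{p+1}` of the submodule. -/
theorem mem_cechBoundaries_of_connecting {f : M →ₗ[B] N} {g : N →ₗ[B] Q}
    (hf : Function.Injective f) (hg : Function.Surjective g) (h : Function.Exact f g) {p : ℕ}
    {α : Cech x M (p + 1)} {β : Cech x N p} (hβ : cechDiff x N p β = cechMap x f (p + 1) α)
    (hgβ : cechMap x g p β ∈ cechBoundaries x Q p) : α ∈ cechBoundaries x M (p + 1) := by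
  obtain ⟨γ, hγ, hγ'⟩ : ∃ γ ∈ cechBoundaries x N p, cechMap x g p γ = cechMap x g p β := by
    cases p with
    | zero => exact ⟨0, zero_mem _, by rw [(Submodule.mem_bot _).1 hgβ, map_zero]⟩
    | succ p =>
      obtain ⟨η, hη⟩ := hgβ
      obtain ⟨ξ, rfl⟩ := cechMap_surjective x hg p η
      exact ⟨cechDiff x N p ξ, ⟨ξ, rfl⟩, by rw [← cechDiff_cechMap, hη]⟩
  obtain ⟨ε, hε⟩ := cechMap_exact x h (β := β - γ) (by rw [map_sub, hγ', sub_self])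
  refine ⟨ε, cechMap_injective x hf _ ?_⟩
  rw [← cechDiff_cechMap, hε, map_sub, LinearMap.mem_ker.1 (cechBoundaries_le_ker x p hγ),
    sub_zero, hβ]

/-- The `p`-th Čech cohomology of `M` vanishes. -/
def CechVanish (M : Type*) [AddCommGroup M] [Module B M] (p : ℕ) : Prop :=
  ∀ α : Cech x M p, cechDiff x M p α = 0 → α ∈ cechBoundaries x M p

theorem CechVanish.of_exact {f : M →ₗ[B] N} {g : N →ₗ[B] Q}
    (hf : Function.Injective f) (hg : Function.Surjective g) (h : Function.Exact f g) {p : ℕ}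
    (hM : CechVanish x M p) (hQ : CechVanish x Q p) : CechVanish x N p := by
  intro β hβ
  obtain ⟨γ, hγ, hγ'⟩ : ∃ γ ∈ cechBoundaries x N p, cechMap x g p γ = cechMap x g p β := by
    have := hQ (cechMap x g p β) (by rw [cechDiff_cechMap, hβ, map_zero])
    cases p with
    | zero => exact ⟨0, zero_mem _, by rw [(Submodule.mem_bot _).1 this, map_zero]⟩
    | succ p =>
      obtain ⟨η, hη⟩ := this
      obtain ⟨ξ, rfl⟩ := cechMap_surjective x hg p η
      exact ⟨cechDiff x N p ξ, ⟨ξ, rfl⟩, by rw [← cechDiff_cechMap, hη]⟩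
  obtain ⟨α, hα⟩ := cechMap_exact x h (β := β - γ) (by rw [map_sub, hγ', sub_self])
  have hα0 : cechDiff x M p α = 0 := cechMap_injective x hf _ (by
    rw [← cechDiff_cechMap, hα, map_sub, hβ, LinearMap.mem_ker.1 (cechBoundaries_le_ker x p hγ),
      sub_zero, map_zero])
  have := cechMap_mem_cechBoundaries x f (hM α hα0)
  rw [hα] at this
  simpa using add_mem this hγ

theorem CechVanish.of_linearEquiv (e : M ≃ₗ[B] N) {p : ℕ} (hN : CechVanish x N p) :
    CechVanish x M p := by
  intro α hα
  have h := cechMap_mem_cechBoundaries x e.symm.toLinearMap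
    (hN (cechMap x e.toLinearMap p α) (by rw [cechDiff_cechMap, hα, map_zero]))
  convert h
  funext S
  rw [cechMap_apply, cechMap_apply]
  induction α S using LocalizedModule.induction_on with
  | h m s => rw [locMap_mk, locMap_mk]; simp

theorem subsingleton_cechLoc {S : Finset (Fin r)} {a : Fin r} (ha : a ∈ S)
    (h : ∀ m : M, ∃ K : ℕ, x a ^ K • m = 0) : Subsingleton (CechLoc x M S) := by
  refine subsingleton_of_forall_eq 0 fun y => ?_
  induction y using LocalizedModule.induction_on with
  | h m s =>
    obtain ⟨K, hK⟩ := h m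
    rw [← LocalizedModule.zero_mk 1, LocalizedModule.mk_eq]
    exact ⟨⟨x a ^ K, pow_mem (mem_cechMonoid x ha) K⟩, by simpa [Submonoid.smul_def] using hK⟩

theorem subsingleton_cech_succ (p : ℕ) (h : ∀ (a : Fin r) (m : M), ∃ K : ℕ, x a ^ K • m = 0) :
    Subsingleton (Cech x M (p + 1)) := by
  refine ⟨fun α β => funext fun S => ?_⟩
  obtain ⟨a, ha⟩ := Finset.card_pos.1 (S.2.symm ▸ Nat.succ_pos p : 0 < S.1.card)
  exact (subsingleton_cechLoc x ha (h a)).elim _ _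

/-! ### Vanishing of the Čech cohomology above the dimension -/

/-- A cochain consists of finitely many fractions, hence comes from a finitely generated submodule.
It is a cocycle there already, because localization preserves injections. -/
theorem CechVanish.of_submodules {p : ℕ}
    (h : ∀ M' : Submodule B M, M'.FG → CechVanish x M' p) : CechVanish x M p := by
  classical
  intro α hα
  have hex : ∀ S, ∃ M' : Submodule B M, M'.FG ∧ ∃ y, locMap x M'.subtype S.1 y = α S := by
    intro S
    induction α S using LocalizedModule.induction_on with
    | h m s =>
      exact ⟨Submodule.span B {m}, Submodule.fg_span_singleton m,
        LocalizedModule.mk ⟨m, Submodule.mem_span_singleton_self m⟩ s, by rw [locMap_mk]; rfl⟩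
  choose F hF y hy using hex
  have hle : ∀ S, F S ≤ ⨆ S, F S := le_iSup F
  have hfg : (⨆ S, F S).FG := Submodule.fg_iSup _ hF
  let β : Cech x ↥(⨆ S, F S) p := fun S => locMap x (Submodule.inclusion (hle S)) S.1 (y S)
  have hβ : cechMap x (⨆ S, F S).subtype p β = α := by
    funext S
    rw [cechMap_apply, ← hy]
    change locMap x _ _ (locMap x _ _ _) = _
    induction y S using LocalizedModule.induction_on with
    | h m s => rw [locMap_mk, locMap_mk, locMap_mk]; rfl
  have hβ0 : cechDiff x _ p β = 0 := cechMap_injective x (Submodule.injective_subtype _) _ (by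
    rw [← cechDiff_cechMap, hβ, hα, map_zero])
  rw [← hβ]
  exact cechMap_mem_cechBoundaries x _ (h _ hfg β hβ0)

theorem ringKrullDim_quotient_le_of_le {I J : Ideal B} (h : I ≤ J) :
    ringKrullDim (B ⧸ J) ≤ ringKrullDim (B ⧸ I) :=
  ringKrullDim_le_of_surjective (Ideal.Quotient.factor h) (Ideal.Quotient.factor_surjective h)

/-- If some `x a ∉ P`, it is a nonzerodivisor on `B / P`, and dividing by it lowers the dimension.
So `H^p` of the quotient vanishes and `x a` acts injectively on `H^{p+1}(B / P)`, where every class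
is also killed by a power of `x a`. If all `x a ∈ P`, the localizations in positive Čech degree are
zero. -/
theorem cechVanish_quotient_prime (P : Ideal B) [P.IsPrime] (p : ℕ)
    (ih : ∀ J : Ideal B, ringKrullDim (B ⧸ J) < (p : ℕ) → CechVanish x (B ⧸ J) p)
    (hP : ringKrullDim (B ⧸ P) < (p + 1 : ℕ)) : CechVanish x (B ⧸ P) (p + 1) := by
  by_cases hx : ∀ a, x a ∈ P
  · have : Subsingleton (Cech x (B ⧸ P) (p + 1)) := by
      refine subsingleton_cech_succ x p fun a m => ⟨1, ?_⟩
      obtain ⟨b, rfl⟩ := Ideal.Quotient.mk_surjective m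
      rw [pow_one, Algebra.smul_def, Ideal.Quotient.algebraMap_eq, Ideal.Quotient.eq_zero_iff_mem.2 (hx a),
        zero_mul]
    intro α _
    rw [Subsingleton.elim α 0]
    exact zero_mem _
  · push Not at hx
    obtain ⟨a, ha⟩ := hx
    set c : B ⧸ P := Ideal.Quotient.mk P (x a) with hc
    have hc0 : c ≠ 0 := fun h => ha (Ideal.Quotient.eq_zero_iff_mem.1 h)
    let f : (B ⧸ P) →ₗ[B] (B ⧸ P) := LinearMap.lsmul B (B ⧸ P) (x a)
    have hfc : ∀ m, f m = c * m := fun m => by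
      change x a • m = _
      rw [Algebra.smul_def, Ideal.Quotient.algebraMap_eq]
    have hf : Function.Injective f := fun m m' h => by
      rw [hfc, hfc] at h
      exact mul_left_cancel₀ hc0 h
    let J : Ideal B := P ⊔ Ideal.span {x a}
    let g : (B ⧸ P) →ₗ[B] (B ⧸ J) := Submodule.factor le_sup_left
    have hg : Function.Surjective g := Submodule.factor_surjective le_sup_left
    have hfg : Function.Exact f g := by
      intro m
      obtain ⟨b, rfl⟩ := Ideal.Quotient.mk_surjective m
      change Ideal.Quotient.mk J b = 0 ↔ _
      rw [Ideal.Quotient.eq_zero_iff_mem, Submodule.mem_sup]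
      constructor
      · rintro ⟨q, hq, z, hz, rfl⟩
        obtain ⟨t, rfl⟩ := Ideal.mem_span_singleton'.1 hz
        refine ⟨Ideal.Quotient.mk P t, ?_⟩
        rw [hfc, map_add, Ideal.Quotient.eq_zero_iff_mem.2 hq, zero_add, map_mul, mul_comm]
      · rintro ⟨t, ht⟩
        obtain ⟨t, rfl⟩ := Ideal.Quotient.mk_surjective t
        rw [hfc, hc, ← map_mul, eq_comm, Ideal.Quotient.mk_eq_mk_iff_sub_mem] at ht
        exact ⟨_, ht, x a * t, Ideal.mul_mem_right _ _ (Ideal.mem_span_singleton_self _), by ring⟩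
    have hJ : ringKrullDim (B ⧸ J) < (p : ℕ) := by
      have h1 := ringKrullDim_quotient_succ_le_of_nonZeroDivisor
        (mem_nonZeroDivisors_of_ne_zero hc0)
      have e : (B ⧸ J) ≃+* ((B ⧸ P) ⧸ Ideal.span {c}) := by
        have e' := (DoubleQuot.quotQuotEquivQuotSup P (Ideal.span {x a})).symm
        rw [Ideal.map_span, Set.image_singleton] at e'
        exact e'
      rw [ringKrullDim_eq_of_ringEquiv e]
      have h2 := h1.trans_lt hP
      by_contra h
      refine absurd h2 (not_lt.2 ?_)
      push_cast
      gcongr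
      exact not_lt.1 h
    have hinj : ∀ α : Cech x (B ⧸ P) (p + 1), cechDiff x _ (p + 1) α = 0 →
        x a • α ∈ cechBoundaries x (B ⧸ P) (p + 1) → α ∈ cechBoundaries x (B ⧸ P) (p + 1) := by
      rintro α hα ⟨β, hβ⟩
      have hβ' : cechDiff x _ p β = cechMap x f (p + 1) α := by
        rw [hβ]
        funext S
        rw [cechMap_apply, Pi.smul_apply]
        induction α S using LocalizedModule.induction_on with
        | h m s => rw [locMap_mk, LocalizedModule.smul'_mk]; rfl
      refine mem_cechBoundaries_of_connecting x hf hg hfg hβ' (ih J hJ _ ?_)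
      rw [cechDiff_cechMap, hβ', cechMap_comp_eq_zero x hfg]
    intro α hα
    -- The factors `x a` are stripped off one at a time by injectivity.
    obtain ⟨K, hK⟩ := exists_pow_smul_mem_cechBoundaries x a (p + 1) α hα
    induction K with
    | zero => simpa using hK
    | succ K ihK =>
      refine ihK (hinj _ (by rw [map_smul, hα, smul_zero]) ?_)
      rwa [smul_smul, ← pow_succ']

theorem CechVanish.of_subsingleton [Subsingleton M] (p : ℕ) : CechVanish x M p := by
  intro α _
  have : α = 0 := funext fun S => by
    induction α S using LocalizedModule.induction_on with
    | h m s => rw [Subsingleton.elim m 0, LocalizedModule.zero_mk]; rfl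
  rw [this]
  exact zero_mem _

theorem eq_top_of_ringKrullDim_quotient_lt_zero {J : Ideal B}
    (h : ringKrullDim (B ⧸ J) < (0 : ℕ)) : J = ⊤ := by
  by_contra hJ
  have : Nontrivial (B ⧸ J) := Ideal.Quotient.nontrivial_iff.2 hJ
  exact absurd h (not_lt.2 (by exact_mod_cast ringKrullDim_nonneg_of_nontrivial))

/-- Dévissage along a prime filtration: annihilators only grow on submodules and quotients, so the
bound on the dimension passes to both ends of a short exact sequence. -/
theorem cechVanish_of_finite [IsNoetherianRing B] {p : ℕ}
    (ih : ∀ J : Ideal B, ringKrullDim (B ⧸ J) < (p : ℕ) → CechVanish x (B ⧸ J) p)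
    {M : Type v} [AddCommGroup M] [Module B M] (hM : Module.Finite B M)
    (h : ringKrullDim (B ⧸ Module.annihilator B M) < (p + 1 : ℕ)) : CechVanish x M (p + 1) := by
  revert h
  refine IsNoetherianRing.induction_on_isQuotientEquivQuotientPrime (A := B) hM
    (motive := fun N _ _ _ =>
      ringKrullDim (B ⧸ Module.annihilator B N) < (p + 1 : ℕ) → CechVanish x N (p + 1)) ?_ ?_ ?_
  · intro N _ _ _ _ _
    exact CechVanish.of_subsingleton x (p + 1)
  · intro N _ _ _ P e h
    rw [e.annihilator_eq, Ideal.annihilator_quotient] at h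
    exact (cechVanish_quotient_prime x P.1 p ih h).of_linearEquiv x e
  · intro N₁ _ _ _ N₂ _ _ _ N₃ _ _ _ f g hf hg hfg h₁ h₃ h
    exact CechVanish.of_exact x hf hg hfg
      (h₁ ((ringKrullDim_quotient_le_of_le (f.annihilator_le_of_injective hf)).trans_lt h))
      (h₃ ((ringKrullDim_quotient_le_of_le (g.annihilator_le_of_surjective hg)).trans_lt h))

theorem cechVanish_quotient [IsNoetherianRing B] (p : ℕ) (J : Ideal B)
    (h : ringKrullDim (B ⧸ J) < (p : ℕ)) : CechVanish x (B ⧸ J) p := by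
  induction p generalizing J with
  | zero =>
    have := Ideal.Quotient.subsingleton_iff.2 (eq_top_of_ringKrullDim_quotient_lt_zero h)
    exact CechVanish.of_subsingleton x 0
  | succ p ih =>
    refine cechVanish_of_finite x ih inferInstance ?_
    rwa [Ideal.annihilator_quotient]

theorem cechVanish_of_ringKrullDim_lt [IsNoetherianRing B] {p : ℕ}
    (h : ringKrullDim B < (p : ℕ)) : CechVanish x M p := by
  refine CechVanish.of_submodules x fun M' hM' => ?_
  have hM' : Module.Finite B M' := Module.Finite.iff_fg.2 hM'
  have h' : ringKrullDim (B ⧸ Module.annihilator B M') < (p : ℕ) :=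
    (ringKrullDim_quotient_le _).trans_lt h
  cases p with
  | zero =>
    have : Subsingleton M' := by
      rw [← Module.annihilator_eq_top_iff (R := B)]
      exact eq_top_of_ringKrullDim_quotient_lt_zero h'
    exact CechVanish.of_subsingleton x 0
  | succ p => exact cechVanish_of_finite x (cechVanish_quotient x p) hM' h'

end CechFunctor

section Gradings

variable {X : Type*} [AddCommGroup X] {Y : Type*} [AddCommGroup Y]

/-! ### Independent and spanning families of homogeneous components -/

/-- A finite sum of elements of distinct degrees vanishes only if all of its terms do. -/
def GrIndep (gr : ℤ → AddSubgroup X) : Prop :=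
  ∀ (T : Finset ℤ) (c : ℤ → X), (∀ d ∈ T, c d ∈ gr d) → ∑ d ∈ T, c d = 0 → ∀ d ∈ T, c d = 0

/-- Every element is a sum of homogeneous elements. -/
def GrSpan (gr : ℤ → AddSubgroup X) : Prop := ∀ y, y ∈ ⨆ d, gr d

theorem GrSpan.exists_finsupp {gr : ℤ → AddSubgroup X} (h : GrSpan gr) (y : X) :
    ∃ c : ℤ →₀ X, (∀ d, c d ∈ gr d) ∧ c.sum (fun _ z => z) = y := by
  classical
  refine AddSubgroup.iSup_induction gr
    (C := fun y => ∃ c : ℤ →₀ X, (∀ d, c d ∈ gr d) ∧ c.sum (fun _ z => z) = y) (h y) (fun d z hz => ⟨Finsupp.single d z, fun d' => ?_, ?_⟩)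
    ⟨0, fun d => zero_mem _, Finsupp.sum_zero_index⟩ ?_
  · rw [Finsupp.single_apply]
    split_ifs with h
    · exact h ▸ hz
    · exact zero_mem _
  · exact Finsupp.sum_single_index rfl
  · rintro _ _ ⟨c, hc, rfl⟩ ⟨c', hc', rfl⟩
    exact ⟨c + c', fun d => add_mem (hc d) (hc' d),
      Finsupp.sum_add_index' (fun _ => rfl) (fun _ _ _ => rfl)⟩

theorem GrIndep.eq_zero_of_shift {gr : ℤ → AddSubgroup X} (h : GrIndep gr) (a : ℤ) (T : Finset ℤ)
    (c : ℤ → X) (hc : ∀ d ∈ T, c d ∈ gr (a + d)) (h0 : ∑ d ∈ T, c d = 0) : ∀ d ∈ T, c d = 0 := by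
  intro d hd
  have := h (T.map (addLeftEmbedding a)) (fun e => c (e - a)) (fun e he => by
    obtain ⟨d, hd, rfl⟩ := Finset.mem_map.1 he
    simpa using hc d hd) (by simpa using h0) (a + d) (by simpa using hd)
  simpa using this

theorem exists_components_of_map_eq_zero {gr : ℤ → AddSubgroup X} {gr' : ℤ → AddSubgroup Y}
    (hX : GrSpan gr) (hY : GrIndep gr') (f : X →+ Y) (hf : ∀ d, ∀ z ∈ gr d, f z ∈ gr' d) {y : X}
    (hy : f y = 0) : ∃ c : ℤ →₀ X, (∀ d, c d ∈ gr d) ∧ (∀ d, f (c d) = 0) ∧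
      c.sum (fun _ z => z) = y := by
  obtain ⟨c, hc, rfl⟩ := hX.exists_finsupp y
  refine ⟨c, hc, fun d => ?_, rfl⟩
  by_cases hd : d ∈ c.support
  · refine hY c.support (fun d => f (c d)) (fun d _ => hf d _ (hc d)) ?_ d hd
    rw [Finsupp.sum, map_sum] at hy
    exact hy
  · rw [Finsupp.notMem_support_iff.1 hd, map_zero]

/-- The degree `e` component of any preimage works, since components in the target are unique. -/
theorem exists_homogeneous_preimage {gr : ℤ → AddSubgroup X} {gr' : ℤ → AddSubgroup Y}
    (hX : GrSpan gr) (hY : GrIndep gr') (f : X →+ Y) (hf : ∀ d, ∀ z ∈ gr d, f z ∈ gr' d) {e : ℤ}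
    {y : X} (hy : f y ∈ gr' e) : ∃ z ∈ gr e, f z = f y := by
  classical
  obtain ⟨c, hc, rfl⟩ := hX.exists_finsupp y
  refine ⟨c e, hc e, ?_⟩
  set y := c.sum (fun _ z => z) with hydef
  -- Subtracting `f y` in degree `e` turns the comparison of components into a vanishing sum of
  -- homogeneous terms. Inserting `e` covers the case where `e` is outside the support.
  have h := hY (insert e c.support) (fun d => f (c d) - if d = e then f y else 0) (fun d _ => by
    refine sub_mem (hf d _ (hc d)) ?_
    split_ifs with h
    · exact h ▸ hy
    · exact zero_mem _) (by
      rw [Finset.sum_sub_distrib, Finset.sum_ite_eq', if_pos (Finset.mem_insert_self _ _),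
        hydef, Finsupp.sum, map_sum, sub_eq_zero]
      refine (Finset.sum_subset (Finset.subset_insert _ _) fun d _ hd => ?_).symm
      rw [Finsupp.notMem_support_iff.1 hd, map_zero]) e (Finset.mem_insert_self _ _)
  simpa [sub_eq_zero] using h

theorem grIndep_of_decomposition {σ : Type*} [SetLike σ X] [AddSubmonoidClass σ X] (ℳ : ℤ → σ)
    [DirectSum.Decomposition ℳ] {gr : ℤ → AddSubgroup X} (h : ∀ d y, y ∈ gr d ↔ y ∈ ℳ d) :
    GrIndep gr := by
  intro T c hc h0 d hd
  have h1 : (DirectSum.decompose ℳ (∑ e ∈ T, c e) d : X) = c d := by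
    rw [DirectSum.decompose_sum, DFinsupp.finsetSum_apply, AddSubmonoidClass.coe_finsetSum,
      Finset.sum_eq_single d]
    · exact DirectSum.decompose_of_mem_same ℳ ((h _ _).1 (hc d hd))
    · exact fun e he hed => DirectSum.decompose_of_mem_ne ℳ ((h _ _).1 (hc e he)) hed
    · exact fun h => absurd hd h
  rw [← h1, h0]
  simp

theorem grSpan_of_decomposition {σ : Type*} [SetLike σ X] [AddSubmonoidClass σ X] (ℳ : ℤ → σ)
    [DirectSum.Decomposition ℳ] {gr : ℤ → AddSubgroup X} (h : ∀ d y, y ∈ gr d ↔ y ∈ ℳ d) :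
    GrSpan gr := by
  classical
  intro y
  rw [← DirectSum.sum_support_decompose ℳ y]
  exact sum_mem fun d _ => AddSubgroup.mem_iSup_of_mem d ((h _ _).2 (SetLike.coe_mem _))

theorem GrIndep.of_injective {gr : ℤ → AddSubgroup X} {gr' : ℤ → AddSubgroup Y} (hY : GrIndep gr')
    (f : X →+ Y) (hf : Function.Injective f) (hgr : ∀ d, ∀ z ∈ gr d, f z ∈ gr' d) :
    GrIndep gr := by
  intro T c hc h0 d hd
  refine hf ?_
  rw [map_zero]
  refine hY T (fun d => f (c d)) (fun d hd => hgr d _ (hc d hd)) ?_ d hd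
  rw [← map_sum, h0, map_zero]

/-- The grading of a free module `ι →₀ X` with coefficients in a graded module `X`. -/
def finGrading {ι : Type*} (deg : ι → ℤ) (gr : ℤ → AddSubgroup X) (e : ℤ) :
    AddSubgroup (ι →₀ X) where
  carrier := {y | ∀ s, y s ∈ gr (e - deg s)}
  zero_mem' := fun _ => zero_mem _
  add_mem' := fun hx hy s => add_mem (hx s) (hy s)
  neg_mem' := fun hx s => neg_mem (hx s)

theorem single_mem_finGrading {ι : Type*} {deg : ι → ℤ} {gr : ℤ → AddSubgroup X} {e : ℤ} {s : ι}
    {z : X} (hz : z ∈ gr (e - deg s)) : Finsupp.single s z ∈ finGrading deg gr e := by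
  classical
  intro t
  rw [Finsupp.single_apply]
  split_ifs with h
  · exact h ▸ hz
  · exact zero_mem _

theorem GrIndep.finsupp {ι : Type*} (deg : ι → ℤ) {gr : ℤ → AddSubgroup X} (h : GrIndep gr) :
    GrIndep (finGrading deg gr) := by
  intro T c hc h0 d hd
  ext s
  refine h.eq_zero_of_shift (-deg s) T (fun d => c d s) (fun d hd => ?_) ?_ d hd
  · have := hc d hd s
    rwa [sub_eq_neg_add] at this
  · rw [← Finsupp.finsetSum_apply, h0, Finsupp.zero_apply]

theorem GrSpan.finsupp {ι : Type*} (deg : ι → ℤ) {gr : ℤ → AddSubgroup X} (h : GrSpan gr) :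
    GrSpan (finGrading deg gr) := by
  intro y
  induction y using Finsupp.induction_linear with
  | zero => exact zero_mem _
  | add f g hf hg => exact add_mem hf hg
  | single s z =>
    obtain ⟨c, hc, rfl⟩ := h.exists_finsupp z
    rw [Finsupp.sum, ← Finsupp.singleAddHom_apply, map_sum]
    refine sum_mem fun d _ => AddSubgroup.mem_iSup_of_mem (d + deg s) (single_mem_finGrading ?_)
    rw [add_sub_cancel_right]
    exact hc d

end Gradings

theorem grSmul_mem {k : Type w} [Field k] {B : Type u} [CommRing B] [Algebra k B]
    (𝒜 : ℤ → Submodule k B) {M : Type*} [AddCommGroup M] [Module B M] (ℳ : ℤ → AddSubgroup M)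
    [SetLike.GradedSMul 𝒜 ℳ] {a d : ℤ} {b : B} {m : M} (hb : b ∈ 𝒜 a) (hm : m ∈ ℳ d) :
    b • m ∈ ℳ (a + d) :=
  SetLike.GradedSMul.smul_mem hb hm

section CechGrading

variable {k : Type w} [Field k] {B : Type u} [CommRing B] [Algebra k B]
  (𝒜 : ℤ → Submodule k B) [GradedAlgebra 𝒜] {r : ℕ} (x : Fin r → B)
  {M : Type*} [AddCommGroup M] [Module B M] (ℳ : ℤ → AddSubgroup M) [SetLike.GradedSMul 𝒜 ℳ]
  {N : Type*} [AddCommGroup N] [Module B N] (𝒩 : ℤ → AddSubgroup N) [SetLike.GradedSMul 𝒜 𝒩]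

/-! ### The grading of the Čech complex -/

variable {x}

theorem exists_degree_of_mem_cechMonoid (hx : ∀ a, ∃ d : ℤ, x a ∈ 𝒜 d) {S : Finset (Fin r)} {s : B}
    (hs : s ∈ cechMonoid x S) : ∃ d : ℤ, s ∈ 𝒜 d := by
  induction hs using Submonoid.closure_induction with
  | mem y hy => obtain ⟨a, -, rfl⟩ := hy; exact hx a
  | one => exact ⟨0, SetLike.GradedOne.one_mem⟩
  | mul y z _ _ hy hz =>
    obtain ⟨d, hd⟩ := hy
    obtain ⟨e, he⟩ := hz
    exact ⟨d + e, SetLike.GradedMul.mul_mem hd he⟩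

theorem mk_mem_locGrading {S : Finset (Fin r)} {a d e : ℤ} {m : M} {s : cechMonoid x S}
    (hs : (s : B) ∈ 𝒜 a) (hm : m ∈ ℳ e) (h : e = a + d) :
    LocalizedModule.mk m s ∈ locGrading x 𝒜 ℳ S d :=
  ⟨a, m, s, hs, h ▸ hm, rfl⟩

theorem grSpan_locGrading (hx : ∀ a, ∃ d : ℤ, x a ∈ 𝒜 d) (hM : GrSpan ℳ) (S : Finset (Fin r)) :
    GrSpan (locGrading x 𝒜 ℳ S) := by
  intro y
  induction y using LocalizedModule.induction_on with
  | h m s =>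
    obtain ⟨a, ha⟩ := exists_degree_of_mem_cechMonoid 𝒜 hx s.2
    let φ : M →ₗ[B] CechLoc x M S := LocalizedModule.divBy s ∘ₗ LocalizedModule.mkLinearMap _ M
    have hφ : ∀ m, φ m = LocalizedModule.mk m s := fun m => by
      simp [φ, LocalizedModule.divBy, LocalizedModule.liftOn_mk]
    rw [← hφ]
    obtain ⟨c, hc, rfl⟩ := hM.exists_finsupp m
    rw [Finsupp.sum, map_sum]
    refine sum_mem fun d _ => AddSubgroup.mem_iSup_of_mem (d - a) ?_
    rw [hφ]
    exact mk_mem_locGrading 𝒜 ℳ ha (hc d) (by ring)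

/-- Independence in a localization is reduced to independence in `M` by putting finitely many
homogeneous fractions over one homogeneous denominator. -/
theorem exists_common_denominator {S : Finset (Fin r)} (T : Finset ℤ) (c : ℤ → CechLoc x M S)
    (hc : ∀ d ∈ T, c d ∈ locGrading x 𝒜 ℳ S d) :
    ∃ (a : ℤ) (s : cechMonoid x S), (s : B) ∈ 𝒜 a ∧
      ∃ m : ℤ → M, ∀ d ∈ T, m d ∈ ℳ (a + d) ∧ c d = LocalizedModule.mk (m d) s := by
  classical
  induction T using Finset.induction_on with
  | empty => exact ⟨0, 1, SetLike.GradedOne.one_mem, fun _ => 0, by simp⟩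
  | insert e T he ih =>
    obtain ⟨a, s, hs, m, hm⟩ := ih fun d hd => hc d (Finset.mem_insert_of_mem hd)
    obtain ⟨b, n, t, ht, hn, hce⟩ := hc e (Finset.mem_insert_self e T)
    refine ⟨a + b, s * t, SetLike.GradedMul.mul_mem hs ht,
      fun d => if d = e then (s : B) • n else (t : B) • m d, fun d hd => ?_⟩
    dsimp only
    split_ifs with h
    · subst h
      refine ⟨?_, ?_⟩
      · rw [add_assoc]; exact grSmul_mem 𝒜 ℳ hs hn
      · rw [hce]; exact (LocalizedModule.mk_cancel_common_left s t n).symm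
    · have hdT := Finset.mem_of_mem_insert_of_ne hd h
      refine ⟨?_, ?_⟩
      · rw [add_comm a b, add_assoc]; exact grSmul_mem 𝒜 ℳ ht (hm d hdT).1
      · rw [(hm d hdT).2]; exact (LocalizedModule.mk_cancel_common_right s t (m d)).symm

theorem sum_mk {S : Submonoid B} {ι : Type*} (T : Finset ι) (m : ι → M) (s : S) :
    ∑ d ∈ T, LocalizedModule.mk (m d) s = LocalizedModule.mk (∑ d ∈ T, m d) s := by
  classical
  induction T using Finset.induction_on with
  | empty => simp
  | insert e T he ih =>
    rw [Finset.sum_insert he, Finset.sum_insert he, ih, LocalizedModule.mk_add_mk, ← smul_add,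
      LocalizedModule.mk_cancel_common_left]

theorem grIndep_locGrading (hx : ∀ a, ∃ d : ℤ, x a ∈ 𝒜 d) (hM : GrIndep ℳ) (S : Finset (Fin r)) :
    GrIndep (locGrading x 𝒜 ℳ S) := by
  intro T c hc h0
  obtain ⟨a, s, hs, m, hm⟩ := exists_common_denominator 𝒜 ℳ T c hc
  rw [Finset.sum_congr rfl fun d hd => (hm d hd).2, sum_mk, ← LocalizedModule.zero_mk 1,
    LocalizedModule.mk_eq] at h0
  obtain ⟨t, ht⟩ := h0
  rw [one_smul, smul_zero, smul_zero, Finset.smul_sum] at ht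
  obtain ⟨b, hb⟩ := exists_degree_of_mem_cechMonoid 𝒜 hx t.2
  have := hM.eq_zero_of_shift (b + a) T (fun d => t • m d) (fun d hd => by
    rw [add_assoc]; exact grSmul_mem 𝒜 ℳ hb (hm d hd).1) ht
  intro d hd
  rw [(hm d hd).2, ← LocalizedModule.zero_mk 1, LocalizedModule.mk_eq]
  exact ⟨t, by rw [one_smul, this d hd, smul_zero, smul_zero]⟩

theorem mem_cechGrading {p : ℕ} {d : ℤ} {α : Cech x M p} :
    α ∈ cechGrading x 𝒜 ℳ p d ↔ ∀ S, α S ∈ locGrading x 𝒜 ℳ S.1 d := by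
  simp [cechGrading, AddSubgroup.mem_pi]

theorem grIndep_cechGrading (hx : ∀ a, ∃ d : ℤ, x a ∈ 𝒜 d) (hM : GrIndep ℳ) (p : ℕ) :
    GrIndep (cechGrading x 𝒜 ℳ p) := by
  intro T c hc h0 d hd
  funext S
  refine grIndep_locGrading 𝒜 ℳ hx hM S.1 T (fun d => c d S)
    (fun d hd => (mem_cechGrading 𝒜 ℳ).1 (hc d hd) S) ?_ d hd
  rw [← Finset.sum_apply, h0]
  rfl

theorem grSpan_cechGrading (hx : ∀ a, ∃ d : ℤ, x a ∈ 𝒜 d) (hM : GrSpan ℳ) (p : ℕ) :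
    GrSpan (cechGrading x 𝒜 ℳ p) := by
  classical
  intro α
  rw [← Finset.univ_sum_single α]
  refine sum_mem fun S _ => ?_
  obtain ⟨c, hc, h⟩ := (grSpan_locGrading 𝒜 ℳ hx hM S.1).exists_finsupp (α S)
  rw [← h, Finsupp.sum, ← AddMonoidHom.single_apply, map_sum]
  refine sum_mem fun d _ => AddSubgroup.mem_iSup_of_mem d ((mem_cechGrading 𝒜 ℳ).2 fun T => ?_)
  rw [AddMonoidHom.single_apply]
  by_cases h : T = S
  · subst h; rw [Pi.single_eq_same]; exact hc d
  · rw [Pi.single_eq_of_ne h]; exact zero_mem _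

theorem locGrading_smul {S : Finset (Fin r)} {a d : ℤ} {b : B} (hb : b ∈ 𝒜 a)
    {y : CechLoc x M S} (hy : y ∈ locGrading x 𝒜 ℳ S d) : b • y ∈ locGrading x 𝒜 ℳ S (a + d) := by
  obtain ⟨c, m, s, hs, hm, rfl⟩ := hy
  rw [LocalizedModule.smul'_mk]
  exact mk_mem_locGrading 𝒜 ℳ hs (grSmul_mem 𝒜 ℳ hb hm) (by ring)

instance gradedSMul_cechGrading (p : ℕ) : SetLike.GradedSMul 𝒜 (cechGrading x 𝒜 ℳ p) where
  smul_mem := fun _ _ _ _ hb hα => (mem_cechGrading 𝒜 ℳ).2 fun S =>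
    locGrading_smul 𝒜 ℳ hb ((mem_cechGrading 𝒜 ℳ).1 hα S)

theorem cechRes_mem_locGrading {S T : Finset (Fin r)} (h : S ⊆ T) {d : ℤ} {y : CechLoc x M S}
    (hy : y ∈ locGrading x 𝒜 ℳ S d) : cechRes x M h y ∈ locGrading x 𝒜 ℳ T d := by
  obtain ⟨c, m, s, hs, hm, rfl⟩ := hy
  rw [cechRes_mk]
  exact ⟨c, m, ⟨s.1, _⟩, hs, hm, rfl⟩

theorem cechDiff_mem_cechGrading {p : ℕ} {d : ℤ} {α : Cech x M p}
    (hα : α ∈ cechGrading x 𝒜 ℳ p d) : cechDiff x M p α ∈ cechGrading x 𝒜 ℳ (p + 1) d := by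
  rw [mem_cechGrading] at hα ⊢
  intro T
  rw [cechDiff_apply]
  refine sum_mem fun a ha => ?_
  have h : cechRes x M (T.1.erase_subset a) (cechExt x α (T.1.erase a)) ∈
      locGrading x 𝒜 ℳ T.1 d := by
    refine cechRes_mem_locGrading 𝒜 ℳ _ ?_
    unfold cechExt
    split_ifs with h
    · exact hα ⟨_, h⟩
    · exact zero_mem _
  rcases neg_one_pow_eq_or B (T.1.filter (fun b => b < a)).card with e | e
  · rw [cechSign, e, one_smul]; exact h
  · rw [cechSign, e, neg_one_smul]; exact neg_mem h

theorem cechMap_mem_cechGrading {f : M →ₗ[B] N} (hf : ∀ d, ∀ m ∈ ℳ d, f m ∈ 𝒩 d) {p : ℕ} {d : ℤ}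
    {α : Cech x M p} (hα : α ∈ cechGrading x 𝒜 ℳ p d) :
    cechMap x f p α ∈ cechGrading x 𝒜 𝒩 p d := by
  rw [mem_cechGrading] at hα ⊢
  intro S
  obtain ⟨a, m, s, hs, hm, h⟩ := hα S
  rw [cechMap_apply, h, locMap_mk]
  exact ⟨a, f m, s, hs, hf _ _ hm, rfl⟩

/-- The `p`-th Čech cohomology of `M` vanishes in degree `e`. -/
def CechVanishAt (p : ℕ) (e : ℤ) : Prop :=
  ∀ α ∈ cechGrading x 𝒜 ℳ p e, cechDiff x M p α = 0 → α ∈ cechBoundaries x M p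

end CechGrading

section CoefMap

variable {B : Type u} [CommRing B] {ι κ μ : Type*}
  {X : Type*} [AddCommGroup X] [Module B X] {Y : Type*} [AddCommGroup Y] [Module B Y]

/-! ### Free modules with coefficients -/

open Classical in
/-- The map `φ ⊗ X`, where the tensor products with `X` are written as `ι →₀ X` and `κ →₀ X`. -/
noncomputable def coefMap (X : Type*) [AddCommGroup X] [Module B X]
    (φ : (ι →₀ B) →ₗ[B] (κ →₀ B)) : (ι →₀ X) →ₗ[B] (κ →₀ X) :=
  (TensorProduct.finsuppScalarLeft B X κ).toLinearMap ∘ₗ φ.rTensor X ∘ₗ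
    (TensorProduct.finsuppScalarLeft B X ι).symm.toLinearMap

theorem coefMap_single (φ : (ι →₀ B) →ₗ[B] (κ →₀ B)) (t : ι) (y : X) (s : κ) :
    coefMap X φ (Finsupp.single t y) s = φ (Finsupp.single t 1) s • y := by
  simp [coefMap, TensorProduct.finsuppScalarLeft_apply_tmul_apply]

theorem coefMap_apply (φ : (ι →₀ B) →ₗ[B] (κ →₀ B)) (y : ι →₀ X) (s : κ) :
    coefMap X φ y s = ∑ t ∈ y.support, φ (Finsupp.single t 1) s • y t := by
  conv_lhs => rw [← Finsupp.sum_single y, Finsupp.sum, map_sum, Finsupp.finsetSum_apply]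
  exact Finset.sum_congr rfl fun t _ => coefMap_single φ t (y t) s

theorem coefMap_coefMap (φ : (ι →₀ B) →ₗ[B] (κ →₀ B)) (ψ : (κ →₀ B) →ₗ[B] (μ →₀ B)) (y : ι →₀ X) :
    coefMap X ψ (coefMap X φ y) = coefMap X (ψ ∘ₗ φ) y := by
  simp [coefMap, LinearMap.rTensor_comp]

theorem coefMap_add (φ ψ : (ι →₀ B) →ₗ[B] (κ →₀ B)) (y : ι →₀ X) :
    coefMap X (φ + ψ) y = coefMap X φ y + coefMap X ψ y := by
  simp [coefMap, LinearMap.rTensor_add]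

theorem coefMap_sub (φ ψ : (ι →₀ B) →ₗ[B] (κ →₀ B)) (y : ι →₀ X) :
    coefMap X (φ - ψ) y = coefMap X φ y - coefMap X ψ y :=
  eq_sub_of_add_eq (by
    rw [← coefMap_add, show φ - ψ + ψ = φ from LinearMap.ext fun z => by
      rw [LinearMap.add_apply, LinearMap.sub_apply, sub_add_cancel]])

theorem coefMap_id (y : ι →₀ X) : coefMap X (LinearMap.id : (ι →₀ B) →ₗ[B] (ι →₀ B)) y = y := by
  simp [coefMap]

theorem coefMap_smul_id (b : B) (y : ι →₀ X) :
    coefMap X (b • LinearMap.id : (ι →₀ B) →ₗ[B] (ι →₀ B)) y = b • y := by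
  simp [coefMap, LinearMap.rTensor_smul]

theorem coefMap_zero (y : ι →₀ X) : coefMap X (0 : (ι →₀ B) →ₗ[B] (κ →₀ B)) y = 0 := by
  simp [coefMap]

theorem mapRange_coefMap (f : X →ₗ[B] Y) (φ : (ι →₀ B) →ₗ[B] (κ →₀ B)) (y : ι →₀ X) :
    Finsupp.mapRange.linearMap f (coefMap X φ y) =
      coefMap Y φ (Finsupp.mapRange.linearMap f y) := by
  induction y using Finsupp.induction_linear with
  | zero => simp
  | add y z hy hz => simp only [map_add, hy, hz]
  | single t y =>
    ext s
    rw [Finsupp.mapRange.linearMap_apply, Finsupp.mapRange.linearMap_apply, Finsupp.mapRange_apply,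
      Finsupp.mapRange_single, coefMap_single, coefMap_single, map_smul]

end CoefMap

/-! ### Degree-preserving maps of graded free modules -/

section GradedMaps

variable {k : Type w} [Field k] {B : Type u} [CommRing B] [Algebra k B]
  (𝒜 : ℤ → Submodule k B)

/-- A linear map between graded free modules which preserves degrees. -/
def IsGradedMap {ι κ : Type u} (deg : ι → ℤ) (deg' : κ → ℤ) (φ : (ι →₀ B) →ₗ[B] (κ →₀ B)) :
    Prop :=
  ∀ t, φ (Finsupp.single t 1) ∈ freeGrading 𝒜 deg' (deg t)

theorem freeGrading_eq {ι : Type u} (deg : ι → ℤ) :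
    freeGrading 𝒜 deg = finGrading deg (fun d => (𝒜 d).toAddSubgroup) := rfl

variable {𝒜}

theorem IsGradedMap.coefMap_mem {ι κ : Type u} {deg : ι → ℤ} {deg' : κ → ℤ}
    {φ : (ι →₀ B) →ₗ[B] (κ →₀ B)} (hφ : IsGradedMap 𝒜 deg deg' φ)
    {X : Type*} [AddCommGroup X] [Module B X] (gr : ℤ → AddSubgroup X) [SetLike.GradedSMul 𝒜 gr]
    {e : ℤ} {y : ι →₀ X} (hy : y ∈ finGrading deg gr e) :
    coefMap X φ y ∈ finGrading deg' gr e := by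
  intro s
  rw [coefMap_apply]
  refine sum_mem fun t _ => ?_
  have := grSmul_mem 𝒜 gr (hφ t s) (hy t)
  rwa [show deg t - deg' s + (e - deg t) = e - deg' s by ring] at this

theorem linearMap_apply_eq {ι : Type*} {X : Type*} [AddCommGroup X] [Module B X]
    (φ : (ι →₀ B) →ₗ[B] X) (y : ι →₀ B) :
    φ y = ∑ t ∈ y.support, y t • φ (Finsupp.single t 1) := by
  conv_lhs => rw [← Finsupp.sum_single y, Finsupp.sum, map_sum]
  refine Finset.sum_congr rfl fun t _ => ?_
  rw [← map_smul, Finsupp.smul_single, smul_eq_mul, mul_one]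

theorem map_mem_of_single_mem [GradedAlgebra 𝒜] {ι : Type u} {deg : ι → ℤ}
    {X : Type*} [AddCommGroup X] [Module B X] (gr : ℤ → AddSubgroup X) [SetLike.GradedSMul 𝒜 gr]
    {φ : (ι →₀ B) →ₗ[B] X} (hφ : ∀ t, φ (Finsupp.single t 1) ∈ gr (deg t))
    {e : ℤ} {y : ι →₀ B} (hy : y ∈ freeGrading 𝒜 deg e) : φ y ∈ gr e := by
  rw [linearMap_apply_eq]
  refine sum_mem fun t _ => ?_
  have := grSmul_mem 𝒜 gr (hy t) (hφ t)
  rwa [sub_add_cancel] at this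

instance gradedSMul_self [GradedAlgebra 𝒜] :
    SetLike.GradedSMul 𝒜 (fun d => (𝒜 d).toAddSubgroup) where
  smul_mem := fun _ _ _ _ hb hm => SetLike.GradedMul.mul_mem hb hm

instance gradedSMul_finGrading {ι : Type*} (deg : ι → ℤ) {X : Type*} [AddCommGroup X] [Module B X]
    (gr : ℤ → AddSubgroup X) [SetLike.GradedSMul 𝒜 gr] :
    SetLike.GradedSMul 𝒜 (finGrading deg gr) where
  smul_mem := fun a d b y hb hy s => by
    have := grSmul_mem 𝒜 gr hb (hy s)
    rwa [show a + (d - deg s) = a + d - deg s by ring] at this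

instance gradedSMul_freeGrading [GradedAlgebra 𝒜] {ι : Type u} (deg : ι → ℤ) :
    SetLike.GradedSMul 𝒜 (freeGrading 𝒜 deg) :=
  gradedSMul_finGrading deg (fun d => (𝒜 d).toAddSubgroup)

theorem IsGradedMap.map_mem [GradedAlgebra 𝒜] {ι κ : Type u} {deg : ι → ℤ} {deg' : κ → ℤ}
    {φ : (ι →₀ B) →ₗ[B] (κ →₀ B)} (hφ : IsGradedMap 𝒜 deg deg' φ) {e : ℤ} {y : ι →₀ B}
    (hy : y ∈ freeGrading 𝒜 deg e) : φ y ∈ freeGrading 𝒜 deg' e :=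
  map_mem_of_single_mem (freeGrading 𝒜 deg') hφ hy

variable (𝒜)

theorem grSpan_self [GradedAlgebra 𝒜] : GrSpan (fun d => (𝒜 d).toAddSubgroup) :=
  grSpan_of_decomposition 𝒜 fun _ _ => Iff.rfl

theorem grIndep_self [GradedAlgebra 𝒜] : GrIndep (fun d => (𝒜 d).toAddSubgroup) :=
  grIndep_of_decomposition 𝒜 fun _ _ => Iff.rfl

theorem grSpan_freeGrading [GradedAlgebra 𝒜] {ι : Type u} (deg : ι → ℤ) :
    GrSpan (freeGrading 𝒜 deg) := (grSpan_self 𝒜).finsupp deg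

theorem grIndep_freeGrading [GradedAlgebra 𝒜] {ι : Type u} (deg : ι → ℤ) :
    GrIndep (freeGrading 𝒜 deg) := (grIndep_self 𝒜).finsupp deg

end GradedMaps

section FreeRes

variable {k : Type w} [Field k] {B : Type u} [CommRing B] [Algebra k B]

/-! ### Graded free resolutions -/

/-- A graded free resolution of `B / I`. The free module in homological degree `p` has the index
`p + 1`; the free module with the index `0` is zero. -/
structure FreeRes (𝒜 : ℤ → Submodule k B) (I : Ideal B) where
  ι : ℕ → Type u
  deg : ∀ p, ι p → ℤ
  d : ∀ p, (ι (p + 1) →₀ B) →ₗ[B] (ι p →₀ B)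
  aug : (ι 1 →₀ B) →ₗ[B] B ⧸ I
  isEmpty_zero : IsEmpty (ι 0)
  isGradedMap_d : ∀ p, IsGradedMap 𝒜 (deg (p + 1)) (deg p) (d p)
  aug_mem : ∀ t, aug (Finsupp.single t 1) ∈ quotientGrading 𝒜 I (deg 1 t)
  aug_lift : ∀ e, ∀ b ∈ quotientGrading 𝒜 I e, ∃ y ∈ freeGrading 𝒜 (deg 1) e, aug y = b
  exact_aug : ∀ y, aug y = 0 ↔ y ∈ LinearMap.range (d 1)
  exact_d : ∀ p y, d (p + 1) y = 0 ↔ y ∈ LinearMap.range (d (p + 2))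

/-- Dependent choice through varying types: `P` is the invariant that allows the next step, `R` the
relation between consecutive terms. -/
theorem exists_seq {α : ℕ → Type*} {P : ∀ p, α p → Prop} {R : ∀ p, α p → α (p + 1) → Prop}
    (a : α 0) (ha : P 0 a) (h : ∀ p b, P p b → ∃ c, P (p + 1) c ∧ R p b c) :
    ∃ f : ∀ p, α p, f 0 = a ∧ (∀ p, P p (f p)) ∧ ∀ p, R p (f p) (f (p + 1)) := by
  choose c hP hR using h
  let f : ∀ p, {b : α p // P p b} := fun p =>
    Nat.rec ⟨a, ha⟩ (fun p b => ⟨c p b.1 b.2, hP p b.1 b.2⟩) p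
  exact ⟨fun p => (f p).1, rfl, fun p => (f p).2, fun p => hR p (f p).1 (f p).2⟩

theorem exists_lift_of_mem_range {ι κ μ : Type*} (f : (κ →₀ B) →ₗ[B] (μ →₀ B))
    (φ : (ι →₀ B) →ₗ[B] (μ →₀ B)) (h : ∀ y, φ y ∈ LinearMap.range f) :
    ∃ ψ : (ι →₀ B) →ₗ[B] (κ →₀ B), f ∘ₗ ψ = φ := by
  choose z hz using fun t => h (Finsupp.single t 1)
  refine ⟨Finsupp.linearCombination B z, Finsupp.lhom_ext' fun t => LinearMap.ext_ring ?_⟩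
  simp [hz]

namespace FreeRes

variable {𝒜 : ℤ → Submodule k B} {I : Ideal B} (F G : FreeRes 𝒜 I)

theorem d_comp_d (p : ℕ) : F.d p ∘ₗ F.d (p + 1) = 0 := by
  cases p with
  | zero =>
    have := F.isEmpty_zero
    exact LinearMap.ext fun y => Subsingleton.elim _ _
  | succ p => exact LinearMap.ext fun y => (F.exact_d p _).2 ⟨y, rfl⟩

/-- The usual lifting argument: `h p` raises the homological degree from `p` to `p + 1`. The
invariant `P` passed to `exists_seq` says exactly that `φ - h ∘ d` lands in the cycles, so that it
lifts through the next differential. -/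
theorem exists_nullHomotopy (φ : ∀ p, (G.ι p →₀ B) →ₗ[B] (F.ι p →₀ B))
    (hφ : ∀ p, F.d p ∘ₗ φ (p + 1) = φ p ∘ₗ G.d p) (hφ1 : ∀ y, F.aug (φ 1 y) = 0) :
    ∃ h : ∀ p, (G.ι (p + 1) →₀ B) →ₗ[B] (F.ι (p + 2) →₀ B), F.d 1 ∘ₗ h 0 = φ 1 ∧
      ∀ p, F.d (p + 2) ∘ₗ h (p + 1) + h p ∘ₗ G.d (p + 1) = φ (p + 2) := by
  obtain ⟨h0, hh0⟩ := exists_lift_of_mem_range (F.d 1) (φ 1) fun y =>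
    (F.exact_aug _).1 (hφ1 y)
  obtain ⟨h, rfl, -, hR⟩ := exists_seq
    (α := fun p => (G.ι (p + 1) →₀ B) →ₗ[B] (F.ι (p + 2) →₀ B))
    (P := fun p h => F.d (p + 1) ∘ₗ h ∘ₗ G.d (p + 1) = φ (p + 1) ∘ₗ G.d (p + 1))
    (R := fun p h h' => F.d (p + 2) ∘ₗ h' + h ∘ₗ G.d (p + 1) = φ (p + 2)) h0
    (by rw [← LinearMap.comp_assoc, hh0]) (fun p h hP => by
      obtain ⟨h', hh'⟩ := exists_lift_of_mem_range (F.d (p + 2)) (φ (p + 2) - h ∘ₗ G.d (p + 1))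
        fun y => (F.exact_d p _).1 (by
          have h1 := LinearMap.congr_fun (hφ (p + 1)) y
          have h2 := LinearMap.congr_fun hP y
          simp only [LinearMap.comp_apply] at h1 h2
          rw [LinearMap.sub_apply, map_sub, LinearMap.comp_apply, h1, h2, sub_self])
      refine ⟨h', LinearMap.ext fun y => ?_, LinearMap.ext fun y => ?_⟩
      · have h1 := LinearMap.congr_fun hh' (G.d (p + 2) y)
        have h2 := LinearMap.congr_fun (G.d_comp_d (p + 1)) y
        simp only [LinearMap.comp_apply, LinearMap.sub_apply, LinearMap.zero_apply] at h1 h2 ⊢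
        exact h1.trans (by rw [h2, map_zero, sub_zero])
      · have h1 := LinearMap.congr_fun hh' y
        simp only [LinearMap.comp_apply, LinearMap.sub_apply, LinearMap.add_apply] at h1 ⊢
        rw [h1, sub_add_cancel])
  exact ⟨h, hh0, hR⟩

/-- Tensor the homotopy `d h + h d = φ` with `X`; on a cycle the term `h d` disappears. -/
theorem exists_coefMap_eq_of_aug_eq_zero (φ : ∀ p, (G.ι p →₀ B) →ₗ[B] (F.ι p →₀ B))
    (hφ : ∀ p, F.d p ∘ₗ φ (p + 1) = φ p ∘ₗ G.d p) (hφ1 : ∀ y, F.aug (φ 1 y) = 0)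
    {X : Type*} [AddCommGroup X] [Module B X] (p : ℕ) {y : G.ι (p + 1) →₀ X}
    (hy : coefMap X (G.d p) y = 0) :
    ∃ z, coefMap X (F.d (p + 1)) z = coefMap X (φ (p + 1)) y := by
  obtain ⟨h, h0, hs⟩ := exists_nullHomotopy F G φ hφ hφ1
  cases p with
  | zero => exact ⟨coefMap X (h 0) y, by rw [coefMap_coefMap, h0]⟩
  | succ p =>
    exact ⟨coefMap X (h (p + 1)) y, by
      rw [← hs p, coefMap_add, coefMap_coefMap, ← coefMap_coefMap (G.d (p + 1)), hy, map_zero,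
        add_zero]⟩

theorem exists_chainMap [GradedAlgebra 𝒜] :
    ∃ f : ∀ p, (G.ι p →₀ B) →ₗ[B] (F.ι p →₀ B), (∀ p, IsGradedMap 𝒜 (G.deg p) (F.deg p) (f p)) ∧
      (∀ p, F.d p ∘ₗ f (p + 1) = f p ∘ₗ G.d p) ∧ ∀ y, F.aug (f 1 y) = G.aug y := by
  choose z hz hz' using fun t => F.aug_lift _ _ (G.aug_mem t)
  have key : ∀ p (f : (G.ι (p + 1) →₀ B) →ₗ[B] (F.ι (p + 1) →₀ B)),
      IsGradedMap 𝒜 (G.deg (p + 1)) (F.deg (p + 1)) f →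
      (∀ y, f (G.d (p + 1) y) ∈ LinearMap.range (F.d (p + 1))) →
      ∃ f' : (G.ι (p + 2) →₀ B) →ₗ[B] (F.ι (p + 2) →₀ B),
        IsGradedMap 𝒜 (G.deg (p + 2)) (F.deg (p + 2)) f' ∧
        F.d (p + 1) ∘ₗ f' = f ∘ₗ G.d (p + 1) := by
    intro p f hf hr
    have hex : ∀ t, ∃ y ∈ freeGrading 𝒜 (F.deg (p + 2)) (G.deg (p + 2) t),
        F.d (p + 1) y = f (G.d (p + 1) (Finsupp.single t 1)) := by
      intro t
      obtain ⟨y, hy⟩ := hr (Finsupp.single t 1)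
      have h1 : F.d (p + 1) y ∈ freeGrading 𝒜 (F.deg (p + 1)) (G.deg (p + 2) t) := by
        rw [hy]; exact hf.map_mem (G.isGradedMap_d (p + 1) t)
      obtain ⟨y', hy', h2⟩ := exists_homogeneous_preimage (grSpan_freeGrading 𝒜 (F.deg (p + 2)))
        (grIndep_freeGrading 𝒜 (F.deg (p + 1))) (F.d (p + 1)).toAddMonoidHom
        (fun e z hz => (F.isGradedMap_d (p + 1)).map_mem hz) h1
      exact ⟨y', hy', h2.trans hy⟩
    choose y hy hy' using hex
    refine ⟨Finsupp.linearCombination B y, fun t => ?_, ?_⟩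
    · simpa using hy t
    · refine Finsupp.lhom_ext' fun t => LinearMap.ext_ring ?_
      simp [hy']
  have haug : ∀ y, F.aug (Finsupp.linearCombination B z y) = G.aug y := fun y => by
    have : F.aug ∘ₗ Finsupp.linearCombination B z = G.aug :=
      Finsupp.lhom_ext' fun t => LinearMap.ext_ring (by simp [hz'])
    exact LinearMap.congr_fun this y
  obtain ⟨f, hf0, hP, hR⟩ := exists_seq
    (α := fun p => (G.ι (p + 1) →₀ B) →ₗ[B] (F.ι (p + 1) →₀ B))
    (P := fun p f => IsGradedMap 𝒜 (G.deg (p + 1)) (F.deg (p + 1)) f ∧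
      ∀ y, f (G.d (p + 1) y) ∈ LinearMap.range (F.d (p + 1)))
    (R := fun p f f' => F.d (p + 1) ∘ₗ f' = f ∘ₗ G.d (p + 1))
    (Finsupp.linearCombination B z)
    ⟨fun t => by simpa using hz t, fun y => (F.exact_aug _).1 (by
      rw [haug]; exact (G.exact_aug _).2 ⟨y, rfl⟩)⟩
    (fun p f hf => by
      obtain ⟨f', hf', hc⟩ := key p f hf.1 hf.2
      refine ⟨f', ⟨hf', fun y => (F.exact_d p _).1 ?_⟩, hc⟩
      have h1 := LinearMap.congr_fun hc (G.d (p + 2) y)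
      have h2 := LinearMap.congr_fun (G.d_comp_d (p + 1)) y
      simp only [LinearMap.comp_apply, LinearMap.zero_apply] at h1 h2
      rw [h1, h2, map_zero])
  have := F.isEmpty_zero
  have := G.isEmpty_zero
  refine ⟨fun p => match p with
    | 0 => 0
    | p + 1 => f p, fun p => ?_, fun p => ?_, fun y => ?_⟩
  · cases p with
    | zero => exact fun t => isEmptyElim t
    | succ p => exact (hP p).1
  · cases p with
    | zero => exact LinearMap.ext fun y => Subsingleton.elim _ _
    | succ p => exact hR p
  · change F.aug (f 0 y) = _
    rw [hf0, haug]

/-- `Tor` with coefficients in a graded module does not depend on the resolution. -/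
theorem exists_coefMap_eq_of_comparison [GradedAlgebra 𝒜] {X : Type*} [AddCommGroup X] [Module B X]
    (gr : ℤ → AddSubgroup X) [SetLike.GradedSMul 𝒜 gr] {p : ℕ} {e : ℤ}
    (hF : ∀ y ∈ finGrading (F.deg (p + 1)) gr e, coefMap X (F.d p) y = 0 →
      ∃ z, coefMap X (F.d (p + 1)) z = y) :
    ∀ y ∈ finGrading (G.deg (p + 1)) gr e, coefMap X (G.d p) y = 0 →
      ∃ z, coefMap X (G.d (p + 1)) z = y := by
  intro y hy hy0
  obtain ⟨f, hf, hfc, hfa⟩ := exists_chainMap F G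
  obtain ⟨g, -, hgc, hga⟩ := exists_chainMap G F
  obtain ⟨z, hz⟩ := hF (coefMap X (f (p + 1)) y) ((hf (p + 1)).coefMap_mem gr hy) (by
    rw [coefMap_coefMap, hfc, ← coefMap_coefMap, hy0, map_zero])
  -- The composite `g ∘ f` and the identity both lift the identity of `B / I`, so they differ by a
  -- boundary on cycles.
  obtain ⟨z', hz'⟩ := exists_coefMap_eq_of_aug_eq_zero G G
    (fun p => g p ∘ₗ f p - LinearMap.id) (fun p => by
      rw [LinearMap.comp_sub, LinearMap.sub_comp, LinearMap.comp_id, LinearMap.id_comp,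
        ← LinearMap.comp_assoc, hgc, LinearMap.comp_assoc, hfc, LinearMap.comp_assoc])
    (fun y => by
      rw [LinearMap.sub_apply, map_sub, LinearMap.comp_apply, hga, hfa, LinearMap.id_apply,
        sub_self]) p hy0
  refine ⟨coefMap X (g (p + 2)) z - z', ?_⟩
  rw [map_sub, hz', coefMap_sub, coefMap_id, coefMap_coefMap, hgc, ← coefMap_coefMap, hz,
    coefMap_coefMap, sub_sub_cancel]

/-- `Tor^B(B / I, X)` vanishes if an element of `I` acts bijectively on `X`. -/
theorem exists_coefMap_eq_of_mem {c : B} (hc : c ∈ I) {X : Type*} [AddCommGroup X] [Module B X]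
    (hX : ∃ g : X →ₗ[B] X, ∀ y, c • g y = y) (p : ℕ) {y : F.ι (p + 1) →₀ X}
    (hy : coefMap X (F.d p) y = 0) : ∃ z, coefMap X (F.d (p + 1)) z = y := by
  obtain ⟨g, hg⟩ := hX
  obtain ⟨z, hz⟩ := exists_coefMap_eq_of_aug_eq_zero F F (fun p => c • LinearMap.id)
    (fun p => by rw [LinearMap.comp_smul, LinearMap.smul_comp, LinearMap.comp_id,
      LinearMap.id_comp]) (fun y => by
        rw [LinearMap.smul_apply, map_smul, LinearMap.id_apply]
        obtain ⟨b, hb⟩ := Ideal.Quotient.mk_surjective (F.aug y)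
        rw [← hb, Algebra.smul_def, Ideal.Quotient.algebraMap_eq,
          Ideal.Quotient.eq_zero_iff_mem.2 hc, zero_mul]) p hy
  refine ⟨Finsupp.mapRange.linearMap g z, ?_⟩
  rw [← mapRange_coefMap, hz, coefMap_smul_id, map_smul]
  ext s
  rw [Finsupp.smul_apply, Finsupp.mapRange.linearMap_apply, Finsupp.mapRange_apply, hg]

end FreeRes
end FreeRes

section Splitting

variable {k : Type*} [Field k] {U V W : Type*} [AddCommGroup U] [Module k U] [AddCommGroup V]
  [Module k V] [AddCommGroup W] [Module k W]

/-! ### Splitting exact sequences of vector spaces -/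

theorem exists_quasiInverse (f : V →ₗ[k] W) : ∃ g : W →ₗ[k] V, ∀ v, f (g (f v)) = f v := by
  obtain ⟨s, hs⟩ := f.rangeRestrict.exists_rightInverse_of_surjective f.range_rangeRestrict
  obtain ⟨g, hg⟩ := LinearMap.exists_extend s
  refine ⟨g, fun v => ?_⟩
  have h1 := LinearMap.congr_fun hg (f.rangeRestrict v)
  have h2 := LinearMap.congr_fun hs (f.rangeRestrict v)
  have h3 : g (f v) = s (f.rangeRestrict v) := h1
  rw [h3]
  exact congrArg Subtype.val h2

/-- Exactness on `V₀` is turned into a contraction `f s + t g = id` on `V₀` with values in the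
prescribed subspaces. In the application these are the parts of one fixed degree. -/
theorem exists_splitting (f : U →ₗ[k] V) (g : V →ₗ[k] W) (U₀ : Submodule k U) (V₀ : Submodule k V)
    (h : ∀ v ∈ V₀, g v = 0 → ∃ u ∈ U₀, f u = v) :
    ∃ (s : V →ₗ[k] U) (t : W →ₗ[k] V), (∀ v, s v ∈ U₀) ∧ (∀ w, t w ∈ V₀) ∧
      ∀ v ∈ V₀, f (s v) + t (g v) = v := by
  obtain ⟨g', hg'⟩ := exists_quasiInverse (g.domRestrict V₀)
  obtain ⟨f', hf'⟩ := exists_quasiInverse (f.domRestrict U₀)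
  refine ⟨U₀.subtype ∘ₗ f' ∘ₗ (LinearMap.id - V₀.subtype ∘ₗ g' ∘ₗ g), V₀.subtype ∘ₗ g',
    fun v => (f' _).2, fun w => (g' w).2, fun v hv => ?_⟩
  obtain ⟨u, hu, hfu⟩ := h (v - g' (g v)) (sub_mem hv (g' (g v)).2) (by
    have := hg' ⟨v, hv⟩
    simp only [LinearMap.domRestrict_apply] at this
    rw [map_sub, this, sub_self])
  have h1 := hf' ⟨u, hu⟩
  simp only [LinearMap.domRestrict_apply] at h1
  simp only [LinearMap.comp_apply, LinearMap.sub_apply, LinearMap.id_apply, Submodule.subtype_apply]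
  rw [← hfu, h1, hfu, sub_add_cancel]

end Splitting

section Residue

variable {k : Type w} [Field k] {B : Type u} [CommRing B] [Algebra k B]
  (𝒜 : ℤ → Submodule k B)

/-! ### The residue field -/

/-- The residue field `B / B₊`, concentrated in degree `0`. -/
def residueGrading (d : ℤ) : AddSubgroup (B ⧸ irrelevantIdeal 𝒜) := if d = 0 then ⊤ else ⊥

variable {𝒜}

theorem mem_residueGrading {d : ℤ} {c : B ⧸ irrelevantIdeal 𝒜} :
    c ∈ residueGrading 𝒜 d ↔ (d ≠ 0 → c = 0) := by
  unfold residueGrading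
  split_ifs with h <;> simp [h]

theorem smul_residue_eq_zero {b : B} (hb : b ∈ irrelevantIdeal 𝒜)
    (c : B ⧸ irrelevantIdeal 𝒜) : b • c = 0 := by
  rw [Algebra.smul_def, Ideal.Quotient.algebraMap_eq, Ideal.Quotient.eq_zero_iff_mem.2 hb, zero_mul]

theorem mem_irrelevantIdeal {d : ℤ} (hd : 0 < d) {b : B} (hb : b ∈ 𝒜 d) :
    b ∈ irrelevantIdeal 𝒜 := Ideal.subset_span ⟨d, hd, hb⟩

theorem gradedSMul_residueGrading (h𝒜 : ∀ d < 0, 𝒜 d = ⊥) :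
    SetLike.GradedSMul 𝒜 (residueGrading 𝒜) where
  smul_mem := fun a d b c hb hc => by
    rw [mem_residueGrading] at hc ⊢
    intro h
    by_cases hd : d = 0
    · rw [hd, vadd_eq_add, add_zero] at h
      rcases lt_or_gt_of_ne h with h' | h'
      · rw [h𝒜 a h'] at hb
        rw [(Submodule.mem_bot _).1 hb, zero_smul]
      · exact smul_residue_eq_zero (mem_irrelevantIdeal h' hb) c
    · rw [hc hd, smul_zero]

theorem grSpan_residueGrading : GrSpan (residueGrading 𝒜) := fun _ =>
  AddSubgroup.mem_iSup_of_mem 0 (mem_residueGrading.2 fun h => absurd rfl h)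

theorem grIndep_residueGrading : GrIndep (residueGrading 𝒜) := by
  intro T c hc h0 d hd
  by_cases h : d = 0
  · rwa [Finset.sum_eq_single_of_mem d hd fun e he hed =>
      mem_residueGrading.1 (hc e he) (h ▸ hed)] at h0
  · exact mem_residueGrading.1 (hc d hd) h

variable (𝒜) in
theorem exists_residue_section [GradedAlgebra 𝒜] (h𝒜 : ∀ d < 0, 𝒜 d = ⊥) (h0 : 𝒜 0 = 1)
    (c : B ⧸ irrelevantIdeal 𝒜) :
    ∃ z : k, Ideal.Quotient.mk (irrelevantIdeal 𝒜) (algebraMap k B z) = c := by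
  obtain ⟨b, rfl⟩ := Ideal.Quotient.mk_surjective c
  refine AddSubgroup.iSup_induction (fun d => (𝒜 d).toAddSubgroup)
    (C := fun b => ∃ z : k, Ideal.Quotient.mk (irrelevantIdeal 𝒜) (algebraMap k B z) =
      Ideal.Quotient.mk (irrelevantIdeal 𝒜) b) (grSpan_self 𝒜 b) (fun d b hb => ?_)
    ⟨0, by simp⟩ ?_
  · rcases lt_trichotomy d 0 with h | rfl | h
    · change b ∈ 𝒜 d at hb
      rw [h𝒜 d h] at hb
      exact ⟨0, by rw [(Submodule.mem_bot _).1 hb]; simp⟩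
    · change b ∈ 𝒜 0 at hb
      rw [h0] at hb
      obtain ⟨z, rfl⟩ := Submodule.mem_one.1 hb
      exact ⟨z, rfl⟩
    · exact ⟨0, by rw [map_zero, map_zero, Ideal.Quotient.eq_zero_iff_mem.2
        (mem_irrelevantIdeal h hb)]⟩
  · rintro a b ⟨y, hy⟩ ⟨z, hz⟩
    exact ⟨y + z, by rw [map_add, map_add, map_add, hy, hz]⟩

variable (𝒜) in
-- A map of sets suffices, because it is applied only to the coefficients of images of basis
-- vectors. The condition `σ 0 = 0` keeps supports finite.
theorem exists_residue_lift [GradedAlgebra 𝒜] (h𝒜 : ∀ d < 0, 𝒜 d = ⊥) (h0 : 𝒜 0 = 1) :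
    ∃ σ : (B ⧸ irrelevantIdeal 𝒜) → B, σ 0 = 0 ∧ (∀ c, σ c ∈ 𝒜 0) ∧
      ∀ c, Ideal.Quotient.mk (irrelevantIdeal 𝒜) (σ c) = c := by
  classical
  choose z hz using exists_residue_section 𝒜 h𝒜 h0
  refine ⟨fun c => if c = 0 then 0 else algebraMap k B (z c), if_pos rfl, fun c => ?_, fun c => ?_⟩
  · dsimp only
    split_ifs
    · exact zero_mem _
    · rw [h0]; exact Submodule.mem_one.2 ⟨_, rfl⟩
  · dsimp only
    split_ifs with h
    · rw [h, map_zero]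
    · exact hz c

/-- The part of degree `e` of `F ⊗ (B / B₊)` as a vector space. -/
def residueSubmodule {ι : Type u} (deg : ι → ℤ) (e : ℤ) :
    Submodule k (ι →₀ B ⧸ irrelevantIdeal 𝒜) where
  carrier := finGrading deg (residueGrading 𝒜) e
  zero_mem' := zero_mem _
  add_mem' := add_mem
  smul_mem' := fun z y hy s => mem_residueGrading.2 fun h => by
    rw [Finsupp.smul_apply, mem_residueGrading.1 (hy s) h, smul_zero]

theorem mem_residueSubmodule {ι : Type u} {deg : ι → ℤ} {e : ℤ}
    {y : ι →₀ B ⧸ irrelevantIdeal 𝒜} :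
    y ∈ residueSubmodule deg e ↔ y ∈ finGrading deg (residueGrading 𝒜) e := Iff.rfl

/-- In degree `e`, the space `F ⊗ k` is spanned by the basis vectors of degree `e`. So the maps `h
e` for all `e` amount to one prescription on basis vectors, which lifts with coefficients in `B_0`.
-/
theorem exists_graded_lift [GradedAlgebra 𝒜] (h𝒜 : ∀ d < 0, 𝒜 d = ⊥) (h0 : 𝒜 0 = 1)
    {ι κ : Type u} (deg : ι → ℤ) (deg' : κ → ℤ)
    (h : ℤ → (ι →₀ B ⧸ irrelevantIdeal 𝒜) →ₗ[k] (κ →₀ B ⧸ irrelevantIdeal 𝒜))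
    (hh : ∀ e v, h e v ∈ residueSubmodule deg' e) :
    ∃ H : (ι →₀ B) →ₗ[B] (κ →₀ B), IsGradedMap 𝒜 deg deg' H ∧
      ∀ e, ∀ v ∈ residueSubmodule deg e, coefMap (B ⧸ irrelevantIdeal 𝒜) H v = h e v := by
  obtain ⟨σ, hσ0, hσ, hσ'⟩ := exists_residue_lift 𝒜 h𝒜 h0
  let H : (ι →₀ B) →ₗ[B] (κ →₀ B) := Finsupp.linearCombination B fun s =>
    (h (deg s) (Finsupp.single s 1)).mapRange σ hσ0
  have hH : ∀ s t, H (Finsupp.single s 1) t = σ (h (deg s) (Finsupp.single s 1) t) := fun s t => by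
    simp [H]
  refine ⟨H, fun s t => ?_, fun e v hv => ?_⟩
  · rw [hH]
    by_cases hst : deg s - deg' t = 0
    · rw [hst]; exact hσ _
    · rw [mem_residueGrading.1 (hh _ _ t) hst, hσ0]; exact zero_mem _
  · rw [← Finsupp.sum_single v, Finsupp.sum, map_sum, map_sum]
    refine Finset.sum_congr rfl fun s hs => ?_
    have hse : e = deg s := by
      by_contra hne
      exact Finsupp.mem_support_iff.1 hs (mem_residueGrading.1 (hv s) (sub_ne_zero.2 hne))
    obtain ⟨z, hz⟩ := exists_residue_section 𝒜 h𝒜 h0 (v s)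
    have hz1 : Finsupp.single s (v s) = z • Finsupp.single s (1 : B ⧸ irrelevantIdeal 𝒜) := by
      rw [Finsupp.smul_single, ← hz, Algebra.smul_def, mul_one]
      rfl
    ext t
    rw [coefMap_single, hH, hz1, map_smul, Finsupp.smul_apply, hse, Algebra.smul_def,
      Ideal.Quotient.algebraMap_eq, hσ', ← hz, Algebra.smul_def, mul_comm]
    rfl

end Residue

/-! ### Tor of a torsion module, controlled by Tor of the residue field -/

section TorVanish

variable {k : Type w} [Field k] {B : Type u} [CommRing B] [Algebra k B]
  {𝒜 : ℤ → Submodule k B} {I : Ideal B} (G : FreeRes 𝒜 I)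

/-- `Tor_p^B(B / I, k)` vanishes in degree `e`. -/
def FreeRes.TorVanishAt (p : ℕ) (e : ℤ) : Prop :=
  ∀ y ∈ finGrading (G.deg (p + 1)) (residueGrading 𝒜) e,
    coefMap (B ⧸ irrelevantIdeal 𝒜) (G.d p) y = 0 →
      ∃ z, coefMap (B ⧸ irrelevantIdeal 𝒜) (G.d (p + 1)) z = y

/-- In a degree where `Tor_p(B / I, k)` vanishes, `F ⊗ k` is exact at the `p`-th place, hence split
exact over `k`. In other degrees the zero maps are taken. Lifting the splittings to `B` gives one
homotopy, correct modulo `B₊` on the basis vectors of the good degrees. -/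
theorem FreeRes.exists_contraction [GradedAlgebra 𝒜] (h𝒜 : ∀ d < 0, 𝒜 d = ⊥) (h0 : 𝒜 0 = 1)
    (p : ℕ) : ∃ (H : (G.ι (p + 1) →₀ B) →ₗ[B] (G.ι (p + 2) →₀ B))
      (H' : (G.ι p →₀ B) →ₗ[B] (G.ι (p + 1) →₀ B)),
      IsGradedMap 𝒜 (G.deg (p + 1)) (G.deg (p + 2)) H ∧
      IsGradedMap 𝒜 (G.deg p) (G.deg (p + 1)) H' ∧
      ∀ s, G.TorVanishAt p (G.deg (p + 1) s) → ∀ t,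
        (LinearMap.id - G.d (p + 1) ∘ₗ H - H' ∘ₗ G.d p : (G.ι (p + 1) →₀ B) →ₗ[B] (G.ι (p + 1) →₀ B))
          (Finsupp.single s 1) t ∈ irrelevantIdeal 𝒜 := by
  classical
  have := gradedSMul_residueGrading h𝒜
  set K := B ⧸ irrelevantIdeal 𝒜
  have hex : ∀ e : ℤ, ∃ (h : (G.ι (p + 1) →₀ K) →ₗ[k] (G.ι (p + 2) →₀ K))
      (h' : (G.ι p →₀ K) →ₗ[k] (G.ι (p + 1) →₀ K)),
      (∀ v, h v ∈ residueSubmodule (𝒜 := 𝒜) (G.deg (p + 2)) e) ∧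
      (∀ v, h' v ∈ residueSubmodule (𝒜 := 𝒜) (G.deg (p + 1)) e) ∧
      (G.TorVanishAt p e → ∀ v ∈ residueSubmodule (𝒜 := 𝒜) (G.deg (p + 1)) e,
        coefMap K (G.d (p + 1)) (h v) + h' (coefMap K (G.d p) v) = v) := by
    intro e
    by_cases he : G.TorVanishAt p e
    · obtain ⟨h, h', h1, h2, h3⟩ := exists_splitting
        ((coefMap K (G.d (p + 1))).restrictScalars k) ((coefMap K (G.d p)).restrictScalars k)
        (residueSubmodule (𝒜 := 𝒜) (G.deg (p + 2)) e) (residueSubmodule (G.deg (p + 1)) e)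
        (fun v hv hv0 => by
          obtain ⟨z, hz⟩ := he v hv hv0
          obtain ⟨z', hz', h⟩ := exists_homogeneous_preimage
            (grSpan_residueGrading.finsupp (G.deg (p + 2)))
            (grIndep_residueGrading.finsupp (G.deg (p + 1)))
            (coefMap K (G.d (p + 1))).toAddMonoidHom
            (fun d y hy => (G.isGradedMap_d (p + 1)).coefMap_mem (residueGrading 𝒜) hy) (e := e)
            (y := z) (by
              change coefMap K (G.d (p + 1)) z ∈ _
              rw [hz]; exact hv)
          exact ⟨z', hz', h.trans hz⟩)
      exact ⟨h, h', h1, h2, fun _ => h3⟩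
    · exact ⟨0, 0, fun _ => zero_mem _, fun _ => zero_mem _, fun h => absurd h he⟩
  choose h h' hm hm' hh using hex
  obtain ⟨H, hH, hHh⟩ := exists_graded_lift h𝒜 h0 (G.deg (p + 1)) (G.deg (p + 2)) h hm
  obtain ⟨H', hH', hHh'⟩ := exists_graded_lift h𝒜 h0 (G.deg p) (G.deg (p + 1)) h' hm'
  refine ⟨H, H', hH, hH', fun s hs t => ?_⟩
  have hs1 : Finsupp.single s (1 : K) ∈ residueSubmodule (𝒜 := 𝒜) (G.deg (p + 1))
      (G.deg (p + 1) s) :=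
    mem_residueSubmodule.2 (single_mem_finGrading (mem_residueGrading.2 fun h =>
      absurd (sub_self _) h))
  have key := hh _ hs _ hs1
  rw [← hHh _ _ hs1, ← hHh' _ _ ((G.isGradedMap_d p).coefMap_mem (residueGrading 𝒜) hs1),
    coefMap_coefMap, coefMap_coefMap] at key
  rw [← Ideal.Quotient.eq_zero_iff_mem]
  have h2 := coefMap_single (X := K)
    (LinearMap.id - G.d (p + 1) ∘ₗ H - H' ∘ₗ G.d p :
      (G.ι (p + 1) →₀ B) →ₗ[B] (G.ι (p + 1) →₀ B)) s 1 t
  rw [coefMap_sub, coefMap_sub, coefMap_id, sub_sub, key, sub_self, Algebra.smul_def, mul_one] at h2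
  exact h2.symm

/-- If `N` is `B₊`-torsion, then `Tor_p(B / I, N)` vanishes in degree `e` if `Tor_p(B / I, k)`
vanishes in the degrees `e - d` for all degrees `d` that occur in `N`. -/
theorem FreeRes.exists_coefMap_eq_of_torsion [GradedAlgebra 𝒜] (h𝒜 : ∀ d < 0, 𝒜 d = ⊥)
    (h0 : 𝒜 0 = 1) {N : Type*} [AddCommGroup N] [Module B N] (𝒩 : ℤ → AddSubgroup N)
    [SetLike.GradedSMul 𝒜 𝒩]
    (htor : ∀ y : N, ∃ K : ℕ, ∀ b ∈ irrelevantIdeal 𝒜 ^ K, b • y = 0) (p : ℕ) (e : ℤ)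
    (hN : ∀ d, 𝒩 d ≠ ⊥ → G.TorVanishAt p (e - d)) {y : G.ι (p + 1) →₀ N}
    (hy : y ∈ finGrading (G.deg (p + 1)) 𝒩 e) (hy0 : coefMap N (G.d p) y = 0) :
    ∃ z ∈ finGrading (G.deg (p + 2)) 𝒩 e, coefMap N (G.d (p + 1)) z = y := by
  classical
  obtain ⟨H, H', hH, hH', hΘ⟩ := G.exists_contraction h𝒜 h0 p
  set Θ : (G.ι (p + 1) →₀ B) →ₗ[B] (G.ι (p + 1) →₀ B) :=
    LinearMap.id - G.d (p + 1) ∘ₗ H - H' ∘ₗ G.d p with hΘdef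
  -- On a cycle `y` the map `Θ` subtracts the boundary of `H y`, and its matrix entries that meet
  -- the support of `y` lie in `B₊`. So `Θ y` is a homologous cycle killed by one power of `B₊`
  -- less.
  have key : ∀ (K : ℕ) (y : G.ι (p + 1) →₀ N), y ∈ finGrading (G.deg (p + 1)) 𝒩 e →
      coefMap N (G.d p) y = 0 → (∀ s, ∀ b ∈ irrelevantIdeal 𝒜 ^ K, b • y s = 0) →
      ∃ z ∈ finGrading (G.deg (p + 2)) 𝒩 e, coefMap N (G.d (p + 1)) z = y := by
    intro K
    induction K with
    | zero =>
      intro y _ _ hK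
      refine ⟨0, zero_mem _, ?_⟩
      rw [map_zero]
      ext s
      have := hK s 1 (by simp)
      rw [one_smul] at this
      exact this.symm
    | succ K ih =>
      intro y hy hy0 hK
      have hΘy : coefMap N Θ y = y - coefMap N (G.d (p + 1)) (coefMap N H y) := by
        rw [hΘdef, coefMap_sub, coefMap_sub, coefMap_id, coefMap_coefMap, ← coefMap_coefMap _ H',
          hy0, map_zero, sub_zero]
      have hHy : coefMap N H y ∈ finGrading (G.deg (p + 2)) 𝒩 e := hH.coefMap_mem 𝒩 hy
      obtain ⟨z, hz, hz'⟩ := ih (coefMap N Θ y) (by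
          rw [hΘy]
          exact sub_mem hy ((G.isGradedMap_d (p + 1)).coefMap_mem 𝒩 hHy)) (by
          rw [hΘy, map_sub, hy0, coefMap_coefMap, G.d_comp_d, coefMap_zero, sub_zero])
        (fun s b hb => by
          rw [coefMap_apply, Finset.smul_sum]
          refine Finset.sum_eq_zero fun t ht => ?_
          rw [smul_smul]
          refine hK t _ ?_
          rw [pow_succ]
          refine Ideal.mul_mem_mul hb (hΘ t ?_ s)
          -- The coefficient of `y` at `t` is nonzero of degree `e - deg t`, so the hypothesis
          -- applies to the degree `deg t` of the basis vector.
          have := hN (e - G.deg (p + 1) t) fun hbot => by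
            have h1 := hy t
            rw [hbot] at h1
            exact Finsupp.mem_support_iff.1 ht ((AddSubgroup.mem_bot).1 h1)
          rwa [sub_sub_cancel] at this)
      exact ⟨z + coefMap N H y, add_mem hz hHy, by rw [map_add, hz', hΘy, sub_add_cancel]⟩
  choose K hK using htor
  refine key (y.support.sup fun s => K (y s)) y hy hy0 fun s b hb => ?_
  by_cases hs : s ∈ y.support
  · exact hK (y s) b (Ideal.pow_le_pow_right (Finset.le_sup (f := fun s => K (y s)) hs) hb)
  · rw [Finsupp.notMem_support_iff.1 hs, smul_zero]

end TorVanish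

theorem subquotGrading_eq_bot_iff {B : Type u} [CommRing B] {X : Type v} [AddCommGroup X]
    [Module B X] {gr : ℤ → AddSubgroup X} {Z D : Submodule B X} {e : ℤ} :
    subquotGrading gr Z D e = ⊥ ↔ ∀ y ∈ Z, y ∈ gr e → y ∈ D := by
  constructor
  · intro h y hy hye
    have h1 : (D.submoduleOf Z).mkQ ⟨y, hy⟩ ∈ subquotGrading gr Z D e :=
      ⟨⟨y, hy⟩, hye, rfl⟩
    rw [h, AddSubgroup.mem_bot, Submodule.mkQ_apply, Submodule.Quotient.mk_eq_zero] at h1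
    exact h1
  · intro h
    rw [eq_bot_iff]
    rintro _ ⟨y, hy, rfl⟩
    rw [AddSubgroup.mem_bot]
    exact (Submodule.Quotient.mk_eq_zero _).2 (h y.1 y.2 hy)

theorem range_linearCombination_eq {k : Type w} [Field k] {B : Type u} [CommRing B] [Algebra k B]
    (𝒜 : ℤ → Submodule k B) {ι κ : Type u} {deg : ι → ℤ}
    (R : Submodule B (ι →₀ B)) (v : κ → (ι →₀ B)) (hv : ∀ t, v t ∈ R)
    (hR : ∀ e, ∀ y ∈ R, y ∈ freeGrading 𝒜 deg e → ∃ t, v t = y)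
    (hhom : ∀ y ∈ R, ∃ c : ℤ →₀ (ι →₀ B), (∀ d, c d ∈ freeGrading 𝒜 deg d) ∧ (∀ d, c d ∈ R) ∧
      c.sum (fun _ z => z) = y) :
    LinearMap.range (Finsupp.linearCombination B v) = R := by
  refine le_antisymm ?_ fun y hy => ?_
  · rw [Finsupp.range_linearCombination, Submodule.span_le]
    rintro _ ⟨t, rfl⟩
    exact hv t
  · obtain ⟨c, hc, hcR, rfl⟩ := hhom y hy
    rw [Finsupp.range_linearCombination]
    refine sum_mem fun d _ => ?_
    obtain ⟨t, ht⟩ := hR d _ (hcR d) (hc d)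
    exact Submodule.subset_span ⟨t, ht⟩

theorem linearCombination_single_mem {B : Type*} [CommRing B] {κ X : Type*} [AddCommGroup X]
    [Module B X] {v : κ → X} {P : AddSubgroup X} {t : κ} (h : v t ∈ P) :
    Finsupp.linearCombination B v (Finsupp.single t 1) ∈ P := by
  rwa [Finsupp.linearCombination_single, one_smul]

theorem single_one_mem_freeGrading {k : Type w} [Field k] {B : Type u} [CommRing B] [Algebra k B]
    (𝒜 : ℤ → Submodule k B) [GradedAlgebra 𝒜] {ι : Type u} (deg : ι → ℤ) (t : ι) :
    Finsupp.single t 1 ∈ freeGrading 𝒜 deg (deg t) := by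
  rw [freeGrading_eq]
  refine single_mem_finGrading ?_
  rw [sub_self]
  exact (SetLike.GradedOne.one_mem : (1 : B) ∈ 𝒜 0)

theorem isGradedMap_diff {k : Type w} [Field k] {B : Type u} [CommRing B] [Algebra k B]
    (𝒜 : ℤ → Submodule k B) (s : Stage B) :
    IsGradedMap 𝒜 (s.next 𝒜).deg s.deg (s.diff 𝒜) := fun t =>
  linearCombination_single_mem (v := fun t : s.NextIndex 𝒜 => (t.2 : s.ι →₀ B)) t.2.2.1

section CanonicalRes

variable {k : Type w} [Field k] {B : Type u} [CommRing B] [Algebra k B]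
  (𝒜 : ℤ → Submodule k B) [GradedAlgebra 𝒜]

/-! ### The canonical resolution -/

variable {M : Type u} [AddCommGroup M] [Module B M] (ℳ : ℤ → AddSubgroup M)

theorem resStage_rel_homogeneous [SetLike.GradedSMul 𝒜 ℳ] (hM : GrIndep ℳ) (p : ℕ)
    (y : (resStage 𝒜 ℳ p).ι →₀ B) (hy : y ∈ (resStage 𝒜 ℳ p).rel) :
    ∃ c : ℤ →₀ ((resStage 𝒜 ℳ p).ι →₀ B),
      (∀ d, c d ∈ freeGrading 𝒜 (resStage 𝒜 ℳ p).deg d) ∧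
      (∀ d, c d ∈ (resStage 𝒜 ℳ p).rel) ∧ c.sum (fun _ z => z) = y := by
  cases p with
  | zero =>
    exact exists_components_of_map_eq_zero (grSpan_freeGrading 𝒜 (Stage.first (B := B) ℳ).deg) hM
      (Finsupp.linearCombination B (fun s : Σ d : ℤ, ℳ d => (s.2 : M))).toAddMonoidHom
      (fun d z hz => map_mem_of_single_mem (deg := (Stage.first (B := B) ℳ).deg) ℳ (fun t =>
        linearCombination_single_mem (v := fun s : Σ d : ℤ, ℳ d => (s.2 : M)) t.2.2) hz) hy
  | succ p =>
    exact exists_components_of_map_eq_zero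
      (grSpan_freeGrading 𝒜 ((resStage 𝒜 ℳ p).next 𝒜).deg)
      (grIndep_freeGrading 𝒜 (resStage 𝒜 ℳ p).deg)
      ((resStage 𝒜 ℳ p).diff 𝒜).toAddMonoidHom
      (fun d z hz => (isGradedMap_diff 𝒜 _).map_mem hz) hy

theorem range_resDiff [SetLike.GradedSMul 𝒜 ℳ] (hM : GrIndep ℳ) (p : ℕ) :
    LinearMap.range (resDiff 𝒜 ℳ p) = (resStage 𝒜 ℳ p).rel :=
  range_linearCombination_eq 𝒜 (deg := (resStage 𝒜 ℳ p).deg) _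
    (fun t : (resStage 𝒜 ℳ p).NextIndex 𝒜 => (t.2 : (resStage 𝒜 ℳ p).ι →₀ B))
    (fun t => t.2.2.2) (fun e y hy hy' => ⟨⟨e, y, hy', hy⟩, rfl⟩)
    (resStage_rel_homogeneous 𝒜 ℳ hM p)

theorem resDiff_succ_eq_zero_iff [SetLike.GradedSMul 𝒜 ℳ] (hM : GrIndep ℳ) (p : ℕ)
    (y : Res 𝒜 ℳ (p + 1)) :
    resDiff 𝒜 ℳ p y = 0 ↔ y ∈ LinearMap.range (resDiff 𝒜 ℳ (p + 1)) := by
  rw [range_resDiff 𝒜 ℳ hM (p + 1)]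
  exact Iff.rfl

theorem linearCombination_eq_zero_iff [SetLike.GradedSMul 𝒜 ℳ] (hM : GrIndep ℳ)
    (y : Res 𝒜 ℳ 0) :
    Finsupp.linearCombination B (fun s : Σ d : ℤ, ℳ d => (s.2 : M)) y = 0 ↔
      y ∈ LinearMap.range (resDiff 𝒜 ℳ 0) := by
  rw [range_resDiff 𝒜 ℳ hM 0]
  exact Iff.rfl

/-- The vanishing of `Tor_p` in degree `e`, in terms of the canonical resolution. -/
theorem exists_coefMap_resDiff_eq (h𝒜 : ∀ d < 0, 𝒜 d = ⊥) (h0 : 𝒜 0 = 1) {p : ℕ} {e : ℤ}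
    (h : torGrading 𝒜 ℳ p e = ⊥) (y : (resStage 𝒜 ℳ p).ι →₀ B ⧸ irrelevantIdeal 𝒜)
    (hy : y ∈ finGrading (resStage 𝒜 ℳ p).deg (residueGrading 𝒜) e)
    (hcyc : ∀ q, ∀ hq : p = q + 1,
      coefMap (B ⧸ irrelevantIdeal 𝒜) (resDiff 𝒜 ℳ q) (hq ▸ y) = 0) :
    ∃ z, coefMap (B ⧸ irrelevantIdeal 𝒜) (resDiff 𝒜 ℳ p) z = y := by
  classical
  obtain ⟨σ, hσ0, hσ, hσ'⟩ := exists_residue_lift 𝒜 h𝒜 h0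
  let K := B ⧸ irrelevantIdeal 𝒜
  have hY : (TensorProduct.finsuppScalarLeft B K (resStage 𝒜 ℳ p).ι).symm y ∈
      torBoundaries 𝒜 ℳ p := by
    refine subquotGrading_eq_bot_iff.1 h _ ?_ ?_
    · cases p with
      | zero => exact Submodule.mem_top
      | succ q =>
        have h1 := hcyc q rfl
        rw [coefMap, LinearMap.comp_apply] at h1
        exact (LinearEquiv.map_eq_zero_iff _).1 h1
    -- The grading of the tensor product asks for a representative `v ⊗ 1` with `v` homogeneous, so
    -- the coefficients of `y` are lifted to `B_0`.
    · refine ⟨y.mapRange σ hσ0, fun s => ?_, ?_⟩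
      · rw [Finsupp.mapRange_apply]
        by_cases hs : e - (resStage 𝒜 ℳ p).deg s = 0
        · rw [hs]; exact hσ _
        · rw [mem_residueGrading.1 (hy s) hs, hσ0]; exact zero_mem _
      · rw [LinearEquiv.eq_symm_apply]
        ext s
        change TensorProduct.finsuppScalarLeft B K _ (y.mapRange σ hσ0 ⊗ₜ[B] (1 : K)) s = _
        rw [TensorProduct.finsuppScalarLeft_apply_tmul_apply, Finsupp.mapRange_apply,
          Algebra.smul_def, mul_one]
        exact hσ' _
  obtain ⟨z, hz⟩ := hY
  refine ⟨TensorProduct.finsuppScalarLeft B K _ z, ?_⟩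
  rw [LinearEquiv.eq_symm_apply] at hz
  rw [← hz]
  simp only [coefMap, LinearMap.comp_apply, LinearEquiv.coe_coe]
  congr 1
  change _ = (resDiff 𝒜 ℳ p).rTensor K z
  congr 1
  convert LinearEquiv.symm_apply_apply (TensorProduct.finsuppScalarLeft B K _) z

variable (I : Ideal B)

instance gradedSMul_quotientGrading : SetLike.GradedSMul 𝒜 (quotientGrading 𝒜 I) where
  smul_mem := by
    rintro a d b _ hb ⟨c, hc, rfl⟩
    refine ⟨b * c, SetLike.GradedMul.mul_mem hb hc, ?_⟩
    change Ideal.Quotient.mk I (b * c) = b • Ideal.Quotient.mk I c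
    rw [map_mul, Algebra.smul_def]
    rfl

instance gradedSMul_idealGrading : SetLike.GradedSMul 𝒜 (idealGrading 𝒜 I) where
  smul_mem := fun _ _ _ _ hb hc => SetLike.GradedMul.mul_mem hb hc

theorem grIndep_idealGrading : GrIndep (idealGrading 𝒜 I) :=
  (grIndep_self 𝒜).of_injective I.subtype.toAddMonoidHom Subtype.val_injective fun _ _ h => h

variable {I}

theorem sum_mem_of_isHomogeneous (hI : I.IsHomogeneous 𝒜) {T : Finset ℤ} {c : ℤ → B}
    (hc : ∀ d ∈ T, c d ∈ 𝒜 d) (h : ∑ d ∈ T, c d ∈ I) : ∀ d ∈ T, c d ∈ I := by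
  intro d hd
  have h1 := hI d h
  rwa [DirectSum.decompose_sum, DFinsupp.finsetSum_apply, AddSubmonoidClass.coe_finsetSum,
    Finset.sum_eq_single_of_mem d hd fun e he hed =>
      DirectSum.decompose_of_mem_ne 𝒜 (hc e he) hed,
    DirectSum.decompose_of_mem_same 𝒜 (hc d hd)] at h1

theorem grIndep_quotientGrading (hI : I.IsHomogeneous 𝒜) : GrIndep (quotientGrading 𝒜 I) := by
  intro T c hc h0 d hd
  choose! b hb hb' using hc
  have h1 : ∑ d ∈ T, b d ∈ I := by
    rw [← Ideal.Quotient.eq_zero_iff_mem, map_sum, ← h0]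
    exact Finset.sum_congr rfl hb'
  rw [← hb' d hd]
  exact Ideal.Quotient.eq_zero_iff_mem.2 (sum_mem_of_isHomogeneous 𝒜 hI hb h1 d hd)

theorem grSpan_idealGrading (hI : I.IsHomogeneous 𝒜) : GrSpan (idealGrading 𝒜 I) := by
  intro y
  obtain ⟨c, hc, hcy⟩ := (grSpan_self 𝒜).exists_finsupp y.1
  have hcI : ∀ d ∈ c.support, c d ∈ I :=
    sum_mem_of_isHomogeneous 𝒜 hI (fun d _ => hc d) (by rw [Finsupp.sum] at hcy; exact hcy ▸ y.2)
  have : y = ∑ d ∈ c.support.attach, ⟨c d.1, hcI d.1 d.2⟩ := Subtype.ext (by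
    rw [AddSubmonoidClass.coe_finsetSum, ← hcy, Finsupp.sum]
    exact (Finset.sum_attach c.support fun d => c d).symm)
  rw [this]
  exact sum_mem fun d _ => AddSubgroup.mem_iSup_of_mem d.1 (hc d.1)

variable (I)

/-- The canonical resolution of `B / I`. -/
noncomputable def quotientRes (hI : I.IsHomogeneous 𝒜) : FreeRes 𝒜 I where
  ι := fun p => match p with
    | 0 => PEmpty
    | p + 1 => (resStage 𝒜 (quotientGrading 𝒜 I) p).ι
  deg := fun p => match p with
    | 0 => fun _ => 0
    | p + 1 => (resStage 𝒜 (quotientGrading 𝒜 I) p).deg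
  d := fun p => match p with
    | 0 => 0
    | p + 1 => resDiff 𝒜 (quotientGrading 𝒜 I) p
  aug := Finsupp.linearCombination B fun s : Σ d : ℤ, quotientGrading 𝒜 I d => (s.2 : B ⧸ I)
  isEmpty_zero := inferInstanceAs (IsEmpty PEmpty)
  isGradedMap_d := fun p => match p with
    | 0 => fun _ => zero_mem _
    | p + 1 => isGradedMap_diff 𝒜 (resStage 𝒜 (quotientGrading 𝒜 I) p)
  aug_mem := fun t => linearCombination_single_mem
    (v := fun s : Σ d : ℤ, quotientGrading 𝒜 I d => (s.2 : B ⧸ I)) t.2.2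
  aug_lift := fun e b hb => ⟨Finsupp.single (⟨e, b, hb⟩ : Σ d : ℤ, quotientGrading 𝒜 I d) 1,
    single_one_mem_freeGrading 𝒜 (resStage 𝒜 (quotientGrading 𝒜 I) 0).deg
      (⟨e, b, hb⟩ : Σ d : ℤ, quotientGrading 𝒜 I d),
    (Finsupp.linearCombination_single B (1 : B)
      (⟨e, b, hb⟩ : Σ d : ℤ, quotientGrading 𝒜 I d)).trans (one_smul B b)⟩
  exact_aug := linearCombination_eq_zero_iff 𝒜 _ (grIndep_quotientGrading 𝒜 hI)
  exact_d := resDiff_succ_eq_zero_iff 𝒜 _ (grIndep_quotientGrading 𝒜 hI)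

/-- The map to `B` from the free module on the homogeneous elements of an ideal `I`; the free
module `B` is written as `PUnit →₀ B`. -/
noncomputable def idealCover :
    ((Σ d : ℤ, idealGrading 𝒜 I d) →₀ B) →ₗ[B] (PUnit.{u + 1} →₀ B) :=
  Finsupp.lsingle PUnit.unit ∘ₗ I.subtype ∘ₗ
    Finsupp.linearCombination B fun s : Σ d : ℤ, idealGrading 𝒜 I d => (s.2 : I)

theorem idealCover_apply (y : (Σ d : ℤ, idealGrading 𝒜 I d) →₀ B) :
    idealCover 𝒜 I y PUnit.unit =
      Finsupp.linearCombination B (fun s : Σ d : ℤ, idealGrading 𝒜 I d => (s.2 : I)) y := by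
  rw [idealCover, LinearMap.comp_apply, Finsupp.lsingle_apply, Finsupp.single_eq_same]
  rfl

theorem idealCover_eq_zero_iff (y : (Σ d : ℤ, idealGrading 𝒜 I d) →₀ B) :
    idealCover 𝒜 I y = 0 ↔
      Finsupp.linearCombination B (fun s : Σ d : ℤ, idealGrading 𝒜 I d => (s.2 : I)) y = 0 := by
  rw [← Submodule.coe_eq_zero, ← idealCover_apply, Finsupp.ext_iff]
  exact ⟨fun h => h _, fun h _ => h⟩

theorem isGradedMap_idealCover :
    IsGradedMap 𝒜 (Sigma.fst : (Σ d : ℤ, idealGrading 𝒜 I d) → ℤ) (fun _ => 0)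
      (idealCover 𝒜 I) := fun t s => by
  rw [sub_zero, Subsingleton.elim s PUnit.unit, idealCover_apply,
    Finsupp.linearCombination_single, one_smul]
  exact t.2.2

theorem range_idealCover (hI : I.IsHomogeneous 𝒜) (y : PUnit.{u + 1} →₀ B) :
    y ∈ LinearMap.range (idealCover 𝒜 I) ↔ y PUnit.unit ∈ I := by
  constructor
  · rintro ⟨z, rfl⟩
    rw [idealCover_apply]
    exact SetLike.coe_mem _
  · intro h
    have : (⟨y PUnit.unit, h⟩ : I) ∈ LinearMap.range (Finsupp.linearCombination B
        fun s : Σ d : ℤ, idealGrading 𝒜 I d => (s.2 : I)) := by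
      obtain ⟨c, hc, hcy⟩ := (grSpan_idealGrading 𝒜 hI).exists_finsupp ⟨y PUnit.unit, h⟩
      rw [Finsupp.range_linearCombination, ← hcy]
      exact sum_mem fun d _ => Submodule.subset_span ⟨⟨d, c d, hc d⟩, rfl⟩
    obtain ⟨z, hz⟩ := this
    refine ⟨z, Finsupp.ext fun s => ?_⟩
    rw [Subsingleton.elim s PUnit.unit, idealCover_apply, hz]

/-- The map `B → B / I`, where `B` is written as `PUnit →₀ B`. -/
noncomputable def punitAug : (PUnit.{u + 1} →₀ B) →ₗ[B] B ⧸ I :=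
  Submodule.mkQ I ∘ₗ Finsupp.lapply PUnit.unit

theorem punitAug_eq_zero_iff (hI : I.IsHomogeneous 𝒜) (y : PUnit.{u + 1} →₀ B) :
    punitAug I y = 0 ↔ y ∈ LinearMap.range (idealCover 𝒜 I) := by
  rw [range_idealCover 𝒜 I hI]
  exact Submodule.Quotient.mk_eq_zero I

theorem punitAug_single (b : B) :
    punitAug I (Finsupp.single PUnit.unit b) = Ideal.Quotient.mk I b := by
  rw [punitAug, LinearMap.comp_apply, Finsupp.lapply_apply, Finsupp.single_eq_same]
  rfl

theorem exists_punitAug_eq (e : ℤ) (c : B ⧸ I) (hc : c ∈ quotientGrading 𝒜 I e) :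
    ∃ y ∈ freeGrading 𝒜 (fun _ : PUnit.{u + 1} => 0) e, punitAug I y = c := by
  obtain ⟨b, hb, rfl⟩ := hc
  refine ⟨Finsupp.single PUnit.unit b, fun s => ?_, punitAug_single I b⟩
  rw [Subsingleton.elim s PUnit.unit, Finsupp.single_eq_same, sub_zero]
  exact hb

theorem punitAug_single_one_mem (t : PUnit.{u + 1}) :
    punitAug I (Finsupp.single t 1) ∈ quotientGrading 𝒜 I 0 :=
  ⟨1, (SetLike.GradedOne.one_mem : (1 : B) ∈ 𝒜 0), (punitAug_single I 1).symm⟩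

/-- The resolution of `B / I` which starts with `B` and continues with the canonical resolution
of `I`. -/
noncomputable def idealRes (hI : I.IsHomogeneous 𝒜) : FreeRes 𝒜 I where
  ι := fun p => match p with
    | 0 => PEmpty
    | 1 => PUnit
    | p + 2 => (resStage 𝒜 (idealGrading 𝒜 I) p).ι
  deg := fun p => match p with
    | 0 => fun _ => 0
    | 1 => fun _ => 0
    | p + 2 => (resStage 𝒜 (idealGrading 𝒜 I) p).deg
  d := fun p => match p with
    | 0 => 0
    | 1 => idealCover 𝒜 I
    | p + 2 => resDiff 𝒜 (idealGrading 𝒜 I) p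
  aug := punitAug I
  isEmpty_zero := inferInstanceAs (IsEmpty PEmpty)
  isGradedMap_d := fun p => match p with
    | 0 => fun _ => zero_mem _
    | 1 => isGradedMap_idealCover 𝒜 I
    | p + 2 => isGradedMap_diff 𝒜 (resStage 𝒜 (idealGrading 𝒜 I) p)
  aug_mem := punitAug_single_one_mem 𝒜 I
  aug_lift := exists_punitAug_eq 𝒜 I
  exact_aug := punitAug_eq_zero_iff 𝒜 I hI
  exact_d := fun p => match p with
    | 0 => fun y => (idealCover_eq_zero_iff 𝒜 I y).trans
        (linearCombination_eq_zero_iff 𝒜 _ (grIndep_idealGrading 𝒜 I) y)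
    | p + 1 => resDiff_succ_eq_zero_iff 𝒜 _ (grIndep_idealGrading 𝒜 I) p

variable {I}

theorem quotientRes_torVanishAt (h𝒜 : ∀ d < 0, 𝒜 d = ⊥) (h0 : 𝒜 0 = 1) (hI : I.IsHomogeneous 𝒜)
    {p : ℕ} {e : ℤ} (h : torGrading 𝒜 (quotientGrading 𝒜 I) p e = ⊥) :
    (quotientRes 𝒜 I hI).TorVanishAt p e := by
  intro y hy hy0
  refine exists_coefMap_resDiff_eq 𝒜 _ h𝒜 h0 h y hy ?_
  rintro q rfl
  exact hy0

/-- `t_n(B / I)` is defined by the canonical resolution of `B / I`, whereas the argument runs on the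
resolution that begins with `B`; Tor does not see the difference. -/
theorem idealRes_torVanishAt_of_quotient (h𝒜 : ∀ d < 0, 𝒜 d = ⊥) (h0 : 𝒜 0 = 1)
    (hI : I.IsHomogeneous 𝒜) {p : ℕ} {e : ℤ}
    (h : torGrading 𝒜 (quotientGrading 𝒜 I) p e = ⊥) :
    (idealRes 𝒜 I hI).TorVanishAt p e := by
  have := gradedSMul_residueGrading h𝒜
  exact FreeRes.exists_coefMap_eq_of_comparison (quotientRes 𝒜 I hI) (idealRes 𝒜 I hI)
    (residueGrading 𝒜) (quotientRes_torVanishAt 𝒜 h𝒜 h0 hI h)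

/-- The dimension shift `Tor_{p+2}(B / I, k) = Tor_{p+1}(I, k)`: beyond the term `B`, the resolution
is that of `I`. -/
theorem idealRes_torVanishAt_succ (h𝒜 : ∀ d < 0, 𝒜 d = ⊥) (h0 : 𝒜 0 = 1)
    (hI : I.IsHomogeneous 𝒜) {p : ℕ} {e : ℤ}
    (h : torGrading 𝒜 (idealGrading 𝒜 I) (p + 1) e = ⊥) :
    (idealRes 𝒜 I hI).TorVanishAt (p + 2) e := by
  intro y hy hy0
  refine exists_coefMap_resDiff_eq 𝒜 _ h𝒜 h0 h y hy ?_
  rintro q hq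
  obtain rfl : p = q := by simpa using hq
  exact hy0

end CanonicalRes

/-- Pointwise choices may have infinite support, so they are replaced by zero where `y` vanishes. -/
theorem exists_finsupp_lift {ι X Y : Type*} [Zero X] [Zero Y] {P : ι → X → Prop} {f : X → Y}
    (hf : f 0 = 0) (hP : ∀ s, P s 0) (y : ι →₀ Y) (h : ∀ s, ∃ z, P s z ∧ f z = y s) :
    ∃ z : ι →₀ X, (∀ s, P s (z s)) ∧ ∀ s, f (z s) = y s := by
  classical
  choose g hg hg' using h
  refine ⟨Finsupp.onFinset y.support (fun s => if y s = 0 then 0 else g s) (by simp +contextual),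
    fun s => ?_, fun s => ?_⟩
  · rw [Finsupp.onFinset_apply]
    split_ifs
    · exact hP s
    · exact hg s
  · rw [Finsupp.onFinset_apply]
    split_ifs with h
    · rw [hf, h]
    · exact hg' s

instance gradedSMul_subquotGrading {k : Type w} [Field k] {B : Type u} [CommRing B] [Algebra k B]
    (𝒜 : ℤ → Submodule k B) {X : Type*} [AddCommGroup X] [Module B X] (gr : ℤ → AddSubgroup X)
    [SetLike.GradedSMul 𝒜 gr] (Z D : Submodule B X) :
    SetLike.GradedSMul 𝒜 (subquotGrading gr Z D) where
  smul_mem := by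
    rintro a d b _ hb ⟨y, hy, rfl⟩
    exact ⟨b • y, grSmul_mem 𝒜 gr (m := (y : X)) hb hy, map_smul (D.submoduleOf Z).mkQ b y⟩

section Staircase

variable {k : Type w} [Field k] {B : Type u} [CommRing B] [Algebra k B]
  {𝒜 : ℤ → Submodule k B} [GradedAlgebra 𝒜] {r : ℕ} {x : Fin r → B}
  {I : Ideal B} (G : FreeRes 𝒜 I)
  {M : Type v} [AddCommGroup M] [Module B M] (ℳ : ℤ → AddSubgroup M) [SetLike.GradedSMul 𝒜 ℳ]

/-! ### The double complex of a free resolution and a Čech complex -/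

/-- A power of `x a` lies in `I`, hence kills Tor, and is invertible on the localization. -/
theorem exists_coefMap_eq_of_cechLoc (hxI : ∀ a, ∃ K : ℕ, x a ^ K ∈ I) {S : Finset (Fin r)}
    {a : Fin r} (ha : a ∈ S) (p : ℕ) {y : G.ι (p + 1) →₀ CechLoc x M S}
    (hy : coefMap _ (G.d p) y = 0) : ∃ z, coefMap _ (G.d (p + 1)) z = y := by
  obtain ⟨K, hK⟩ := hxI a
  exact G.exists_coefMap_eq_of_mem hK
    ⟨LocalizedModule.divBy ⟨x a ^ K, pow_mem (mem_cechMonoid x ha) K⟩, fun z =>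
      LocalizedModule.mul_by_divBy ⟨x a ^ K, pow_mem (mem_cechMonoid x ha) K⟩ z⟩ p hy

theorem exists_coefMap_eq_of_cech (hxI : ∀ a, ∃ K : ℕ, x a ^ K ∈ I) (p q : ℕ)
    {y : G.ι (p + 1) →₀ Cech x M (q + 1)} (hy : coefMap _ (G.d p) y = 0) :
    ∃ z, coefMap _ (G.d (p + 1)) z = y := by
  classical
  have hex : ∀ S : {S : Finset (Fin r) // S.card = q + 1}, ∃ z : G.ι (p + 2) →₀ CechLoc x M S.1,
      coefMap _ (G.d (p + 1)) z =
        Finsupp.mapRange.linearMap (LinearMap.proj (R := B)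
          (φ := fun S : {S : Finset (Fin r) // S.card = q + 1} => CechLoc x M S.1) S) y := by
    intro S
    obtain ⟨a, ha⟩ := Finset.card_pos.1 (S.2.symm ▸ Nat.succ_pos q : 0 < S.1.card)
    exact exists_coefMap_eq_of_cechLoc G hxI ha p (by rw [← mapRange_coefMap, hy, map_zero])
  choose z hz using hex
  refine ⟨∑ S, Finsupp.mapRange.linearMap (LinearMap.single B
    (fun S : {S : Finset (Fin r) // S.card = q + 1} => CechLoc x M S.1) S) (z S), ?_⟩
  rw [map_sum]
  simp only [← mapRange_coefMap, hz]
  ext s : 1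
  rw [Finsupp.finsetSum_apply]
  exact Finset.univ_sum_single (y s)

theorem exists_homogeneous_coefMap_eq_of_cech (hx : ∀ a, ∃ d : ℤ, x a ∈ 𝒜 d) (hM : GrSpan ℳ)
    (hM' : GrIndep ℳ) (hxI : ∀ a, ∃ K : ℕ, x a ^ K ∈ I) (p q : ℕ) {e : ℤ}
    {y : G.ι (p + 1) →₀ Cech x M (q + 1)}
    (hye : y ∈ finGrading (G.deg (p + 1)) (cechGrading x 𝒜 ℳ (q + 1)) e)
    (hy : coefMap _ (G.d p) y = 0) :
    ∃ z ∈ finGrading (G.deg (p + 2)) (cechGrading x 𝒜 ℳ (q + 1)) e,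
      coefMap _ (G.d (p + 1)) z = y := by
  obtain ⟨z, rfl⟩ := exists_coefMap_eq_of_cech G hxI p q hy
  exact exists_homogeneous_preimage
    ((grSpan_cechGrading 𝒜 ℳ hx hM (q + 1)).finsupp (G.deg (p + 2)))
    ((grIndep_cechGrading 𝒜 ℳ hx hM' (q + 1)).finsupp (G.deg (p + 1)))
    (coefMap _ (G.d (p + 1))).toAddMonoidHom
    (fun d _ hz => (G.isGradedMap_d (p + 1)).coefMap_mem (cechGrading x 𝒜 ℳ (q + 1)) hz) hye

theorem mapRange_cechDiff_mem {ι : Type*} {deg : ι → ℤ} {p : ℕ} {e : ℤ} {y : ι →₀ Cech x M p}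
    (hy : y ∈ finGrading deg (cechGrading x 𝒜 ℳ p) e) :
    Finsupp.mapRange.linearMap (cechDiff x M p) y ∈
      finGrading deg (cechGrading x 𝒜 ℳ (p + 1)) e :=
  fun s => cechDiff_mem_cechGrading 𝒜 ℳ (hy s)

theorem mapRange_cechDiff_cechDiff {ι : Type*} {p : ℕ} (y : ι →₀ Cech x M p) :
    Finsupp.mapRange.linearMap (cechDiff x M (p + 1))
      (Finsupp.mapRange.linearMap (cechDiff x M p) y) = 0 :=
  Finsupp.ext fun s => cechDiff_cechDiff x (y s)

/-- If `Tor_p(B / I, H^p(M))` vanishes in degree `e` for all `p`, then so does `M / I M`. -/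
theorem exists_coefMap_eq_of_staircase (hx : ∀ a, ∃ d : ℤ, x a ∈ 𝒜 d) (hM : GrSpan ℳ)
    (hM' : GrIndep ℳ) (hxI : ∀ a, ∃ K : ℕ, x a ^ K ∈ I) {e : ℤ}
    (hTor : ∀ (p : ℕ) (y : G.ι (p + 1) →₀ Cech x M p),
      y ∈ finGrading (G.deg (p + 1)) (cechGrading x 𝒜 ℳ p) e → (∀ s, cechDiff x M p (y s) = 0) →
      (∀ s, coefMap _ (G.d p) y s ∈ cechBoundaries x M p) →
      ∃ z ∈ finGrading (G.deg (p + 2)) (cechGrading x 𝒜 ℳ p) e,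
        (∀ s, cechDiff x M p (z s) = 0) ∧
        ∀ s, (y - coefMap _ (G.d (p + 1)) z) s ∈ cechBoundaries x M p)
    {y : G.ι 1 →₀ Cech x M 0} (hy : y ∈ finGrading (G.deg 1) (cechGrading x 𝒜 ℳ 0) e) :
    ∃ z, coefMap _ (G.d 1) z = y := by
  have hempty := G.isEmpty_zero
  obtain ⟨Y, rfl, hY, hYd⟩ := exists_seq (α := fun q => G.ι (q + 1) →₀ Cech x M q)
    (P := fun q y => y ∈ finGrading (G.deg (q + 1)) (cechGrading x 𝒜 ℳ q) e ∧
      coefMap _ (G.d q) (Finsupp.mapRange.linearMap (cechDiff x M q) y) = 0)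
    (R := fun q y y' => coefMap _ (G.d (q + 1)) y' =
      Finsupp.mapRange.linearMap (cechDiff x M q) y) y
    ⟨hy, Subsingleton.elim _ _⟩
    (fun q y hy => by
      obtain ⟨z, hz, hz'⟩ := exists_homogeneous_coefMap_eq_of_cech G ℳ hx hM hM' hxI q q
        (mapRange_cechDiff_mem ℳ hy.1) hy.2
      exact ⟨z, ⟨hz, by rw [← mapRange_coefMap, hz', mapRange_cechDiff_cechDiff]⟩, hz'⟩)
  -- Descend again: modulo boundaries of `F`, each `Y q` can be made a Čech cocycle. The start is `q
  -- = r`, since there are no Čech cochains in degree `r + 1`.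
  have down : ∀ m q, q + m = r → ∃ z ∈ finGrading (G.deg (q + 2)) (cechGrading x 𝒜 ℳ q) e,
      Finsupp.mapRange.linearMap (cechDiff x M q) (Y q - coefMap _ (G.d (q + 1)) z) = 0 := by
    intro m
    induction m with
    | zero =>
      rintro q hq
      refine ⟨0, zero_mem _, Finsupp.ext fun s => funext fun S => ?_⟩
      have h1 := Finset.card_le_univ S.1
      rw [S.2, Fintype.card_fin] at h1
      omega
    | succ m ih =>
      intro q hq
      obtain ⟨z, hz, hz0⟩ := ih (q + 1) (by omega)
      set U := Y (q + 1) - coefMap _ (G.d (q + 2)) z with hU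
      have hdU : coefMap _ (G.d (q + 1)) U =
          Finsupp.mapRange.linearMap (cechDiff x M q) (Y q) := by
        rw [hU, map_sub, hYd q, coefMap_coefMap, G.d_comp_d, coefMap_zero, sub_zero]
      have hUe : U ∈ finGrading (G.deg (q + 2)) (cechGrading x 𝒜 ℳ (q + 1)) e :=
        sub_mem (hY (q + 1)).1 ((G.isGradedMap_d (q + 2)).coefMap_mem (cechGrading x 𝒜 ℳ (q + 1)) hz)
      -- `U` is a Čech cocycle whose `F`-boundary is a Čech coboundary, so it represents a cycle of
      -- `F ⊗ H^{q+1}`. By hypothesis this is a boundary, and `U` is the Čech coboundary of some `t`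
      -- up to the `F`-boundary of a cocycle. This `t` corrects `Y q`.
      obtain ⟨z', hz', hz'0, hbd⟩ := hTor (q + 1) U hUe
        (fun s => DFunLike.congr_fun hz0 s)
        (fun s => by rw [hdU]; exact ⟨Y q s, rfl⟩)
      obtain ⟨t, ht, ht'⟩ := exists_finsupp_lift
        (P := fun s c => c ∈ cechGrading x 𝒜 ℳ q (e - G.deg (q + 2) s))
        (f := cechDiff x M q) (map_zero _) (fun s => zero_mem _)
        (U - coefMap _ (G.d (q + 2)) z') (fun s => by
          obtain ⟨c, hc⟩ := hbd s
          have h1 : cechDiff x M q c ∈ cechGrading x 𝒜 ℳ (q + 1) (e - G.deg (q + 2) s) := by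
            rw [hc]
            exact sub_mem hUe
              ((G.isGradedMap_d (q + 2)).coefMap_mem (cechGrading x 𝒜 ℳ (q + 1)) hz') s
          obtain ⟨c', hc', h2⟩ := exists_homogeneous_preimage (grSpan_cechGrading 𝒜 ℳ hx hM q)
            (grIndep_cechGrading 𝒜 ℳ hx hM' (q + 1)) (cechDiff x M q).toAddMonoidHom
            (fun d _ hz => cechDiff_mem_cechGrading 𝒜 ℳ hz) h1
          exact ⟨c', hc', h2.trans hc⟩)
      have ht'' : Finsupp.mapRange.linearMap (cechDiff x M q) t =
          U - coefMap _ (G.d (q + 2)) z' := Finsupp.ext ht'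
      refine ⟨t, ht, ?_⟩
      rw [map_sub, mapRange_coefMap, ht'', map_sub, hdU, coefMap_coefMap, G.d_comp_d, coefMap_zero,
        sub_zero, sub_self]
  obtain ⟨z, hz, hz0⟩ := down r 0 (Nat.zero_add r)
  obtain ⟨z', -, -, hbd⟩ := hTor 0 (Y 0 - coefMap _ (G.d 1) z)
    (sub_mem hy ((G.isGradedMap_d 1).coefMap_mem (cechGrading x 𝒜 ℳ 0) hz))
    (fun s => DFunLike.congr_fun hz0 s) (fun s => isEmptyElim s)
  refine ⟨z + z', ?_⟩
  -- In Čech degree `0` the coboundaries are zero, so equality of classes is equality.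
  have h1 : Y 0 - coefMap _ (G.d 1) z - coefMap _ (G.d 1) z' = 0 :=
    Finsupp.ext fun s => (Submodule.mem_bot B).1 (hbd s)
  rw [map_add, eq_comm, ← sub_eq_zero, ← sub_sub, h1]

/-- Each `x a` acts nilpotently on the class, so `B₊` lies in the radical of its annihilator; `B₊`
is finitely generated. -/
theorem exists_pow_smul_locCoh_eq_zero [IsNoetherianRing B] (hx : IsCechFamily 𝒜 x) (p : ℕ)
    (y : LocCoh x M p) : ∃ K : ℕ, ∀ b ∈ irrelevantIdeal 𝒜 ^ K, b • y = 0 := by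
  have hle : irrelevantIdeal 𝒜 ≤ (Ideal.torsionOf B _ y).radical := by
    rw [← hx.radical_eq, Ideal.radical_le_radical_iff, Ideal.span_le]
    rintro _ ⟨a, rfl⟩
    obtain ⟨⟨α, hα⟩, rfl⟩ := Submodule.mkQ_surjective _ y
    obtain ⟨K, hK⟩ := exists_pow_smul_mem_cechBoundaries x a p α hα
    refine ⟨K, ?_⟩
    rw [Ideal.mem_torsionOf_iff, ← map_smul]
    exact (Submodule.Quotient.mk_eq_zero _).2 hK
  obtain ⟨K, hK⟩ := Ideal.exists_pow_le_of_le_radical_of_fg hle (IsNoetherian.noetherian _)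
  exact ⟨K, fun b hb => (Ideal.mem_torsionOf_iff y b).1 (hK hb)⟩

/-- The torsion criterion for `N = H^p(M)`, rewritten with cocycles and coboundaries in place of
classes: this is the input of the staircase. -/
theorem cechTor_of_torVanishAt [IsNoetherianRing B] (hx : IsCechFamily 𝒜 x)
    (h𝒜 : ∀ d < 0, 𝒜 d = ⊥) (h0 : 𝒜 0 = 1) {p : ℕ} {e : ℤ}
    (hH : ∀ d, ¬ CechVanishAt 𝒜 (x := x) ℳ p d → G.TorVanishAt p (e - d))
    (y : G.ι (p + 1) →₀ Cech x M p)
    (hy : y ∈ finGrading (G.deg (p + 1)) (cechGrading x 𝒜 ℳ p) e)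
    (hy0 : ∀ s, cechDiff x M p (y s) = 0)
    (hyb : ∀ s, coefMap _ (G.d p) y s ∈ cechBoundaries x M p) :
    ∃ z ∈ finGrading (G.deg (p + 2)) (cechGrading x 𝒜 ℳ p) e,
      (∀ s, cechDiff x M p (z s) = 0) ∧
      ∀ s, (y - coefMap _ (G.d (p + 1)) z) s ∈ cechBoundaries x M p := by
  set Z := LinearMap.ker (cechDiff x M p) with hZ
  set D := cechBoundaries x M p
  set gr := subquotGrading (cechGrading x 𝒜 ℳ p) Z D
  obtain ⟨y', -, hy'⟩ := exists_finsupp_lift (P := fun _ _ => True) (f := Z.subtype)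
    (map_zero _) (fun _ => trivial) y (fun s => ⟨⟨y s, hy0 s⟩, trivial, rfl⟩)
  have hy'' : Finsupp.mapRange.linearMap Z.subtype y' = y := Finsupp.ext hy'
  let π := (D.submoduleOf Z).mkQ
  have hπ : ∀ c, π c = 0 ↔ c.1 ∈ D := fun c => Submodule.Quotient.mk_eq_zero _
  obtain ⟨z, hz, hz'⟩ := G.exists_coefMap_eq_of_torsion h𝒜 h0 gr
    (exists_pow_smul_locCoh_eq_zero hx p) p e
    (fun d hd => hH d fun hv => hd (subquotGrading_eq_bot_iff.2 fun y hy hye => hv y hye hy))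
    (y := Finsupp.mapRange.linearMap π y')
    (fun s => ⟨y' s, by
      change (y' s : Cech x M p) ∈ cechGrading x 𝒜 ℳ p (e - G.deg (p + 1) s)
      have h1 : (y' s : Cech x M p) = y s := hy' s
      rw [h1]; exact hy s, rfl⟩)
    (by
      rw [← mapRange_coefMap]
      refine Finsupp.ext fun s => (hπ _).2 ?_
      have h1 := hyb s
      rw [← hy'', ← mapRange_coefMap] at h1
      exact h1)
  obtain ⟨w, hw, hw'⟩ := exists_finsupp_lift
    (P := fun s (c : Z) => (c : Cech x M p) ∈ cechGrading x 𝒜 ℳ p (e - G.deg (p + 2) s)) (f := π)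
    (map_zero _) (fun _ => zero_mem _) z (fun s => by
      obtain ⟨c, hc, hc'⟩ := hz s
      exact ⟨c, hc, hc'⟩)
  have hw'' : Finsupp.mapRange.linearMap π w = z := Finsupp.ext hw'
  refine ⟨Finsupp.mapRange.linearMap Z.subtype w, fun s => hw s, fun s => (w s).2, fun s => ?_⟩
  rw [← hy'', ← mapRange_coefMap, ← map_sub]
  refine (hπ ((y' - coefMap _ (G.d (p + 1)) w) s)).1 ?_
  have h1 : Finsupp.mapRange.linearMap π (y' - coefMap _ (G.d (p + 1)) w) = 0 := by
    rw [map_sub, mapRange_coefMap, hw'', hz', sub_self]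
  exact DFunLike.congr_fun h1 s

/-- The isomorphism of `M` with the Čech cochains of degree `0`. -/
noncomputable def cechZero (x : Fin r → B) (M : Type v) [AddCommGroup M] [Module B M] :
    M →ₗ[B] Cech x M 0 :=
  LinearMap.pi fun S => LocalizedModule.mkLinearMap (cechMonoid x S.1) M

theorem eq_one_of_mem_cechMonoid {S : Finset (Fin r)} (hS : S.card = 0) (s : cechMonoid x S) :
    s = 1 := by
  obtain ⟨s, hs⟩ := s
  rw [cechMonoid, Finset.card_eq_zero.1 hS, Finset.coe_empty, Set.image_empty,
    Submonoid.closure_empty, Submonoid.mem_bot] at hs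
  exact Subtype.ext hs

theorem cechZero_injective : Function.Injective (cechZero x M) := by
  intro m m' h
  have h1 := congrFun h ⟨∅, rfl⟩
  obtain ⟨t, ht⟩ := LocalizedModule.mk_eq.1 h1
  rw [eq_one_of_mem_cechMonoid rfl t] at ht
  simpa using ht

theorem cechZero_surjective : Function.Surjective (cechZero x M) := by
  intro α
  obtain ⟨m, hm⟩ : ∃ m : M, LocalizedModule.mkLinearMap _ M m = α ⟨∅, rfl⟩ := by
    induction α ⟨∅, rfl⟩ using LocalizedModule.induction_on with
    | h m s => exact ⟨m, by rw [eq_one_of_mem_cechMonoid rfl s]; rfl⟩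
  refine ⟨m, funext fun S => ?_⟩
  obtain ⟨S, hS⟩ := S
  obtain rfl := Finset.card_eq_zero.1 hS
  exact hm

theorem coefMap_apply_mem_smul_top {ι κ : Type*} {X : Type*} [AddCommGroup X] [Module B X]
    (φ : (ι →₀ B) →ₗ[B] (κ →₀ B)) {s : κ} (hφ : ∀ y, φ y s ∈ I) (z : ι →₀ X) :
    coefMap X φ z s ∈ I • (⊤ : Submodule B X) := by
  rw [coefMap_apply]
  exact sum_mem fun t _ => Submodule.smul_mem_smul (hφ _) Submodule.mem_top

/-- A homogeneous element of `M` lies in `I M` if, for all `p`, no degree of `H^p(M)` and no degree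
of `Tor_p(B / I, k)` add up to its degree. -/
theorem mem_ideal_smul_top_of_torVanishAt [IsNoetherianRing B] (hx : IsCechFamily 𝒜 x)
    (h𝒜 : ∀ d < 0, 𝒜 d = ⊥) (h0 : 𝒜 0 = 1) (hI : I.IsHomogeneous 𝒜) (hM : GrSpan ℳ)
    (hM' : GrIndep ℳ) (hxI : ∀ a, ∃ K : ℕ, x a ^ K ∈ I) {e : ℤ}
    (hH : ∀ p d, ¬ CechVanishAt 𝒜 (x := x) ℳ p d → (idealRes 𝒜 I hI).TorVanishAt p (e - d))
    {m : M} (hm : m ∈ ℳ e) : m ∈ I • (⊤ : Submodule B M) := by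
  have hmem : cechZero x M m ∈ cechGrading x 𝒜 ℳ 0 e := (mem_cechGrading 𝒜 ℳ).2 fun S =>
    mk_mem_locGrading 𝒜 ℳ (s := 1) SetLike.GradedOne.one_mem hm (zero_add e).symm
  -- `M` sits in the double complex as `F_0 ⊗ Č^0`, with `F_0 = B`. The image of `F_1` in `F_0` is
  -- `I`, so being a boundary there means lying in `I M`.
  let t : (idealRes 𝒜 I hI).ι 1 := (PUnit.unit : PUnit.{u + 1})
  have ht : (idealRes 𝒜 I hI).deg 1 t = 0 := rfl
  have hdt : ∀ y, (idealRes 𝒜 I hI).d 1 y t ∈ I := fun y =>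
    (range_idealCover 𝒜 I hI _).1 ⟨y, rfl⟩
  obtain ⟨z, hz⟩ := exists_coefMap_eq_of_staircase (idealRes 𝒜 I hI) ℳ hx.homogeneous hM hM' hxI
    (fun p => cechTor_of_torVanishAt (idealRes 𝒜 I hI) ℳ hx h𝒜 h0 (hH p))
    (y := Finsupp.single t (cechZero x M m)) (single_mem_finGrading (by rwa [ht, sub_zero]))
  have h1 : cechZero x M m ∈ I • (⊤ : Submodule B (Cech x M 0)) := by
    have h2 := coefMap_apply_mem_smul_top ((idealRes 𝒜 I hI).d 1) hdt z
    rwa [hz, Finsupp.single_eq_same] at h2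
  have h4 : (I • (⊤ : Submodule B M)).map (cechZero x M) = I • (⊤ : Submodule B (Cech x M 0)) := by
    rw [Submodule.map_smul'', Submodule.map_top, LinearMap.range_eq_top.2 cechZero_surjective]
  rw [← h4] at h1
  obtain ⟨m', hm', h5⟩ := h1
  rwa [← cechZero_injective h5]

end Staircase

section Sub

variable {k : Type w} [Field k] {B : Type u} [CommRing B] [Algebra k B]
  (𝒜 : ℤ → Submodule k B) [GradedAlgebra 𝒜] {r : ℕ} {x : Fin r → B}

/-! ### Local cohomology of graded submodules -/

section ShortExact

variable {A M Q : Type*} [AddCommGroup A] [Module B A] [AddCommGroup M] [Module B M]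
  [AddCommGroup Q] [Module B Q] (gA : ℤ → AddSubgroup A) (gM : ℤ → AddSubgroup M)
  (gQ : ℤ → AddSubgroup Q) [SetLike.GradedSMul 𝒜 gA] [SetLike.GradedSMul 𝒜 gM]
  [SetLike.GradedSMul 𝒜 gQ]

/-- The segment `H^p(Q) → H^{p+1}(A) → H^{p+1}(M)` of the long exact sequence in degree `e`. The
primitive in `M` has to be chosen homogeneous, so that its image in `Q` has degree `e`. -/
theorem CechVanishAt.succ_of_exact (hx : ∀ a, ∃ d : ℤ, x a ∈ 𝒜 d) (hM : GrSpan gM)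
    (hM' : GrIndep gM) {f : A →ₗ[B] M} {g : M →ₗ[B] Q} (hf : Function.Injective f)
    (hg : Function.Surjective g) (h : Function.Exact f g) (hfgr : ∀ d, ∀ z ∈ gA d, f z ∈ gM d)
    (hggr : ∀ d, ∀ z ∈ gM d, g z ∈ gQ d) {p : ℕ} {e : ℤ} (hQ : CechVanishAt 𝒜 (x := x) gQ p e)
    (hMe : CechVanishAt 𝒜 (x := x) gM (p + 1) e) : CechVanishAt 𝒜 (x := x) gA (p + 1) e := by
  intro α hα hα0
  have hfα := cechMap_mem_cechGrading 𝒜 gA gM hfgr hα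
  obtain ⟨β, hβ⟩ := hMe _ hfα (by rw [cechDiff_cechMap, hα0, map_zero])
  obtain ⟨γ, hγ, hγβ⟩ := exists_homogeneous_preimage (grSpan_cechGrading 𝒜 gM hx hM p)
    (grIndep_cechGrading 𝒜 gM hx hM' (p + 1)) (cechDiff x M p).toAddMonoidHom
    (fun d _ hz => cechDiff_mem_cechGrading 𝒜 gM hz) (e := e) (y := β)
    (by rw [LinearMap.toAddMonoidHom_coe, hβ]; exact hfα)
  have hγ' : cechDiff x M p γ = cechMap x f (p + 1) α := hγβ.trans hβ
  refine mem_cechBoundaries_of_connecting x hf hg h hγ' ?_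
  exact hQ _ (cechMap_mem_cechGrading 𝒜 gM gQ hggr hγ)
    (by rw [cechDiff_cechMap, hγ', cechMap_comp_eq_zero x h])

theorem CechVanishAt.zero_of_injective {f : A →ₗ[B] M} (hf : Function.Injective f)
    (hfgr : ∀ d, ∀ z ∈ gA d, f z ∈ gM d) {e : ℤ} (hMe : CechVanishAt 𝒜 (x := x) gM 0 e) :
    CechVanishAt 𝒜 (x := x) gA 0 e := by
  intro α hα hα0
  have h := hMe _ (cechMap_mem_cechGrading 𝒜 gA gM hfgr hα)
    (by rw [cechDiff_cechMap, hα0, map_zero])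
  refine (Submodule.mem_bot B).2 (cechMap_injective x hf 0 ?_)
  rw [map_zero]
  exact (Submodule.mem_bot B).1 h

/-- `Č^0(M) = M` as graded modules: the only denominator is `1`, which has degree `0` and no other
since `B ≠ 0`. -/
theorem cechVanishAt_zero_of_eq_bot [Nontrivial B] {e : ℤ} (he : gM e = ⊥) :
    CechVanishAt 𝒜 (x := x) gM 0 e := by
  intro α hα _
  refine (Submodule.mem_bot B).2 (funext fun S => ?_)
  obtain ⟨a, m, s, hs, hm, h⟩ := (mem_cechGrading 𝒜 gM).1 hα S
  rw [eq_one_of_mem_cechMonoid S.2 s] at hs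
  obtain rfl : a = 0 :=
    DirectSum.degree_eq_of_mem_mem 𝒜 hs SetLike.GradedOne.one_mem one_ne_zero
  rw [zero_add, he, AddSubgroup.mem_bot] at hm
  rw [h, hm, LocalizedModule.zero_mk]
  rfl

end ShortExact

variable {X Y : Type*} [AddCommGroup X] [Module B X] [AddCommGroup Y] [Module B Y]

/-- The grading which a submodule inherits. -/
def subGrading (gr : ℤ → AddSubgroup X) (Z : Submodule B X) (d : ℤ) : AddSubgroup Z :=
  (gr d).comap Z.subtype.toAddMonoidHom

instance gradedSMul_subGrading (gr : ℤ → AddSubgroup X) [SetLike.GradedSMul 𝒜 gr]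
    (Z : Submodule B X) : SetLike.GradedSMul 𝒜 (subGrading gr Z) where
  smul_mem := fun _ _ _ z hb hz => grSmul_mem 𝒜 gr (m := (z : X)) hb hz

theorem GrIndep.subGrading {gr : ℤ → AddSubgroup X} (h : GrIndep gr) (Z : Submodule B X) :
    GrIndep (subGrading gr Z) :=
  h.of_injective Z.subtype.toAddMonoidHom Z.subtype_injective fun _ _ hz => hz

theorem GrSpan.subGrading_ker {gr : ℤ → AddSubgroup X} {gr' : ℤ → AddSubgroup Y} (h : GrSpan gr)
    (h' : GrIndep gr') (f : X →ₗ[B] Y) (hf : ∀ d, ∀ z ∈ gr d, f z ∈ gr' d) :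
    GrSpan (subGrading gr (LinearMap.ker f)) := by
  rintro ⟨y, hy⟩
  obtain ⟨c, hc, hc0, rfl⟩ := exists_components_of_map_eq_zero h h' f.toAddMonoidHom hf hy
  have h1 : (⟨c.sum fun _ z => z, hy⟩ : LinearMap.ker f) =
      ∑ d ∈ c.support, ⟨c d, hc0 d⟩ := Subtype.ext (by
    rw [AddSubmonoidClass.coe_finsetSum]; rfl)
  rw [h1]
  exact sum_mem fun d _ => AddSubgroup.mem_iSup_of_mem d (hc d)

variable (gr : ℤ → AddSubgroup X) [SetLike.GradedSMul 𝒜 gr] (gr' : ℤ → AddSubgroup Y)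
  [SetLike.GradedSMul 𝒜 gr']

theorem CechVanishAt.ker_of_range (hx : ∀ a, ∃ d : ℤ, x a ∈ 𝒜 d) (hX : GrSpan gr)
    (hX' : GrIndep gr) (f : X →ₗ[B] Y) (hf : ∀ d, ∀ z ∈ gr d, f z ∈ gr' d) {p : ℕ} {e : ℤ}
    (hR : CechVanishAt 𝒜 (x := x) (subGrading gr' (LinearMap.range f)) p e)
    (hXe : CechVanishAt 𝒜 (x := x) gr (p + 1) e) :
    CechVanishAt 𝒜 (x := x) (subGrading gr (LinearMap.ker f)) (p + 1) e := by
  refine CechVanishAt.succ_of_exact 𝒜 _ gr _ hx hX hX' (LinearMap.ker f).subtype_injective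
    f.surjective_rangeRestrict ?_ (fun _ _ hz => hz) (fun d z hz => hf d z hz) hR hXe
  intro z
  rw [← LinearMap.mem_ker, LinearMap.ker_rangeRestrict]
  exact ⟨fun hz => ⟨⟨z, hz⟩, rfl⟩, by rintro ⟨z, rfl⟩; exact z.2⟩

theorem CechVanishAt.sub_of_subquot (hx : ∀ a, ∃ d : ℤ, x a ∈ 𝒜 d) {Z D : Submodule B X}
    (hDZ : D ≤ Z) (hZ : GrSpan (subGrading gr Z)) (hX : GrIndep gr) {p : ℕ} {e : ℤ}
    (hQ : CechVanishAt 𝒜 (x := x) (subquotGrading gr Z D) p e)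
    (hZe : CechVanishAt 𝒜 (x := x) (subGrading gr Z) (p + 1) e) :
    CechVanishAt 𝒜 (x := x) (subGrading gr D) (p + 1) e := by
  refine CechVanishAt.succ_of_exact 𝒜 _ (subGrading gr Z) (subquotGrading gr Z D) hx hZ (hX.subGrading Z)
    (Submodule.inclusion_injective hDZ) (Submodule.mkQ_surjective (D.submoduleOf Z)) ?_
    (fun _ _ hz => hz) (fun d z hz => ⟨z, hz, rfl⟩) hQ hZe
  intro z
  rw [← LinearMap.mem_ker, Submodule.ker_mkQ]
  exact ⟨fun hz => ⟨⟨z, hz⟩, rfl⟩, by rintro ⟨z, rfl⟩; exact z.2⟩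

end Sub

/-! ### Nilpotence modulo an ideal of dimension zero -/

/-- `B / I` is Artinian, so for `b` homogeneous of degree `d > 0` one has `b^N ≡ b^{N+1} c` modulo
`I`. In degree `N d` the right side is `b^{N+1}` times the component of `c` of degree `-d`, which is
zero; hence `b^N ∈ I`. -/
theorem irrelevantIdeal_le_radical {k : Type w} [Field k] {B : Type u} [CommRing B] [Algebra k B]
    [IsNoetherianRing B] (𝒜 : ℤ → Submodule k B) [GradedAlgebra 𝒜] (h𝒜 : ∀ d < 0, 𝒜 d = ⊥)
    {I : Ideal B} (hI : I.IsHomogeneous 𝒜) (hdim : ringKrullDim (B ⧸ I) = 0) :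
    irrelevantIdeal 𝒜 ≤ I.radical := by
  have : Ring.KrullDimLE 0 (B ⧸ I) := Ring.krullDimLE_iff.2 hdim.le
  have : IsArtinianRing (B ⧸ I) :=
    isArtinianRing_iff_isNoetherianRing_krullDimLE_zero.2 ⟨inferInstance, this⟩
  refine Ideal.span_le.2 ?_
  rintro b ⟨d, hd, hb⟩
  obtain ⟨N, c, hc⟩ := IsArtinian.exists_pow_succ_smul_dvd (Ideal.Quotient.mk I b)
    (1 : B ⧸ I)
  obtain ⟨c, rfl⟩ := Ideal.Quotient.mk_surjective c
  rw [smul_eq_mul, smul_eq_mul, mul_one, ← map_pow, ← map_pow, ← map_mul, Ideal.Quotient.eq] at hc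
  have hpow : ∀ m : ℕ, b ^ m ∈ 𝒜 (m • d) := fun m => SetLike.pow_mem_graded m hb
  have h1 := hI (N • d) hc
  have h2 : (DirectSum.decompose 𝒜 (b ^ (N + 1) * c) (N • d) : B) = 0 := by
    have h3 : N • d = (N + 1) • d + -d := by rw [succ_nsmul]; ring
    have h4 : (DirectSum.decompose 𝒜 c (-d) : B) = 0 := (Submodule.mem_bot k).1
      ((h𝒜 _ (neg_lt_zero.2 hd)).le (SetLike.coe_mem (DirectSum.decompose 𝒜 c (-d))))
    rw [h3, DirectSum.coe_decompose_mul_add_of_left_mem 𝒜 (hpow (N + 1)), h4, mul_zero]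
  rw [DirectSum.decompose_sub, DFinsupp.sub_apply, AddSubgroupClass.coe_sub, h2,
    DirectSum.decompose_of_mem_same 𝒜 (hpow N), zero_sub, neg_mem_iff] at h1
  exact ⟨N, h1⟩

theorem IsCechFamily.exists_pow_mem {k : Type w} [Field k] {B : Type u} [CommRing B] [Algebra k B]
    {𝒜 : ℤ → Submodule k B} {r : ℕ} {x : Fin r → B} (hx : IsCechFamily 𝒜 x) {I : Ideal B}
    (hI : irrelevantIdeal 𝒜 ≤ I.radical) (a : Fin r) : ∃ K : ℕ, x a ^ K ∈ I :=
  hI (hx.radical_eq ▸ Ideal.le_radical (Ideal.subset_span ⟨a, rfl⟩))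

theorem cechVanish_of_lt_lcDepth {B : Type u} [CommRing B] {r : ℕ} {x : Fin r → B} {M : Type v}
    [AddCommGroup M] [Module B M] {p : ℕ} (h : (p : ℕ∞) < lcDepth x M) : CechVanish x M p := by
  have : Subsingleton (LocCoh x M p) := by
    rw [← not_nontrivial_iff_subsingleton]
    exact fun hn => h.not_ge (iInf₂_le p hn)
  intro α hα
  have h1 : (Submodule.Quotient.mk ⟨α, hα⟩ : LocCoh x M p) = 0 := Subsingleton.elim _ _
  rw [Submodule.Quotient.mk_eq_zero] at h1
  exact h1

/-! ### Local cohomology of the cycles of a complex -/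

section Complex

variable {k : Type w} [Field k] {B : Type u} [CommRing B] [Algebra k B]
  {𝒜 : ℤ → Submodule k B} [GradedAlgebra 𝒜] {r : ℕ} {x : Fin r → B}
  {L : ChainComplex (ModuleCat.{v} B) ℤ}

theorem boundaries_le_cycles (j : ℤ) : boundaries L j ≤ cycles L j := by
  rintro _ ⟨y, rfl⟩
  exact congrArg (fun f => f.hom y) (L.d_comp_d (j + 1) j (j - 1))

theorem range_d_eq_boundaries (j : ℤ) :
    LinearMap.range (L.d j (j - 1)).hom = boundaries L (j - 1) := by
  have h : ∀ a, a = j - 1 + 1 → LinearMap.range (L.d a (j - 1)).hom = boundaries L (j - 1) := by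
    rintro _ rfl
    rfl
  exact h j (by ring)

variable (ℒ : (j : ℤ) → ℤ → AddSubgroup (L.X j)) [∀ j, SetLike.GradedSMul 𝒜 (ℒ j)]

/-- Pass from `H^p(Z_j)` to `H^{p-1}` of the boundaries in `L_{j-1}`, then to `H^{p-2}(H_{j-1})` and
`H^{p-1}(Z_{j-1})`. Both indices drop by one, and the homology contributes only through `H^0`, that
is, when `p` has come down to `2`. Hence only `H_{j-p+1}` matters. -/
theorem cechVanishAt_cycles [Nontrivial B] (hx : ∀ a, ∃ d : ℤ, x a ∈ 𝒜 d) (hspan : ∀ j, GrSpan (ℒ j))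
    (hindep : ∀ j, GrIndep (ℒ j)) (hd : ∀ a b d : ℤ, ∀ y ∈ ℒ a d, (L.d a b).hom y ∈ ℒ b d)
    {i : ℤ} {n : ℕ} (hdepth : ∀ j ≤ i, ∀ p < n, CechVanish x (L.X j) p)
    (htors : ∀ j ≤ i, ∀ (a : Fin r) (h : Homology L j), ∃ K : ℕ, x a ^ K • h = 0) (d : ℤ) (p : ℕ)
    (hp : p ≤ n) {j : ℤ} (hj : j ≤ i)
    (hH : 2 ≤ p → ∀ j' : ℤ, j' + p = j + 1 →
      subquotGrading (ℒ j') (cycles L j') (boundaries L j') d = ⊥)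
    (hL : CechVanishAt 𝒜 (x := x) (ℒ j) p d) :
    CechVanishAt 𝒜 (x := x) (subGrading (ℒ j) (cycles L j)) p d := by
  induction p generalizing j with
  | zero =>
    exact CechVanishAt.zero_of_injective 𝒜 _ (ℒ j) (cycles L j).subtype_injective
      (fun _ _ hz => hz) hL
  | succ p ih =>
    refine CechVanishAt.ker_of_range 𝒜 (ℒ j) (ℒ (j - 1)) hx (hspan j) (hindep j) _ (hd j (j - 1))
      ?_ hL
    rw [range_d_eq_boundaries]
    cases p with
    -- Here `n ≥ 1`, and the boundaries embed in `L_{j-1}`, which has no `H^0`.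
    | zero =>
      exact CechVanishAt.zero_of_injective 𝒜 _ (ℒ (j - 1)) (boundaries L (j - 1)).subtype_injective
        (fun _ _ hz => hz) fun α _ hα => hdepth (j - 1) (by omega) 0 (by omega) α hα
    | succ q =>
      refine CechVanishAt.sub_of_subquot 𝒜 (ℒ (j - 1)) hx (boundaries_le_cycles (j - 1))
        ((hspan (j - 1)).subGrading_ker (hindep (j - 1 - 1)) _ (hd _ _)) (hindep _) ?_
        (ih (by omega) (by omega) (fun _ j' hj' => hH (by omega) j' (by push_cast at hj' ⊢; omega))
          fun α _ hα => hdepth (j - 1) (by omega) (q + 1) (by omega) α hα)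
      cases q with
      | zero =>
        exact cechVanishAt_zero_of_eq_bot 𝒜 _ (hH le_rfl (j - 1) (by push_cast; ring))
      | succ q =>
        -- The homology is torsion, so it has no Čech cochains in positive degree.
        have := subsingleton_cech_succ x q (htors (j - 1) (by omega))
        intro α _ _
        rw [Subsingleton.elim α 0]
        exact zero_mem _

/-- A degree of `H_i` is the sum of a degree of `H^n(L_i)` and a degree of `Tor_n(B / I, k)`, or of
a degree of some `H_j` with `j < i` and a degree of `Tor_{i-j}(I, k)`. -/
theorem exists_degree_of_homology_ne_bot [Nontrivial B] [IsNoetherianRing B] (h𝒜 : ∀ d < 0, 𝒜 d = ⊥)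
    (h0 : 𝒜 0 = 1) (hx : IsCechFamily 𝒜 x) (hspan : ∀ j, GrSpan (ℒ j))
    (hindep : ∀ j, GrIndep (ℒ j)) (hd : ∀ a b d : ℤ, ∀ y ∈ ℒ a d, (L.d a b).hom y ∈ ℒ b d)
    {i : ℤ} {n : ℕ} (hn : ringKrullDim B = n)
    (hdepth : ∀ j ≤ i, ∀ p < n, CechVanish x (L.X j) p) {I : Ideal B} (hI : I.IsHomogeneous 𝒜)
    (hxI : ∀ a, ∃ K : ℕ, x a ^ K ∈ I) (hIH : ∀ j ≤ i, ∀ a ∈ I, ∀ h : Homology L j, a • h = 0)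
    {e : ℤ} (he : subquotGrading (ℒ i) (cycles L i) (boundaries L i) e ≠ ⊥) :
    (∃ d, subquotGrading (cechGrading x 𝒜 (ℒ i) n) (LinearMap.ker (cechDiff x (L.X i) n))
        (cechBoundaries x (L.X i) n) d ≠ ⊥ ∧
      torGrading 𝒜 (quotientGrading 𝒜 I) n (e - d) ≠ ⊥) ∨
    ∃ j < i, ∃ d, subquotGrading (ℒ j) (cycles L j) (boundaries L j) d ≠ ⊥ ∧
      torGrading 𝒜 (idealGrading 𝒜 I) (i - j).toNat (e - d) ≠ ⊥ := by
  contrapose! he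
  obtain ⟨h1, h2⟩ := he
  have htors : ∀ j ≤ i, ∀ (a : Fin r) (h : Homology L j), ∃ K : ℕ, x a ^ K • h = 0 :=
    fun j hj a h => (hxI a).imp fun K hK => hIH j hj _ hK h
  refine subquotGrading_eq_bot_iff.2 fun y hy hye => ?_
  -- It suffices to place the cycle in `I Z`, because `I H_i = 0` puts `I Z` inside the boundaries.
  have hmem : (⟨y, hy⟩ : cycles L i) ∈ I • (⊤ : Submodule B (cycles L i)) := by
    refine mem_ideal_smul_top_of_torVanishAt (subGrading (ℒ i) (cycles L i)) hx h𝒜 h0 hI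
      ((hspan i).subGrading_ker (hindep (i - 1)) _ (hd _ _)) ((hindep i).subGrading _) hxI
      (e := e) (fun p d hpd => ?_) hye
    have hpn : p ≤ n := by
      by_contra hlt
      refine hpd fun α _ hα => cechVanish_of_ringKrullDim_lt x ?_ α hα
      rw [hn]
      exact_mod_cast not_le.1 hlt
    by_cases hL : CechVanishAt 𝒜 (x := x) (ℒ i) p d
    · by_cases hH : 2 ≤ p ∧ ∃ j : ℤ, j + p = i + 1 ∧
          subquotGrading (ℒ j) (cycles L j) (boundaries L j) d ≠ ⊥
      · obtain ⟨hp, j, hj, hjd⟩ := hH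
        obtain ⟨p, rfl⟩ := Nat.exists_eq_add_of_le' hp
        -- With `p + 2` in place of `p`, the relation `j + (p + 2) = i + 1` reads `i - j = p + 1`,
        -- the index of the Tor of `I`.
        refine idealRes_torVanishAt_succ 𝒜 h𝒜 h0 hI ?_
        have h3 := h2 j (by push_cast at hj; omega) d hjd
        rwa [show (i - j).toNat = p + 1 by push_cast at hj; omega] at h3
      · push Not at hH
        exact absurd (cechVanishAt_cycles ℒ hx.homogeneous hspan hindep hd hdepth htors d p hpn
          le_rfl hH hL) hpd
    -- By depth, only the top local cohomology of `L_i` can be nonzero here; this is the term with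
    -- `t_n(B / I)`.
    · obtain rfl : p = n := by
        refine hpn.antisymm (not_lt.1 fun hlt => hL fun α _ hα => hdepth i le_rfl p hlt α hα)
      refine idealRes_torVanishAt_of_quotient 𝒜 h𝒜 h0 hI (h1 d fun h3 => hL fun α hα hα0 => ?_)
      exact subquotGrading_eq_bot_iff.1 h3 α hα0 hα
  have hle : I • (⊤ : Submodule B (cycles L i)) ≤ (boundaries L i).submoduleOf (cycles L i) :=
    Submodule.smul_le.2 fun a ha z _ => (Submodule.Quotient.mk_eq_zero _).1
      (hIH i le_rfl a ha (Submodule.Quotient.mk z))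
  exact hle hmem

end Complex

/-! ### Assembling the degrees -/

theorem le_gradedEnd {M : Type v} [AddCommGroup M] {gr : ℤ → AddSubgroup M} {d : ℤ}
    (h : gr d ≠ ⊥) : ((d : ℝ) : EReal) ≤ gradedEnd gr :=
  le_iSup₂ (f := fun (d : ℤ) (_ : gr d ≠ ⊥) => ((d : ℝ) : EReal)) d h

/-- Unwinding a recursion which either stops or descends by a positive block. -/
theorem exists_blocks_of_descent {H N : ℤ → ℤ → Prop} {T : ℤ → Prop} {W : ℕ → ℤ → Prop}
    {t : ℕ → EReal} (ht : ∀ b d, W b d → ((d : ℝ) : EReal) ≤ t b) {i j₀ : ℤ}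
    (hH : ∀ j ≤ j₀, ∀ e, ¬ H j e)
    (hstep : ∀ j ≤ i, ∀ e, H j e → (∃ d, N j d ∧ T (e - d)) ∨
      ∃ j' < j, ∃ d, H j' d ∧ W (j - j').toNat (e - d)) (m : ℕ) {j : ℤ} (hj : j ≤ i)
    (hm : j ≤ j₀ + m) {e : ℤ} (he : H j e) :
    ∃ j' ≤ j, ∃ (d u s : ℤ) (l : List ℕ), N j' d ∧ T u ∧ e = d + s + u ∧ (∀ b ∈ l, 0 < b) ∧
      (l.sum : ℤ) = j - j' ∧ ((s : ℝ) : EReal) ≤ (l.map t).sum := by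
  induction m generalizing j e with
  | zero => exact absurd he (hH j (by simpa using hm) e)
  | succ m ih =>
    rcases hstep j hj e he with ⟨d, hd, hT⟩ | ⟨j', hj', d, hd, hW⟩
    -- The descent stops: no blocks, and their total degree `s` is `0`.
    · exact ⟨j, le_rfl, d, e - d, 0, [], hd, hT, by ring, by simp, by simp, by simp⟩
    · obtain ⟨j'', hj'', d', u, s, l, h1, h2, h3, h4, h5, h6⟩ :=
        ih (hj'.le.trans hj) (by push_cast at hm; omega) hd
      refine ⟨j'', by omega, d', u, (e - d) + s, (j - j').toNat :: l, h1, h2, by rw [h3]; ring,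
        ?_, ?_, ?_⟩
      · rintro b hb
        rcases List.mem_cons.1 hb with rfl | hb
        · omega
        · exact h4 b hb
      · rw [List.sum_cons, Nat.cast_add, h5]; omega
      · rw [List.map_cons, List.sum_cons, Int.cast_add, EReal.coe_add]
        exact add_le_add (ht _ _ hW) h6

theorem sum_map_torEnd_le_maxTorSum {k : Type w} [Field k] {B : Type u} [CommRing B] [Algebra k B]
    (𝒜 : ℤ → Submodule k B) (I : Ideal B) {j : ℤ} (hj : 0 < j) {l : List ℕ}
    (hl : ∀ b ∈ l, 0 < b) (hsum : (l.sum : ℤ) = j) :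
    (l.map (torEnd 𝒜 (idealGrading 𝒜 I))).sum ≤ maxTorSum 𝒜 I j := by
  rw [maxTorSum, if_pos hj]
  exact le_iSup (fun c : Composition j.toNat => (c.blocks.map (torEnd 𝒜 (idealGrading 𝒜 I))).sum)
    ⟨l, fun {b} hb => hl b hb, by omega⟩

end GradedHomology

/-! ### The theorem -/

open GradedHomology in
theorem theorem4p4 {k : Type w} [Field k] {B : Type u} [CommRing B] [Nontrivial B] [Algebra k B]
    [IsNoetherianRing B]
    (𝒜 : ℤ → Submodule k B) [GradedAlgebra 𝒜]
    (h𝒜_nonneg : ∀ d < 0, 𝒜 d = ⊥) (h𝒜_zero : 𝒜 0 = 1)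
    (n : ℕ) (hn : ringKrullDim B = n)
    {r : ℕ} (x : Fin r → B) (hx : IsCechFamily 𝒜 x)
    (L : ChainComplex (ModuleCat.{v} B) ℤ) (ℒ : (j : ℤ) → ℤ → AddSubgroup (L.X j))
    [∀ j, DirectSum.Decomposition (ℒ j)] [∀ j, SetLike.GradedSMul 𝒜 (ℒ j)]
    (hd : ∀ (a b d : ℤ), ∀ y ∈ ℒ a d, (L.d a b).hom y ∈ ℒ b d)
    (i : ℤ)
    (hdepth : ∀ j ≤ i, (n : ℕ∞) ≤ lcDepth x (L.X j))
    (hbelow : ∀ j ≤ i, ∃ c : ℤ, ∀ d < c, ℒ j d = ⊥)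
    (I : Ideal B) (hI : I.IsHomogeneous 𝒜) (hIdim : ringKrullDim (B ⧸ I) = 0)
    (hIH : ∀ j ≤ i, ∀ a ∈ I, ∀ h : Homology L j, a • h = 0)
    (hH : ∃ j₀ : ℤ, ∀ j ≤ j₀, Subsingleton (Homology L j)) :
    homologyEnd L ℒ i ≤
      max (locCohEnd x 𝒜 (ℒ i) n)
          (⨆ (j : ℤ) (_ : j < i), (locCohEnd x 𝒜 (ℒ j) n + maxTorSum 𝒜 I (i - j)))
        + torEnd 𝒜 (quotientGrading 𝒜 I) n := by
  have hspan : ∀ j, GrSpan (ℒ j) := fun j => grSpan_of_decomposition (ℒ j) fun _ _ => Iff.rfl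
  have hindep : ∀ j, GrIndep (ℒ j) := fun j => grIndep_of_decomposition (ℒ j) fun _ _ => Iff.rfl
  have hcech : ∀ j ≤ i, ∀ p < n, CechVanish x (L.X j) p := fun j hj p hp =>
    cechVanish_of_lt_lcDepth ((Nat.cast_lt.2 hp).trans_le (hdepth j hj))
  have hxI := hx.exists_pow_mem (irrelevantIdeal_le_radical 𝒜 h𝒜_nonneg hI hIdim)
  obtain ⟨j₀, hj₀⟩ := hH
  refine iSup₂_le fun e he => ?_
  obtain ⟨j, hj, d, u, s, l, hN, hT, rfl, hl, hsum, hs⟩ := exists_blocks_of_descent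
    (H := fun j e => subquotGrading (ℒ j) (cycles L j) (boundaries L j) e ≠ ⊥)
    (N := fun j d => subquotGrading (cechGrading x 𝒜 (ℒ j) n)
      (LinearMap.ker (cechDiff x (L.X j) n)) (cechBoundaries x (L.X j) n) d ≠ ⊥)
    (T := fun u => torGrading 𝒜 (quotientGrading 𝒜 I) n u ≠ ⊥)
    (W := fun b d => torGrading 𝒜 (idealGrading 𝒜 I) b d ≠ ⊥)
    (fun b d h => le_gradedEnd h) (i := i) (j₀ := j₀)
    (fun j hj e he => by
      have := hj₀ j hj
      exact he (Subsingleton.elim _ _))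
    (fun j hj e he => exists_degree_of_homology_ne_bot ℒ h𝒜_nonneg h𝒜_zero hx hspan hindep hd hn
      (fun j' hj' => hcech j' (hj'.trans hj)) hI hxI (fun j' hj' => hIH j' (hj'.trans hj)) he)
    -- Fuel for the descent: each step lowers `j` by at least one, and the homology vanishes from
    -- `j₀` downwards.
    (i - j₀).toNat le_rfl (by omega) he
  rw [Int.cast_add, EReal.coe_add, Int.cast_add, EReal.coe_add]
  refine add_le_add ?_ (le_gradedEnd hT)
  rcases hj.eq_or_lt with rfl | hlt
  · refine le_max_of_le_left ?_
    -- Positive blocks with sum `0`: there are none, so no degree of a Tor of `I` enters.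
    have hl0 : l = [] := List.eq_nil_iff_forall_not_mem.2 fun b hb => by
      have := List.le_sum_of_mem hb
      have := hl b hb
      omega
    rw [hl0, List.map_nil, List.sum_nil] at hs
    exact (add_le_add (le_gradedEnd hN) hs).trans_eq (add_zero _)
  · refine le_max_of_le_right (le_trans ?_ (le_iSup₂ (f := fun (j : ℤ) (_ : j < i) =>
      locCohEnd x 𝒜 (ℒ j) n + maxTorSum 𝒜 I (i - j)) j hlt))
    exact add_le_add (le_gradedEnd hN)
      (hs.trans (sum_map_torEnd_le_maxTorSum 𝒜 I (sub_pos.2 hlt) hl hsum))
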